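/- **Setting.** Let $\mathcal X$ be an open subset of $\mathbb R^D$ (continuous case, reference measure: Lebesgue measure) or $\mathcal X=\{0,\dots,L-1\}^D$ with $L>1$ (discrete case, reference measure: counting measure). In the continuous case let $\nabla=\nabla^*$ be the gradient; in the discrete case let $\nabla=\Delta$ be the vector of cyclic forward differences $\Delta_d f(x)=f(\dots,x^d+1 \bmod L,\dots)-f(x)$ and $\nabla^*=\Delta^{-1}$ the vector of cyclic backward differences $\Delta_d^{-1}f(x)=f(x)-f(\dots,x^d-1\bmod L,\dots)$. The score of a positive density $p$ is $s_p(x)=p(x)^{-1}\nabla p(x)$, and its Stein operator is $A_Pf(x)=\sum_{d=1}^D\bigl(s_{p}(x)_d f_d(x)+\nabla^*_d f_d(x)\bigr)$. Let $\mathcal H$ be a reproducing kernel Hilbert space of real functions on $\mathcal X$ with kernel $k$; in the continuous case $k\in C^{(1,1)}$, i.e. $k$, $\partial_{x_d}k(x,x')$ and $\partial_{x'_e}\partial_{x_d}k(x,x')$ exist and are continuous on $\mathcal X\times\mathcal X$. With $\|f\|^2=\sum_d\|f_d\|_{\mathcal H}^2$ on $\mathcal H^D$, the kernel Stein discrepancy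 of a probability measure $R$ from the distribution $P$ with density $p$ is $$\mathrm{KSD}_p(R)=\sup_{f\in\mathcal H^D,\ \|f\|\le 1}\bigl|\mathbb E_{x\sim R}A_Pf(x)-\mathbb E_{y\sim P}A_Pf(y)\bigr| .$$ For points $x,x'$ and vectors $u,v\in\mathbb R^D$ put $h(x,u;x',v)=u^\top v\,k(x,x')+u^\top k_1(x',x)+k_1(x,x')^\top v+\mathrm{tr}\,k_{12}(x,x')$, where $k_1$ is $\nabla^*$ applied to the first argument of $k$ and $k_{12}$ is $\nabla^*$ applied to both arguments. The Stein kernel of $p$ is $h_p(x,x')=h(x,s_p(x);x',s_p(x'))$. Consider two latent variable models: $P$ with prior $P_Z$ on a Polish space $\mathcal Z$, strictly positive, jointly measurable likelihoods $p(x|z)$ that are probability densities in $x$, finite marginal density $p(x)=\int p(x|z)\,dP_Z(z)$ and posterior $P_Z(dz|x)=\frac{p(x|z)}{p(x)}P_Z(dz)$; and $Q$ with prior $Q_W$ on a Polish space $\mathcal W$, likelihoods $q(x|w)$, marginal density $q$ and posterior $Q_W(dw|x)$, under the same conditions. In the continuous case assume moreover that $p(\cdot|z)$ and $p$ are differentiable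 with $\nabla p(x)=\int\nabla_xp(x|z)\,dP_Z(z)$ (absolutely convergent), that $\int_{\mathcal X}\partial_d(pf)\,dx=0$ (with integrable integrand) for all $f\in\mathcal H$ and $d\le D$, so that $\mathbb E_{y\sim P}A_Pf(y)=0$ for all $f\in\mathcal H^D$, and the same for $Q$. Let $R$ be a probability measure on $\mathcal X$ (the data distribution) with $\mathbb E_{x\sim R}h_p(x,x)<\infty$ and $\mathbb E_{x\sim R}h_q(x,x)<\infty$. With $H_p[(x,z),(x',z')]=h(x,s_p(x|z);x',s_p(x'|z'))$, where $s_p(x|z)$ is the score of $p(\cdot|z)$, assume that $|H_p|$ has finite expectation when $(x,z),(x',z')$ are independent with law $P_Z(dz|x)R(dx)$, and likewise for $Q$. Put $\mu_{P,Q}=\mathrm{KSD}_p(R)^2-\mathrm{KSD}_q(R)^2$. **Statistics.** Fix $m\ge1$. For $\mathbf z\in\mathcal Z^m$ let $\bar s_p(x|\mathbf z)=\frac1m\sum_{j=1}^m s_p(x|z_j)$ and $\bar H_p[(x,\mathbf z),(x',\mathbf z')]=h(x,\bar s_p(x|\mathbf z);x',\bar s_p(x'|\mathbf z'))$; define $\bar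 H_q$ likewise and put $$\bar H_{p,q}[(x,\mathbf z,\mathbf w),(x',\mathbf z',\mathbf w')]=\bar H_p[(x,\mathbf z),(x',\mathbf z')]-\bar H_q[(x,\mathbf w),(x',\mathbf w')].$$ Let $\gamma_t$ be the law of $(x,\mathbf z^{(t)},\mathbf w^{(t)})$, where $x\sim R$ and, given $x$, $(\mathbf z^{(t)},\mathbf w^{(t)})\in\mathcal Z^m\times\mathcal W^m$ is drawn from a probability kernel (e.g. the output of Markov chain samplers targeting $P_Z(\cdot|x)$ and $Q_W(\cdot|x)$ after $t$ burn-in steps). Let $\gamma$ be a probability measure on $\mathcal X\times\mathcal Z^m\times\mathcal W^m$ under which, for every $j$, $(x,z_j)$ has law $P_Z(dz|x)R(dx)$ and $(x,w_j)$ has law $Q_W(dw|x)R(dx)$. For each $t$ let $y_i^{(t)}=(x_i,\mathbf z_i^{(t)},\mathbf w_i^{(t)})$, $i\ge1$, be i.i.d. with law $\gamma_t$. With $h=\bar H_{p,q}$ let $$U_n^{(t)}(P,Q)=\frac1{n(n-1)}\sum_{i\ne j}h(y_i^{(t)},y_j^{(t)}),\qquad \sigma_{n,t}=\sqrt{4\tfrac{n-2}{n-1}\bigl(\hat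 A^V_{n,t}-\hat B^V_{n,t}\bigr)},$$ $$\hat A^V_{n,t}=\frac1{n^3}\sum_{i_1,i_2,i_3=1}^n h_a(y^{(t)}_{i_1},y^{(t)}_{i_2},y^{(t)}_{i_3}),\qquad \hat B^V_{n,t}=\frac1{n^4}\sum_{i_1,\dots,i_4=1}^n h_b(y^{(t)}_{i_1},\dots,y^{(t)}_{i_4}),$$ where $h_a(y_1,y_2,y_3)=\frac13\{h(y_1,y_2)h(y_1,y_3)+h(y_2,y_1)h(y_2,y_3)+h(y_3,y_1)h(y_3,y_2)\}$ and $h_b(y_1,\dots,y_4)=\frac13\{h(y_1,y_2)h(y_3,y_4)+h(y_1,y_3)h(y_2,y_4)+h(y_1,y_4)h(y_2,y_3)\}$. Put $T_{n,t}=\sqrt n\,U_n^{(t)}(P,Q)/\sigma_{n,t}$. **Assumptions.** Let $\theta_t=\mathbb E_{\gamma_t\otimes\gamma_t}[h]$ and $\theta=\mathbb E_{\gamma\otimes\gamma}[h]$. Fix a way of letting $n,t\to\infty$: a filter on $\mathbb N\times\mathbb N$ along which both $n\to\infty$ and $t\to\infty$ (for instance the unrestricted double limit, or $n\to\infty$ with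 $t=t(n)\to\infty$). Assume 1. $\limsup_{t\to\infty}\mathbb E_{\gamma_t\otimes\gamma_t}\bigl[|h-\theta_t|^3\bigr]^{1/3}<\infty$; 2. $\sigma_t^2=4\,\mathrm{Var}_{Y'\sim\gamma_t}\bigl[\mathbb E_{Y\sim\gamma_t}h(Y,Y')\bigr]\to\sigma_{P,Q}^2$ as $t\to\infty$ with $\sigma_{P,Q}>0$; 3. $\sqrt n\,(\theta_t-\theta)\to0$ in the chosen limit; 4. $\limsup_{t\to\infty}\mathbb E\bigl[\bar H_p[y_1^{(t)},y_1^{(t)}]^2\bigr]<\infty$, $\ \limsup_{t\to\infty}\mathbb E\bigl[\bar H_q[y_1^{(t)},y_1^{(t)}]^2\bigr]<\infty$ and $\limsup_{t\to\infty}\mathbb E\bigl[\bar H_{p,q}[y_1^{(t)},y_2^{(t)}]^4\bigr]<\infty$. **Conclusion.** In the chosen limit $n,t\to\infty$, $$\frac{\sqrt n\,\bigl(U_n^{(t)}(P,Q)-\mu_{P,Q}\bigr)}{\sigma_{n,t}}\ \xrightarrow{\ d\ }\ N(0,1).$$ Moreover, for $\alpha\in(0,1)$ let $\tau_{1-\alpha}$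 be the $(1-\alpha)$-quantile of $N(0,1)$. If $\mathrm{KSD}_p(R)\le\mathrm{KSD}_q(R)$ (hypothesis $H_0$), then $\lim \Pr(T_{n,t}>\tau_{1-\alpha})$ exists and is at most $\alpha$; if $\mathrm{KSD}_p(R)>\mathrm{KSD}_q(R)$ (hypothesis $H_1$), then $\lim\Pr(T_{n,t}>\tau_{1-\alpha})=1$. -/

import Mathlib

open MeasureTheory ProbabilityTheory Filter
open scoped Topology ENNReal

noncomputable section

/-! ### Data spaces and their difference operators -/

/-- The space in which the observations live: an open subset of `ℝᴰ`, or the finite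
lattice `{0, …, L - 1}ᴰ` with `L > 1`. -/
inductive DataSpace (D : ℕ) : Type
  | euclidean (X : TopologicalSpace.Opens (EuclideanSpace ℝ (Fin D))) : DataSpace D
  | lattice (L : ℕ) (hL : 1 < L) : DataSpace D

/-- The partial derivative `∂f/∂x^d` at `x` of a function on an open subset of `ℝᴰ`. The function
is extended by zero; as `X` is open, the values of the extension outside `X` do not matter. -/
def partialDeriv {D : ℕ} {X : TopologicalSpace.Opens (EuclideanSpace ℝ (Fin D))}
    (d : Fin D) (f : X → ℝ) (x : X) : ℝ :=
  lineDeriv ℝ (Function.extend (Subtype.val : X → EuclideanSpace ℝ (Fin D)) f 0) x.1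
    (EuclideanSpace.single d (1 : ℝ))

/-- The partial derivative `∂f/∂x^d` at `x` exists. -/
def HasPartialDeriv {D : ℕ} {X : TopologicalSpace.Opens (EuclideanSpace ℝ (Fin D))}
    (d : Fin D) (f : X → ℝ) (x : X) : Prop :=
  LineDifferentiableAt ℝ (Function.extend (Subtype.val : X → EuclideanSpace ℝ (Fin D)) f 0) x.1
    (EuclideanSpace.single d (1 : ℝ))

/-- Differentiability of a function on an open subset of `ℝᴰ`. -/
def IsDifferentiable {D : ℕ} {X : TopologicalSpace.Opens (EuclideanSpace ℝ (Fin D))}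
    (f : X → ℝ) : Prop :=
  ∀ x : X, DifferentiableAt ℝ
    (Function.extend (Subtype.val : X → EuclideanSpace ℝ (Fin D)) f 0) x.1

/-- The cyclic shift `x^d ↦ x^d + s mod L` of the `d`-th coordinate. -/
def cyclicShift {D L : ℕ} (hL : 1 < L) (s : ℕ) (d : Fin D) (x : Fin D → Fin L) : Fin D → Fin L :=
  Function.update x d ⟨((x d : ℕ) + s) % L, Nat.mod_lt _ (by omega)⟩

/-- Lebesgue measure on an open subset of `ℝᴰ`. -/
def lebesgueOn {D : ℕ} (X : TopologicalSpace.Opens (EuclideanSpace ℝ (Fin D))) : Measure X :=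
  Measure.comap (Subtype.val : X → EuclideanSpace ℝ (Fin D)) volume

namespace DataSpace

variable {D : ℕ}

/-- The points of the data space. -/
def Point : DataSpace D → Type
  | euclidean X => X
  | lattice L _ => Fin D → Fin L

/-- The Borel `σ`-algebra. -/
instance (S : DataSpace D) : MeasurableSpace S.Point :=
  match S with
  | euclidean X => inferInstanceAs (MeasurableSpace X)
  | lattice L _ => inferInstanceAs (MeasurableSpace (Fin D → Fin L))

/-- Densities are taken with respect to Lebesgue measure, respectively counting measure. -/
def refMeasure (S : DataSpace D) : Measure S.Point :=
  match S with
  | euclidean X => lebesgueOn X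
  | lattice L _ => (Measure.count : Measure (Fin D → Fin L))

/-- The operator in the score: `∂/∂x^d`, respectively the cyclic forward difference
`Δ_d f(x) = f(…, x^d + 1 mod L, …) - f(x)`. -/
def fwd (S : DataSpace D) (d : Fin D) (f : S.Point → ℝ) (x : S.Point) : ℝ :=
  match S, f, x with
  | euclidean _, f, x => partialDeriv d f x
  | lattice _ hL, f, x => f (cyclicShift hL 1 d x) - f x

/-- The operator acting on test functions and kernels: `∂/∂x^d`, respectively the cyclic backward
difference `Δ_d⁻¹ f(x) = f(x) - f(…, x^d - 1 mod L, …)`. -/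
def bwd (S : DataSpace D) (d : Fin D) (f : S.Point → ℝ) (x : S.Point) : ℝ :=
  match S, f, x with
  | euclidean _, f, x => partialDeriv d f x
  | lattice L hL, f, x => f x - f (cyclicShift hL (L - 1) d x)

/-- The distribution with density `p`. -/
def ofDensity (S : DataSpace D) (p : S.Point → ℝ) : Measure S.Point :=
  S.refMeasure.withDensity (fun x => ENNReal.ofReal (p x))

/-- The score `s_p(x) = p(x)⁻¹ ∇p(x)`, respectively `p(x)⁻¹ Δp(x)`. -/
def score (S : DataSpace D) (p : S.Point → ℝ) (x : S.Point) (d : Fin D) : ℝ :=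
  (p x)⁻¹ * S.fwd d p x

/-- The Stein operator `A_P f(x) = ⟨s_p(x), f(x)⟩ + ⟨∇, f(x)⟩` (Langevin), respectively
`tr[f(x) s_p(x)ᵀ + Δ⁻¹ f(x)]` (difference). -/
def steinOp (S : DataSpace D) (p : S.Point → ℝ) (f : Fin D → S.Point → ℝ) (x : S.Point) : ℝ :=
  ∑ d, (S.score p x d * f d x + S.bwd d (f d) x)

/-- The vector `k₁(a, b)`: the operator `∇` (or `Δ⁻¹`) applied to the first argument of `k`. -/
def kerGrad (S : DataSpace D) (k : S.Point → S.Point → ℝ) (a b : S.Point) (d : Fin D) : ℝ :=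
  S.bwd d (fun x => k x b) a

/-- The trace of `k₁₂(a, b)`, where the operator is applied to both arguments of `k`. -/
def kerGradTrace (S : DataSpace D) (k : S.Point → S.Point → ℝ) (a b : S.Point) : ℝ :=
  ∑ d, S.bwd d (fun y => S.bwd d (fun x => k x y) a) b

/-- The Stein kernel as a function of the two points and of the score vectors put there:
`uᵀv k(x,x') + uᵀk₁(x',x) + k₁(x,x')ᵀv + tr k₁₂(x,x')`. -/
def steinForm (S : DataSpace D) (k : S.Point → S.Point → ℝ)
    (x : S.Point) (u : Fin D → ℝ) (x' : S.Point) (v : Fin D → ℝ) : ℝ :=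
  (∑ d, u d * v d) * k x x' + ∑ d, u d * S.kerGrad k x' x d + ∑ d, S.kerGrad k x x' d * v d
    + S.kerGradTrace k x x'

/-- The Stein kernel `h_p(x, x')` of a density `p`. -/
def steinKernel (S : DataSpace D) (k : S.Point → S.Point → ℝ) (p : S.Point → ℝ)
    (x x' : S.Point) : ℝ :=
  S.steinForm k x (S.score p x) x' (S.score p x')

/-- In the Euclidean case, `k ∈ C^(1,1)`: `k`, its partial derivatives in the first argument, and
the mixed partial derivatives in both arguments exist and are continuous on `X × X`. (A kernel is
symmetric, so this covers the derivatives in the second argument.) No condition on a lattice. -/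
def RegularKernel (S : DataSpace D) (k : S.Point → S.Point → ℝ) : Prop :=
  match S, k with
  | euclidean X, k =>
    Continuous (fun a : X × X => k a.1 a.2) ∧
    (∀ (d : Fin D) (x y : X), HasPartialDeriv d (fun x' : X => k x' y) x) ∧
    (∀ d : Fin D, Continuous (fun a : X × X => partialDeriv d (fun x' : X => k x' a.2) a.1)) ∧
    (∀ (d e : Fin D) (x y : X),
      HasPartialDeriv e (fun y' : X => partialDeriv d (fun x' : X => k x' y') x) y) ∧
    (∀ d e : Fin D, Continuous (fun a : X × X =>
      partialDeriv e (fun y' : X => partialDeriv d (fun x' : X => k x' y') a.1) a.2))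
  | lattice _ _, _ => True

/-- In the Euclidean case, the space `H` of functions lies in the Stein class of the density `p`:
for `f ∈ H` the product `p f` has no flux through the boundary (or at infinity), that is,
`∫_X ∂_d (p f) dx = 0` for each `d`. No condition on a lattice. -/
def SteinClass (S : DataSpace D) (H : Type*) [NormedAddCommGroup H] [InnerProductSpace ℝ H]
    [RKHS ℝ H S.Point ℝ] (p : S.Point → ℝ) : Prop :=
  ∀ f : H,
    match S, p, (f : S.Point → ℝ) with
    | euclidean X, p, f => ∀ d : Fin D,
        Integrable (partialDeriv d (fun x : X => p x * f x)) (lebesgueOn X) ∧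
        ∫ x, partialDeriv d (fun x : X => p x * f x) x ∂(lebesgueOn X) = 0
    | lattice _ _, _, _ => True

/-- The real-valued reproducing kernel `k` of the reproducing kernel Hilbert space `H`. -/
def ker (S : DataSpace D) (H : Type*) [NormedAddCommGroup H] [InnerProductSpace ℝ H]
    [CompleteSpace H] [RKHS ℝ H S.Point ℝ] (x y : S.Point) : ℝ :=
  RKHS.kernel H x y 1

/-- The expectation `E_{x ∼ μ} A_P f(x)` for `f = (f_1, …, f_D) ∈ Hᴰ`. -/
def steinMean (S : DataSpace D) {H : Type*} [NormedAddCommGroup H] [InnerProductSpace ℝ H]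
    [RKHS ℝ H S.Point ℝ] (p : S.Point → ℝ) (f : PiLp 2 (fun _ : Fin D => H))
    (μ : Measure S.Point) : ℝ :=
  ∫ x, S.steinOp p (fun d y => f d y) x ∂μ

/-- The kernel Stein discrepancy `KSD_p(R) = sup_{‖f‖ ≤ 1} |E_R A_P f - E_P A_P f|`, where `f`
ranges over the unit ball of `Hᴰ` with inner product `∑_d ⟨f_d, g_d⟩` and `P` has density `p`. -/
def ksd (S : DataSpace D) (H : Type*) [NormedAddCommGroup H] [InnerProductSpace ℝ H]
    [RKHS ℝ H S.Point ℝ] (p : S.Point → ℝ) (R : Measure S.Point) : ℝ :=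
  sSup {r : ℝ | ∃ f : PiLp 2 (fun _ : Fin D => H), ‖f‖ ≤ 1 ∧
    r = |S.steinMean p f R - S.steinMean p f (S.ofDensity p)|}

end DataSpace

/-! ### Latent variable models -/

/-- A latent variable model on `S`: a prior on the latent space `Z` and a family `p(· | z)` of
strictly positive probability densities, whose mixture has a finite density `p(x)`. -/
structure LatentModel {D : ℕ} (S : DataSpace D) (Z : Type*) [MeasurableSpace Z] where
  prior : Measure Z
  isProb_prior : IsProbabilityMeasure prior
  lik : Z → S.Point → ℝ
  measurable_lik : Measurable (Function.uncurry lik)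
  lik_pos : ∀ z x, 0 < lik z x
  lintegral_lik : ∀ z, ∫⁻ x, ENNReal.ofReal (lik z x) ∂S.refMeasure = 1
  integrable_lik : ∀ x, Integrable (fun z => lik z x) prior

attribute [instance] LatentModel.isProb_prior

namespace LatentModel

variable {D : ℕ} {S : DataSpace D} {Z : Type*} [MeasurableSpace Z]

/-- The marginal density `p(x) = ∫ p(x|z) dP_Z(z)`. -/
def marginal (M : LatentModel S Z) (x : S.Point) : ℝ :=
  ∫ z, M.lik z x ∂M.prior

/-- The posterior `P_Z(dz|x) = p(x|z) / p(x) P_Z(dz)`. -/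
def posterior (M : LatentModel S Z) : Kernel S.Point Z :=
  (Kernel.const S.Point M.prior).withDensity
    (fun x z => ENNReal.ofReal (M.lik z x / M.marginal x))

/-- In the Euclidean case: the densities are differentiable and one may differentiate under the
integral sign, `∇p(x) = ∫ ∇_x p(x|z) dP_Z(z)`. No condition on a lattice. -/
def Regular (M : LatentModel S Z) : Prop :=
  match S, M with
  | .euclidean X, M =>
    (∀ z, IsDifferentiable (X := X) (M.lik z)) ∧
    IsDifferentiable (X := X) M.marginal ∧
    (∀ (x : X) (d : Fin D),
      Integrable (fun z => partialDeriv (X := X) d (M.lik z) x) M.prior ∧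
      partialDeriv (X := X) d M.marginal x
        = ∫ z, partialDeriv (X := X) d (M.lik z) x ∂M.prior)
  | .lattice _ _, _ => True

/-- The kernel `H_p[(x, z), (x', z')]` built from the conditional scores `s_p(x|z)`. -/
def latentKernel (M : LatentModel S Z) (k : S.Point → S.Point → ℝ) (a b : S.Point × Z) : ℝ :=
  S.steinForm k a.1 (S.score (M.lik a.2) a.1) b.1 (S.score (M.lik b.2) b.1)

/-- The averaged conditional score `s̄_p(x|z) = m⁻¹ ∑_j s_p(x|z_j)`. -/
def avgScore (M : LatentModel S Z) {m : ℕ} (x : S.Point) (z : Fin m → Z) (d : Fin D) : ℝ :=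
  (m : ℝ)⁻¹ * ∑ j, S.score (M.lik (z j)) x d

/-- The kernel `H̄_p[(x, z), (x', z')]` built from averaged conditional scores. -/
def avgKernel (M : LatentModel S Z) (k : S.Point → S.Point → ℝ) {m : ℕ}
    (a b : S.Point × (Fin m → Z)) : ℝ :=
  S.steinForm k a.1 (M.avgScore a.1 a.2) b.1 (M.avgScore b.1 b.2)

end LatentModel

/-- The difference kernel
`H̄_{p,q}[(x, z, w), (x', z', w')] = H̄_p[(x, z), (x', z')] - H̄_q[(x, w), (x', w')]`. -/
def diffKernel {D : ℕ} {S : DataSpace D} {Z W : Type*} [MeasurableSpace Z] [MeasurableSpace W]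
    (P : LatentModel S Z) (Q : LatentModel S W) (k : S.Point → S.Point → ℝ) {m : ℕ}
    (a b : S.Point × (Fin m → Z) × (Fin m → W)) : ℝ :=
  P.avgKernel k (a.1, a.2.1) (b.1, b.2.1) - Q.avgKernel k (a.1, a.2.2) (b.1, b.2.2)

/-! ### U-statistics and the variance estimator -/

section Statistics

variable {Y : Type*} (h : Y → Y → ℝ)

/-- The U-statistic `(n (n - 1))⁻¹ ∑_{i ≠ j} h(y_i, y_j)` of the first `n` points of `y`. -/
def uStat (n : ℕ) (y : ℕ → Y) : ℝ :=
  ((n : ℝ) * ((n : ℝ) - 1))⁻¹ *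
    ∑ i ∈ Finset.range n, ∑ j ∈ (Finset.range n).erase i, h (y i) (y j)

/-- The symmetric kernel `h_a` of three arguments. -/
def kerA (a b c : Y) : ℝ :=
  (1 / 3) * (h a b * h a c + h b a * h b c + h c a * h c b)

/-- The symmetric kernel `h_b` of four arguments. -/
def kerB (a b c d : Y) : ℝ :=
  (1 / 3) * (h a b * h c d + h a c * h b d + h a d * h b c)

/-- The V-statistic with kernel `h_a`. -/
def vStatA (n : ℕ) (y : ℕ → Y) : ℝ :=
  ((n : ℝ) ^ 3)⁻¹ * ∑ i ∈ Finset.range n, ∑ j ∈ Finset.range n, ∑ k ∈ Finset.range n,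
    kerA h (y i) (y j) (y k)

/-- The V-statistic with kernel `h_b`. -/
def vStatB (n : ℕ) (y : ℕ → Y) : ℝ :=
  ((n : ℝ) ^ 4)⁻¹ * ∑ i ∈ Finset.range n, ∑ j ∈ Finset.range n, ∑ k ∈ Finset.range n,
    ∑ l ∈ Finset.range n, kerB h (y i) (y j) (y k) (y l)

/-- The estimator `σ_{n,t}` of the asymptotic standard deviation. -/
def sigmaEst (n : ℕ) (y : ℕ → Y) : ℝ :=
  √(4 * (((n : ℝ) - 2) / ((n : ℝ) - 1)) * (vStatA h n y - vStatB h n y))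

/-- The mean `E_{(Y,Y') ∼ γ ⊗ γ} h(Y, Y')`. -/
def kerMean [MeasurableSpace Y] (γ : Measure Y) : ℝ :=
  ∫ a : Y × Y, h a.1 a.2 ∂(γ.prod γ)

/-- The variance `4 Var_{Y' ∼ γ} (E_{Y ∼ γ} h(Y, Y'))`. -/
def projVar [MeasurableSpace Y] (γ : Measure Y) : ℝ :=
  4 * variance (fun y' => ∫ y, h y y' ∂γ) γ

end Statistics

end

/-! ### A central limit theorem for triangular arrays with i.i.d. rows -/

/-! The argument has a probabilistic half and a Hilbert-space half.

Probability. Let `g` be the projection `kerProj` of the symmetric kernel `h` under the current law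
and `θ` its mean. The Hoeffding identity `uStat_sub_eq` writes the U-statistic minus `θ` as twice
the empirical mean of `g - θ` plus a degenerate remainder. Distinct pairs in the remainder are
orthogonal, so it has second moment of order n⁻² (`degenerate_part_bound`) and disappears after
multiplication by √n. The linear part is a row sum of an array whose law changes with t;
`tendstoInDistribution_triangular` treats it by characteristic functions, with errors uniform in the
law once the fourth moments are bounded. The two V-statistics differ by exactly the empirical
variance of the row means of `h`. By `row_mean_bound` these row means are mean-square close to `g`,
so the variance estimator is consistent. Slutsky's lemma and the bias condition then give
`tendstoInDistribution_studentized`. For the test, the limit is 0, α or 1 according to the sign of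
the centring constant.

Hilbert space. It remains to identify the mean of the kernel under the target law. Evaluation and
the operators ∇* are represented by vectors of `H`; for a C^(1,1) kernel this is differentiability
of the feature map (`exists_hasDerivAt_of_inner`). Hence the Stein form is a Gram kernel in `Hᴰ`
(`DataSpace.steinForm_eq_inner`), and with the Stein identity the discrepancy is the norm of the
mean feature (`DataSpace.ksd_eq_norm`). The feature is affine in the score, and the marginal score
is the posterior mean of the conditional scores (`LatentModel.integral_score_posterior`). So
replacing scores by conditional or averaged scores leaves the mean unchanged, and
`DataSpace.integral_avgKernel` yields the squared discrepancy.

The limit theorems are proved along countably generated filters; a general filter is handled by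
passing to a coarser one of that kind. -/

/-- Telescoping: an error of order n^(-3/2) in one characteristic function costs only a factor n in
the n-th power. -/
lemma norm_pow_sub_pow_le_of_norm_le_one {a b : ℂ} (ha : ‖a‖ ≤ 1) (hb : ‖b‖ ≤ 1) (n : ℕ) :
    ‖a ^ n - b ^ n‖ ≤ n * ‖a - b‖ := by
  induction n with
  | zero => simp
  | succ n ih =>
    have h : a ^ (n + 1) - b ^ (n + 1) = a ^ n * (a - b) + (a ^ n - b ^ n) * b := by ring
    have h1 : ‖a ^ n * (a - b)‖ ≤ ‖a - b‖ := by
      rw [norm_mul, norm_pow]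
      exact mul_le_of_le_one_left (norm_nonneg _) (pow_le_one₀ (norm_nonneg _) ha)
    have h2 : ‖(a ^ n - b ^ n) * b‖ ≤ n * ‖a - b‖ := by
      rw [norm_mul]
      exact (mul_le_of_le_one_right (norm_nonneg _) hb).trans ih
    rw [h]
    push_cast
    linarith [norm_add_le (a ^ n * (a - b)) ((a ^ n - b ^ n) * b)]

/-- Taylor's formula for |x| ≤ 1; for |x| ≥ 1 every term is at most a multiple of |x|³. The constant
4 is not sharp. -/
lemma norm_cexp_mul_I_sub_le (x : ℝ) :
    ‖Complex.exp (x * Complex.I) - (1 + x * Complex.I - x ^ 2 / 2)‖ ≤ 4 * |x| ^ 3 := by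
  rcases le_total |x| 1 with hx | hx
  · have hn : ‖(x : ℂ) * Complex.I‖ = |x| := by simp
    have h := Complex.exp_bound (x := (x : ℂ) * Complex.I) (hn.trans_le hx)
      (n := 3) (by norm_num)
    rw [hn] at h
    have hs : ∑ m ∈ Finset.range 3, ((x : ℂ) * Complex.I) ^ m / (m.factorial : ℂ)
        = 1 + x * Complex.I - x ^ 2 / 2 := by
      simp only [Finset.sum_range_succ, Finset.sum_range_zero, mul_pow, Complex.I_sq]
      norm_num [Nat.factorial]
      ring
    rw [hs] at h
    refine h.trans ?_
    norm_num [Nat.factorial]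
    nlinarith [pow_nonneg (abs_nonneg x) 3]
  · have h1 : ‖Complex.exp (x * Complex.I)‖ = 1 := Complex.norm_exp_ofReal_mul_I x
    have h2 : ‖(1 : ℂ) + x * Complex.I - x ^ 2 / 2‖ ≤ 1 + |x| + |x| ^ 2 / 2 := by
      refine (norm_sub_le _ _).trans (add_le_add ((norm_add_le _ _).trans (by simp)) ?_)
      simp
    refine (norm_sub_le _ _).trans ?_
    rw [h1]
    have h3 : |x| ≤ |x| ^ 3 := le_self_pow₀ hx (by norm_num)
    have h4 : |x| ^ 2 ≤ |x| ^ 3 := pow_le_pow_right₀ hx (by norm_num)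
    have h5 : 1 ≤ |x| ^ 3 := one_le_pow₀ hx
    linarith

lemma norm_charFun_sub_le {ν : Measure ℝ} [IsProbabilityMeasure ν] {M : ℝ}
    (h0 : ∫ x, x ∂ν = 0) (h3 : MemLp id 3 ν) (hM : ∫ x, |x| ^ 3 ∂ν ≤ M) (s : ℝ) :
    ‖charFun ν s - ((1 - s ^ 2 * (∫ x, x ^ 2 ∂ν) / 2 : ℝ) : ℂ)‖ ≤ 4 * |s| ^ 3 * M := by
  have i1 : Integrable (fun x : ℝ => x) ν := (h3.mono_exponent (q := 3) (p := 1)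
    (by norm_num)).integrable le_rfl
  have i2 : Integrable (fun x : ℝ => x ^ 2) ν :=
    (h3.mono_exponent (q := 3) (p := 2) (by norm_num)).integrable_sq
  have i3 : Integrable (fun x : ℝ => |x| ^ 3) ν := by
    have := h3.integrable_norm_pow (by norm_num)
    simpa using! this
  have e1 : ∫ x, ((1 : ℂ) + ((s * x : ℝ) : ℂ) * Complex.I - ((s * x : ℝ) : ℂ) ^ 2 / 2) ∂ν
      = ((1 - s ^ 2 * (∫ x, x ^ 2 ∂ν) / 2 : ℝ) : ℂ) := by
    have j1 : Integrable (fun x : ℝ => ((s * x : ℝ) : ℂ) * Complex.I) ν :=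
      (i1.const_mul s).ofReal.mul_const _
    have j2 : Integrable (fun x : ℝ => ((s * x : ℝ) : ℂ) ^ 2 / 2) ν := by
      have : Integrable (fun x : ℝ => (((s ^ 2 / 2) * x ^ 2 : ℝ) : ℂ)) ν :=
        (i2.const_mul (s ^ 2 / 2)).ofReal
      refine this.congr (ae_of_all _ fun x => ?_)
      push_cast; ring
    have j0 : Integrable (fun x : ℝ => (1 : ℂ) + ((s * x : ℝ) : ℂ) * Complex.I) ν :=
      (integrable_const _).add j1
    rw [integral_sub j0 j2, integral_add (integrable_const _) j1,
      integral_mul_const, integral_complex_ofReal, integral_const_mul, h0]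
    have : ∫ x : ℝ, ((s * x : ℝ) : ℂ) ^ 2 / 2 ∂ν = ((s ^ 2 / 2 * ∫ x, x ^ 2 ∂ν : ℝ) : ℂ) := by
      rw [← integral_const_mul, ← integral_complex_ofReal]
      congr 1; ext x; push_cast; ring
    rw [this]
    simp
    ring
  have j4 : Integrable (fun x : ℝ => (1 : ℂ) + ((s * x : ℝ) : ℂ) * Complex.I
      - ((s * x : ℝ) : ℂ) ^ 2 / 2) ν := by
    refine ((integrable_const _).add ((i1.const_mul s).ofReal.mul_const _)).sub ?_
    have : Integrable (fun x : ℝ => (((s ^ 2 / 2) * x ^ 2 : ℝ) : ℂ)) ν :=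
      (i2.const_mul (s ^ 2 / 2)).ofReal
    refine this.congr (ae_of_all _ fun x => ?_)
    push_cast; ring
  have j5 : Integrable (fun x : ℝ => Complex.exp (((s * x : ℝ) : ℂ) * Complex.I)) ν := by
    refine Integrable.of_bound (by fun_prop) 1 (ae_of_all _ fun x => ?_)
    exact (Complex.norm_exp_ofReal_mul_I _).le
  rw [charFun_apply_real, ← e1]
  have : ∫ x : ℝ, Complex.exp (s * x * Complex.I) ∂ν
      = ∫ x : ℝ, Complex.exp (((s * x : ℝ) : ℂ) * Complex.I) ∂ν := by
    simp
  rw [this, ← integral_sub j5 j4]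
  calc _ ≤ ∫ x, 4 * |s| ^ 3 * |x| ^ 3 ∂ν := by
        refine norm_integral_le_of_norm_le (i3.const_mul _) (ae_of_all _ fun x => ?_)
        refine (norm_cexp_mul_I_sub_le (s * x)).trans_eq ?_
        rw [abs_mul]; ring
    _ ≤ _ := by
        rw [integral_const_mul]
        gcongr

lemma abs_exp_neg_sub_le {y : ℝ} (hy : 0 ≤ y) : |Real.exp (-y) - (1 - y)| ≤ y ^ 2 := by
  rcases le_total y 1 with h | h
  · have := Real.abs_exp_sub_one_sub_id_le (x := -y) (by rwa [abs_neg, abs_of_nonneg hy])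
    calc _ = |Real.exp (-y) - 1 - -y| := by congr 1; ring
      _ ≤ _ := by simpa using this
  · have h1 : Real.exp (-y) ≤ 1 := Real.exp_le_one_iff.2 (by linarith)
    have h2 := Real.exp_pos (-y)
    rw [abs_le]
    constructor <;> nlinarith

/-- The characteristic function and the Gaussian factor `exp (-y)` are both compared with `1 - y`.
The bound depends on the law only through its second moment and `M`, so it serves rows with varying
laws. -/
lemma norm_charFun_pow_sub_le {ν : Measure ℝ} [IsProbabilityMeasure ν] {M : ℝ}
    (h0 : ∫ x, x ∂ν = 0) (h3 : MemLp id 3 ν) (hM : ∫ x, |x| ^ 3 ∂ν ≤ M) (u : ℝ)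
    {n : ℕ} (hn : 1 ≤ n) :
    ‖charFun ν ((√(n : ℝ))⁻¹ * u) ^ n - Real.exp (-((∫ x, x ^ 2 ∂ν) * u ^ 2 / 2))‖
      ≤ (√(n : ℝ))⁻¹ * (4 * M * |u| ^ 3 + (∫ x, x ^ 2 ∂ν) ^ 2 * u ^ 4) := by
  set V := ∫ x, x ^ 2 ∂ν with hV
  have hV0 : 0 ≤ V := integral_nonneg fun x => sq_nonneg x
  set r := (√(n : ℝ))⁻¹ with hr
  have hn0 : (0 : ℝ) < n := by exact_mod_cast hn
  have hr0 : 0 < r := by positivity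
  have hr1 : r ≤ 1 := by
    refine inv_le_one_of_one_le₀ ?_
    rw [Real.one_le_sqrt]; exact_mod_cast hn
  have hrn : (n : ℝ) * r ^ 2 = 1 := by
    rw [hr, inv_pow, Real.sq_sqrt hn0.le]; field_simp
  set y := (r * u) ^ 2 * V / 2 with hy
  have hy0 : 0 ≤ y := by positivity
  have hexp : (Real.exp (-(V * u ^ 2 / 2)) : ℂ) = (Real.exp (-y) : ℂ) ^ n := by
    rw [← Complex.ofReal_pow, ← Real.exp_nat_mul]
    congr 2
    rw [hy]
    linear_combination (u ^ 2 * V / 2) * hrn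
  have hb1 : ‖(Real.exp (-y) : ℂ)‖ ≤ 1 := by
    rw [Complex.norm_real, Real.norm_of_nonneg (Real.exp_pos _).le]
    exact Real.exp_le_one_iff.2 (by linarith)
  have key : ‖charFun ν (r * u) - (Real.exp (-y) : ℂ)‖ ≤ 4 * |r * u| ^ 3 * M + y ^ 2 := by
    have e : charFun ν (r * u) - (Real.exp (-y) : ℂ) =
        (charFun ν (r * u) - ((1 - y : ℝ) : ℂ)) - ((Real.exp (-y) - (1 - y) : ℝ) : ℂ) := by
      push_cast; ring
    rw [e]
    refine (norm_sub_le _ _).trans (add_le_add (norm_charFun_sub_le h0 h3 hM _) ?_)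
    rw [Complex.norm_real]
    exact abs_exp_neg_sub_le hy0
  rw [hexp]
  refine (norm_pow_sub_pow_le_of_norm_le_one (norm_charFun_le_one _) hb1 n).trans ?_
  refine (mul_le_mul_of_nonneg_left key hn0.le).trans ?_
  rw [abs_mul, abs_of_pos hr0, mul_pow]
  have e1 : (n : ℝ) * (4 * (r ^ 3 * |u| ^ 3) * M + y ^ 2)
      = r * (4 * M * |u| ^ 3) + r ^ 2 * (V ^ 2 * u ^ 4) / 4 := by
    rw [hy]
    linear_combination (r * 4 * |u| ^ 3 * M + r ^ 2 * u ^ 4 * V ^ 2 / 4) * hrn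
  rw [e1, mul_add]
  have : r ^ 2 * (V ^ 2 * u ^ 4) ≤ r * (V ^ 2 * u ^ 4) := by
    gcongr; nlinarith
  have h5 : 0 ≤ r ^ 2 * (V ^ 2 * u ^ 4) := by positivity
  linarith

lemma charFun_inv_sqrt_mul_sum_of_hasLaw {Ω : Type*} [MeasurableSpace Ω] {Pr : Measure Ω}
    {X : ℕ → Ω → ℝ} {ν : Measure ℝ} (hX : ∀ i, HasLaw (X i) ν Pr) (hind : iIndepFun X Pr)
    (n : ℕ) (u : ℝ) :
    charFun (Pr.map (fun ω => (√(n : ℝ))⁻¹ * ∑ i ∈ Finset.range n, X i ω)) u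
      = charFun ν ((√(n : ℝ))⁻¹ * u) ^ n := by
  rw [charFun_inv_sqrt_mul_sum hind fun i => ⟨(hX i).aemeasurable, (hX 0).aemeasurable,
    (hX i).map_eq.trans (hX 0).map_eq.symm⟩, (hX 0).map_eq]

/-- Central limit theorem for triangular arrays whose rows are i.i.d. and centred, with bounded
third moments and convergent variances. -/
theorem tendstoInDistribution_triangular {ι Ω : Type*} [MeasurableSpace Ω] {Pr : Measure Ω}
    [IsProbabilityMeasure Pr] {l : Filter ι} [l.IsCountablyGenerated] {n : ι → ℕ}
    (hn : Tendsto n l atTop) {X : ι → ℕ → Ω → ℝ} {ν : ι → Measure ℝ}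
    [∀ k, IsProbabilityMeasure (ν k)]
    (hX : ∀ k i, HasLaw (X k i) (ν k) Pr) (hind : ∀ k, iIndepFun (X k) Pr)
    (h0 : ∀ᶠ k in l, ∫ x, x ∂(ν k) = 0) {M : ℝ}
    (h3 : ∀ᶠ k in l, MemLp id 3 (ν k) ∧ ∫ x, |x| ^ 3 ∂(ν k) ≤ M) {v : NNReal}
    (hv : Tendsto (fun k => ∫ x, x ^ 2 ∂(ν k)) l (𝓝 (v : ℝ))) :
    TendstoInDistribution
      (fun k ω => (√(n k : ℝ))⁻¹ * ∑ i ∈ Finset.range (n k), X k i ω) l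
      (fun x : ℝ => x) (fun _ => Pr) (gaussianReal 0 v) where
  forall_aemeasurable k :=
    .const_mul (Finset.aemeasurable_fun_sum _ fun _ _ => (hX k _).aemeasurable) _
  tendsto := by
    have key : ∀ u : ℝ, Tendsto (fun k => charFun (ν k) ((√(n k : ℝ))⁻¹ * u) ^ (n k)) l
        (𝓝 (charFun (gaussianReal 0 v) u)) := by
      intro u
      have hnR : Tendsto (fun k => (√(n k : ℝ))⁻¹) l (𝓝 0) :=
        tendsto_inv_atTop_zero.comp (Real.tendsto_sqrt_atTop.comp
          (tendsto_natCast_atTop_atTop.comp hn))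
      have hb : Tendsto (fun k => (√(n k : ℝ))⁻¹ *
          (4 * M * |u| ^ 3 + (∫ x, x ^ 2 ∂(ν k)) ^ 2 * u ^ 4)) l (𝓝 0) := by
        have := hnR.mul (((hv.pow 2).mul_const (u ^ 4)).const_add (4 * M * |u| ^ 3))
        simpa using this
      have hexp : Tendsto (fun k => (Real.exp (-((∫ x, x ^ 2 ∂(ν k)) * u ^ 2 / 2)) : ℂ)) l
          (𝓝 (charFun (gaussianReal 0 v) u)) := by
        have h : charFun (gaussianReal 0 v) u = (Real.exp (-((v : ℝ) * u ^ 2 / 2)) : ℂ) := by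
          rw [charFun_gaussianReal]; push_cast; congr 1; simp
        rw [h]
        refine (Complex.continuous_ofReal.tendsto _).comp ((Real.continuous_exp.tendsto _).comp ?_)
        exact ((hv.mul_const _).div_const 2).neg
      have hd : Tendsto (fun k => charFun (ν k) ((√(n k : ℝ))⁻¹ * u) ^ (n k)
          - (Real.exp (-((∫ x, x ^ 2 ∂(ν k)) * u ^ 2 / 2)) : ℂ)) l (𝓝 0) := by
        refine squeeze_zero_norm' ?_ hb
        filter_upwards [h0, h3, hn.eventually_ge_atTop 1] with k k0 k3 kn
        exact norm_charFun_pow_sub_le k0 k3.1 k3.2 u kn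
      simpa using hd.add hexp
    -- Lévy's continuity theorem is applied along sequences, which suffice because the filter is
    -- countably generated.
    refine tendsto_of_seq_tendsto fun s hs => ?_
    refine ProbabilityMeasure.tendsto_of_tendsto_charFun fun u => ?_
    simp only [ProbabilityMeasure.coe_mk, Measure.map_id']
    refine ((key u).comp hs).congr fun k => ?_
    exact (charFun_inv_sqrt_mul_sum_of_hasLaw (hX _) (hind _) _ _).symm

/-! ### Second moments of U-statistics -/

section Laws

variable {Ω 𝒴 : Type*} [MeasurableSpace Ω] [MeasurableSpace 𝒴] {Pr : Measure Ω} {γ : Measure 𝒴}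

lemma ProbabilityTheory.HasLaw.memLp_comp {X : Ω → 𝒴} (hX : HasLaw X γ Pr) {f : 𝒴 → ℝ} {p : ℝ≥0∞}
    (hf : MemLp f p γ) : MemLp (fun ω => f (X ω)) p Pr := by
  have hf' : MemLp f p (Pr.map X) := by rwa [hX.map_eq]
  exact (memLp_map_measure_iff hf'.1 hX.aemeasurable).1 hf'

lemma hasLaw_pair [IsProbabilityMeasure Pr] [IsProbabilityMeasure γ] {X : ℕ → Ω → 𝒴}
    (hX : ∀ i, HasLaw (X i) γ Pr) (hind : iIndepFun X Pr) {i j : ℕ} (hij : i ≠ j) :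
    HasLaw (fun ω => (X i ω, X j ω)) (γ.prod γ) Pr where
  aemeasurable := (hX i).aemeasurable.prodMk (hX j).aemeasurable
  map_eq := by
    rw [(indepFun_iff_map_prod_eq_prod_map_map (hX i).aemeasurable (hX j).aemeasurable).1
      (hind.indepFun hij), (hX i).map_eq, (hX j).map_eq]

/-- The variable `X i` occurs once and is independent of the others, so integrating it out first
gives zero. This is the source of all orthogonality below. -/
lemma integral_mul_eq_zero_of_fresh_index [IsProbabilityMeasure Pr] [IsProbabilityMeasure γ]
    {X : ℕ → Ω → 𝒴} (hX : ∀ i, HasLaw (X i) γ Pr) (hind : iIndepFun X Pr) {d e : 𝒴 → 𝒴 → ℝ}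
    (hd : Measurable (Function.uncurry d)) (he : Measurable (Function.uncurry e))
    (hd0 : ∀ b, ∫ a, d a b ∂γ = 0) {i j k l : ℕ} (hij : i ≠ j) (hik : i ≠ k) (hil : i ≠ l) :
    ∫ ω, d (X i ω) (X j ω) * e (X k ω) (X l ω) ∂Pr = 0 := by
  classical
  -- As `T` is a finite set, coincidences among `j`, `k`, `l` need no case distinction.
  let T : Finset ℕ := {j, k, l}
  have hj : j ∈ T := by simp [T]
  have hk : k ∈ T := by simp [T]
  have hl : l ∈ T := by simp [T]
  have hdisj : Disjoint ({i} : Finset ℕ) T := by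
    simp [T, hij, hik, hil]
  have h1 := hind.indepFun_finset₀ {i} T hdisj (fun i => (hX i).aemeasurable)
  let V : Ω → T → 𝒴 := fun ω t => X t ω
  have hV : AEMeasurable V Pr := aemeasurable_pi_iff.2 fun t => (hX t).aemeasurable
  have h2 : IndepFun (X i) V Pr :=
    h1.comp (φ := fun u : (({i} : Finset ℕ) → 𝒴) => u ⟨i, by simp⟩) (ψ := id)
      (measurable_pi_apply _) measurable_id
  have hmap := (indepFun_iff_map_prod_eq_prod_map_map (hX i).aemeasurable hV).1 h2
  rw [(hX i).map_eq] at hmap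
  have : IsProbabilityMeasure (Pr.map V) := Measure.isProbabilityMeasure_map hV
  let F : 𝒴 × (T → 𝒴) → ℝ := fun z =>
    d z.1 (z.2 ⟨j, hj⟩) * e (z.2 ⟨k, hk⟩) (z.2 ⟨l, hl⟩)
  have hF : Measurable F := by
    have a1 : Measurable fun z : 𝒴 × (T → 𝒴) => d z.1 (z.2 ⟨j, hj⟩) :=
      hd.comp (measurable_fst.prodMk ((measurable_pi_apply _).comp measurable_snd))
    have a2 : Measurable fun z : 𝒴 × (T → 𝒴) => e (z.2 ⟨k, hk⟩) (z.2 ⟨l, hl⟩) :=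
      he.comp (((measurable_pi_apply (X := fun _ : T => 𝒴) ⟨k, hk⟩).comp measurable_snd).prodMk
        ((measurable_pi_apply (X := fun _ : T => 𝒴) ⟨l, hl⟩).comp measurable_snd))
    exact a1.mul a2
  have h3 : ∫ ω, F (X i ω, V ω) ∂Pr = ∫ z, F z ∂(γ.prod (Pr.map V)) := by
    rw [← hmap, integral_map ((hX i).aemeasurable.prodMk hV) hF.aestronglyMeasurable]
  change ∫ ω, F (X i ω, V ω) ∂Pr = 0
  rw [h3]
  by_cases hi : Integrable F (γ.prod (Pr.map V))
  · rw [integral_prod_symm _ hi]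
    simp [F, integral_mul_const, hd0]
  -- A non-integrable function has integral zero by convention, so no moment condition is required.
  · exact integral_undef hi

end Laws

lemma sum_sum_erase_eq_sum_offDiag {α : Type*} [DecidableEq α] (s : Finset α) (f : α → α → ℝ) :
    ∑ i ∈ s, ∑ j ∈ s.erase i, f i j = ∑ p ∈ s.offDiag, f p.1 p.2 := by
  refine (Finset.sum_finset_product' s.offDiag s (fun i => s.erase i) fun p => ?_).symm
  simp only [Finset.mem_offDiag, Finset.mem_erase]
  tauto

section SecondMoments

variable {Ω 𝒴 : Type*} [MeasurableSpace Ω] [MeasurableSpace 𝒴] {Pr : Measure Ω} {γ : Measure 𝒴}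
  [IsProbabilityMeasure Pr] [IsProbabilityMeasure γ] {X : ℕ → Ω → 𝒴}

/-- The sum over `i ≠ j` of a degenerate symmetric kernel has second moment `2n(n-1)E d²`. -/
lemma integral_sq_sum_degenerate (hX : ∀ i, HasLaw (X i) γ Pr) (hind : iIndepFun X Pr)
    {d : 𝒴 → 𝒴 → ℝ} (hd : Measurable (Function.uncurry d)) (hs : ∀ a b, d a b = d b a)
    (hd0 : ∀ b, ∫ a, d a b ∂γ = 0) (h2 : MemLp (Function.uncurry d) 2 (γ.prod γ)) (n : ℕ) :
    ∫ ω, (∑ i ∈ Finset.range n, ∑ j ∈ (Finset.range n).erase i, d (X i ω) (X j ω)) ^ 2 ∂Pr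
      = (Finset.range n).offDiag.card * (2 * ∫ z, Function.uncurry d z ^ 2 ∂(γ.prod γ)) := by
  have hL : ∀ p ∈ (Finset.range n).offDiag, MemLp (fun ω => d (X p.1 ω) (X p.2 ω)) 2 Pr :=
    fun p hp => (hasLaw_pair hX hind (Finset.mem_offDiag.1 hp).2.2).memLp_comp h2
  have hLL : ∀ p ∈ (Finset.range n).offDiag, ∀ q ∈ (Finset.range n).offDiag,
      Integrable (fun ω => d (X p.1 ω) (X p.2 ω) * d (X q.1 ω) (X q.2 ω)) Pr :=
    fun p hp q hq => (hL p hp).integrable_mul (hL q hq)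
  have hsq : ∀ p ∈ (Finset.range n).offDiag,
      ∫ ω, d (X p.1 ω) (X p.2 ω) * d (X p.1 ω) (X p.2 ω) ∂Pr
        = ∫ z, Function.uncurry d z ^ 2 ∂(γ.prod γ) := fun p hp => by
    have := (hasLaw_pair hX hind (Finset.mem_offDiag.1 hp).2.2).integral_comp
      (f := fun z => Function.uncurry d z ^ 2) (hd.pow_const 2).aestronglyMeasurable
    rw [← this]
    simp [Function.uncurry, sq]
  simp_rw [sum_sum_erase_eq_sum_offDiag, sq (Finset.sum _ _), Finset.sum_mul_sum]
  rw [integral_finsetSum _ fun p hp => integrable_finsetSum _ fun q hq =>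
    hLL p hp q hq]
  rw [Finset.sum_congr rfl, Finset.sum_const, nsmul_eq_mul]
  intro p hp
  rw [integral_finsetSum _ fun q hq => hLL p hp q hq]
  have hp' := Finset.mem_offDiag.1 hp
  -- Only `p` and its swap correlate with `p`: any other pair misses one of the two indices of `p`,
  -- and that index is fresh. This gives the factor 2.
  have hsub : ({p, p.swap} : Finset (ℕ × ℕ)) ⊆ (Finset.range n).offDiag := by
    intro q hq
    rcases Finset.mem_insert.1 hq with rfl | hq
    · exact hp
    · rw [Finset.mem_singleton.1 hq]
      exact Finset.mem_offDiag.2 ⟨hp'.2.1, hp'.1, hp'.2.2.symm⟩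
  have hne : p ≠ p.swap := fun h => hp'.2.2 (by simpa using congrArg Prod.fst h)
  rw [← Finset.sum_subset hsub, Finset.sum_pair hne]
  · have : ∫ ω, d (X p.1 ω) (X p.2 ω) * d (X p.swap.1 ω) (X p.swap.2 ω) ∂Pr
        = ∫ ω, d (X p.1 ω) (X p.2 ω) * d (X p.1 ω) (X p.2 ω) ∂Pr := by
      congr 1; ext ω; rw [Prod.fst_swap, Prod.snd_swap, hs (X p.2 ω)]
    rw [this, hsq p hp]; ring
  · intro q hq hq'
    have hq1 := Finset.mem_offDiag.1 hq
    have hor : (p.1 ≠ q.1 ∧ p.1 ≠ q.2) ∨ (p.2 ≠ q.1 ∧ p.2 ≠ q.2) := by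
      by_contra hcon
      apply hq'
      rw [Finset.mem_insert, Finset.mem_singleton, Prod.ext_iff, Prod.ext_iff]
      simp only [Prod.fst_swap, Prod.snd_swap]
      have := hp'.2.2
      have := hq1.2.2
      omega
    rcases hor with h | h
    · exact integral_mul_eq_zero_of_fresh_index hX hind hd hd hd0 hp'.2.2 h.1 h.2
    · have := integral_mul_eq_zero_of_fresh_index hX hind hd hd hd0 hp'.2.2.symm h.1 h.2
      simpa only [hs (X p.2 _) (X p.1 _)] using this

/-- Row sums of a kernel that is centred in its second argument. -/
lemma integral_sq_sum_row (hX : ∀ i, HasLaw (X i) γ Pr) (hind : iIndepFun X Pr)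
    {e : 𝒴 → 𝒴 → ℝ} (he : Measurable (Function.uncurry e))
    (he0 : ∀ a, ∫ b, e a b ∂γ = 0) (h2 : MemLp (Function.uncurry e) 2 (γ.prod γ))
    (i : ℕ) {s : Finset ℕ} (hs : i ∉ s) :
    ∫ ω, (∑ j ∈ s, e (X i ω) (X j ω)) ^ 2 ∂Pr
      = s.card * ∫ z, Function.uncurry e z ^ 2 ∂(γ.prod γ) := by
  have hij : ∀ j ∈ s, i ≠ j := fun j hj h => hs (h ▸ hj)
  have hL : ∀ j ∈ s, MemLp (fun ω => e (X i ω) (X j ω)) 2 Pr :=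
    fun j hj => (hasLaw_pair hX hind (hij j hj)).memLp_comp h2
  have hLL : ∀ p ∈ s, ∀ q ∈ s,
      Integrable (fun ω => e (X i ω) (X p ω) * e (X i ω) (X q ω)) Pr :=
    fun p hp q hq => (hL p hp).integrable_mul (hL q hq)
  simp_rw [sq (Finset.sum _ _), Finset.sum_mul_sum]
  rw [integral_finsetSum _ fun p hp => integrable_finsetSum _ fun q hq =>
    hLL p hp q hq]
  rw [Finset.sum_congr rfl, Finset.sum_const, nsmul_eq_mul]
  intro j hj
  rw [integral_finsetSum _ fun q hq => hLL j hj q hq]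
  rw [Finset.sum_eq_single_of_mem j hj]
  · have := (hasLaw_pair hX hind (hij j hj)).integral_comp
      (f := fun z => Function.uncurry e z ^ 2) (he.pow_const 2).aestronglyMeasurable
    rw [← this]
    simp [Function.uncurry, sq]
  · intro k hk hkj
    -- The arguments are flipped so that the fresh index `j` stands in the centred slot.
    exact integral_mul_eq_zero_of_fresh_index hX hind (d := fun a b => e b a)
      (he.comp measurable_swap) he he0 (hij j hj).symm (hij j hj).symm hkj.symm

/-- Second moment of a centred empirical mean. -/
lemma integral_sq_sum_centred (hX : ∀ i, HasLaw (X i) γ Pr) (hind : iIndepFun X Pr)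
    {f : 𝒴 → ℝ} (hf : Measurable f) (hf0 : ∫ b, f b ∂γ = 0) (h2 : MemLp f 2 γ) (n : ℕ) :
    ∫ ω, (∑ j ∈ Finset.range n, f (X j ω)) ^ 2 ∂Pr = n * ∫ z, f z ^ 2 ∂γ := by
  have hm : Measurable (Function.uncurry fun _ b : 𝒴 => f b) := hf.comp measurable_snd
  have hmap : (γ.prod γ).map Prod.snd = γ := by simp
  have h2' : MemLp (Function.uncurry fun _ b : 𝒴 => f b) 2 (γ.prod γ) := by
    have := (memLp_map_measure_iff (p := 2) (g := f) (f := Prod.snd) (μ := γ.prod γ)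
      hf.aestronglyMeasurable measurable_snd.aemeasurable).1 (by rwa [hmap])
    exact this
  -- A plain sum is a row sum of a kernel that ignores its first argument; the row index `n` lies
  -- outside the range.
  have := integral_sq_sum_row hX hind (e := fun _ b => f b) hm (fun _ => hf0) h2' n
    (s := Finset.range n) (by simp)
  rw [this, Finset.card_range]
  congr 1
  have h3 := integral_map (μ := γ.prod γ) (φ := Prod.snd) (f := fun z => f z ^ 2)
    measurable_snd.aemeasurable (hf.pow_const 2).aestronglyMeasurable
  rw [hmap] at h3
  exact h3.symm

end SecondMoments

/-! ### Moments of the projection of a kernel -/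

section Moments

variable {α : Type*} [MeasurableSpace α] {μ : Measure α} [IsProbabilityMeasure μ]

lemma sq_integral_le_integral_sq {f : α → ℝ} (hf : MemLp f 2 μ) :
    (∫ x, f x ∂μ) ^ 2 ≤ ∫ x, f x ^ 2 ∂μ := by
  have h1 := variance_eq_sub hf
  have h2 := variance_nonneg f μ
  have h3 : μ[f ^ 2] = ∫ x, f x ^ 2 ∂μ := rfl
  linarith

lemma integral_sq_sub_const_le {f : α → ℝ} (hf : MemLp f 2 μ) :
    ∫ x, (f x - ∫ y, f y ∂μ) ^ 2 ∂μ ≤ ∫ x, f x ^ 2 ∂μ := by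
  rw [← variance_eq_integral hf.1.aemeasurable]
  exact variance_le_expectation_sq hf.1

omit [IsProbabilityMeasure μ] in
lemma integral_sq_add_le {f g : α → ℝ} (hf : MemLp f 2 μ) (hg : MemLp g 2 μ) :
    ∫ x, (f x + g x) ^ 2 ∂μ ≤ 2 * ∫ x, f x ^ 2 ∂μ + 2 * ∫ x, g x ^ 2 ∂μ := by
  rw [← integral_const_mul, ← integral_const_mul,
    ← integral_add (hf.integrable_sq.const_mul 2) (hg.integrable_sq.const_mul 2)]
  refine integral_mono (hf.add hg).integrable_sq
    ((hf.integrable_sq.const_mul 2).add (hg.integrable_sq.const_mul 2)) fun x => ?_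
  simp only
  nlinarith [sq_nonneg (f x - g x)]

omit [IsProbabilityMeasure μ] in
lemma integral_sq_sub_le {f g : α → ℝ} (hf : MemLp f 2 μ) (hg : MemLp g 2 μ) :
    ∫ x, (f x - g x) ^ 2 ∂μ ≤ 2 * ∫ x, f x ^ 2 ∂μ + 2 * ∫ x, g x ^ 2 ∂μ := by
  simpa [sub_eq_add_neg] using integral_sq_add_le hf hg.neg

omit [IsProbabilityMeasure μ] in
lemma MeasureTheory.MemLp.sq_of_four {f : α → ℝ} (hf : MemLp f 4 μ) : MemLp (fun x => f x ^ 2) 2 μ := by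
  have : ENNReal.HolderTriple 4 4 2 := ⟨by
    rw [← two_mul, show (4 : ℝ≥0∞) = 2 * 2 by norm_num,
      ENNReal.mul_inv (by simp) (by simp), ← mul_assoc, ENNReal.mul_inv_cancel (by simp) (by simp),
      one_mul]⟩
  simpa [sq, Pi.mul_def] using! hf.mul hf (r := 2)

omit [IsProbabilityMeasure μ] in
lemma MeasureTheory.MemLp.integrable_pow_four {f : α → ℝ} (hf : MemLp f 4 μ) :
    Integrable (fun x => f x ^ 4) μ := by
  have := hf.sq_of_four.integrable_sq
  simpa [← pow_mul] using this

omit [IsProbabilityMeasure μ] in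
lemma memLp_four_of_integrable_pow {f : α → ℝ} (hf : AEStronglyMeasurable f μ)
    (h2 : Integrable (fun x => f x ^ 4) μ) : MemLp f 4 μ := by
  refine (integrable_norm_rpow_iff hf (by norm_num) (by norm_num)).1 ?_
  refine h2.congr (ae_of_all _ fun x => ?_)
  have h : ‖f x‖ ^ (4 : ℝ) = ‖f x‖ ^ 4 := by exact_mod_cast Real.rpow_natCast ‖f x‖ 4
  simp only [ENNReal.toReal_ofNat]
  rw [h, Real.norm_eq_abs]
  exact (Even.pow_abs (by decide) (f x)).symm

lemma integral_sq_le_of_four {f : α → ℝ} (hf : MemLp f 4 μ) :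
    ∫ x, f x ^ 2 ∂μ ≤ 1 + ∫ x, f x ^ 4 ∂μ := by
  have h4 := hf.integrable_pow_four
  have : (1 : ℝ) + ∫ x, f x ^ 4 ∂μ = ∫ x, (1 + f x ^ 4) ∂μ := by
    rw [integral_add (integrable_const _) h4]; simp
  rw [this]
  refine integral_mono (hf.mono_exponent (p := 2) (by norm_num)).integrable_sq
    ((integrable_const _).add h4) fun x => ?_
  simp only
  nlinarith [sq_nonneg (f x ^ 2 - 1), sq_nonneg (f x)]

lemma integral_abs_cube_le_of_four {f : α → ℝ} (hf : MemLp f 4 μ) :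
    ∫ x, |f x| ^ 3 ∂μ ≤ 1 + ∫ x, f x ^ 4 ∂μ := by
  have h4 := hf.integrable_pow_four
  have : (1 : ℝ) + ∫ x, f x ^ 4 ∂μ = ∫ x, (1 + f x ^ 4) ∂μ := by
    rw [integral_add (integrable_const _) h4]; simp
  rw [this]
  have h3 := (hf.mono_exponent (p := 3) (by norm_num)).integrable_norm_pow (by norm_num)
  refine integral_mono (by simpa using! h3) ((integrable_const _).add h4) fun x => ?_
  simp only
  have h0 := abs_nonneg (f x)
  rw [← Even.pow_abs (n := 4) (by decide)]
  rcases le_total |f x| 1 with h | h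
  · have : |f x| ^ 3 ≤ 1 := pow_le_one₀ h0 h
    have := pow_nonneg h0 4
    linarith
  · have : |f x| ^ 3 ≤ |f x| ^ 4 := pow_le_pow_right₀ h (by norm_num)
    linarith

/-- Here (a - c)⁴ ≤ 8a⁴ + 8c⁴, and c⁴ is at most the fourth moment by Jensen applied twice; hence 16
= 8 + 8. -/
lemma integral_pow_four_sub_le {f : α → ℝ} (hf : MemLp f 4 μ) :
    ∫ x, (f x - ∫ y, f y ∂μ) ^ 4 ∂μ ≤ 16 * ∫ x, f x ^ 4 ∂μ := by
  set c := ∫ y, f y ∂μ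
  have h4 := hf.integrable_pow_four
  have hf2 : MemLp f 2 μ := hf.mono_exponent (by norm_num)
  have hc : c ^ 4 ≤ ∫ x, f x ^ 4 ∂μ := by
    have h1 := sq_integral_le_integral_sq hf2
    have h2 := sq_integral_le_integral_sq hf.sq_of_four
    simp only [← pow_mul] at h2
    have h3 : (c ^ 2) ^ 2 ≤ (∫ x, f x ^ 2 ∂μ) ^ 2 := pow_le_pow_left₀ (sq_nonneg _) h1 2
    calc c ^ 4 = (c ^ 2) ^ 2 := by ring
      _ ≤ _ := h3
      _ ≤ _ := by simpa using h2
  calc ∫ x, (f x - c) ^ 4 ∂μ ≤ ∫ x, (8 * f x ^ 4 + 8 * c ^ 4) ∂μ := by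
        refine integral_mono (hf.sub (memLp_const c)).integrable_pow_four
          ((h4.const_mul 8).add (integrable_const _)) fun x => ?_
        simp only
        nlinarith [sq_nonneg (f x + c), sq_nonneg (f x - c), sq_nonneg (f x ^ 2 - c ^ 2),
          mul_nonneg (sq_nonneg (f x + c)) (sq_nonneg (f x - c)), sq_nonneg ((f x + c) ^ 2)]
    _ = 8 * ∫ x, f x ^ 4 ∂μ + 8 * c ^ 4 := by
        rw [integral_add (h4.const_mul 8) (integrable_const _), integral_const_mul]; simp
    _ ≤ _ := by linarith

end Moments

/-- The projection `b ↦ E_{Y ∼ γ} h(Y, b)` of a kernel. -/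
noncomputable def kerProj {𝒴 : Type*} [MeasurableSpace 𝒴] (h : 𝒴 → 𝒴 → ℝ) (γ : Measure 𝒴)
    (b : 𝒴) : ℝ :=
  ∫ a, h a b ∂γ

section Projection

variable {𝒴 : Type*} [MeasurableSpace 𝒴] {γ : Measure 𝒴} [IsProbabilityMeasure γ]
  {h : 𝒴 → 𝒴 → ℝ}

lemma measurable_kerProj (hm : Measurable (Function.uncurry h)) : Measurable (kerProj h γ) :=
  hm.stronglyMeasurable.integral_prod_left.measurable

lemma kerMean_eq_integral_kerProj (hi : Integrable (Function.uncurry h) (γ.prod γ)) :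
    kerMean h γ = ∫ b, kerProj h γ b ∂γ :=
  integral_prod_symm _ hi

lemma kerProj_sq_le_ae (h2 : MemLp (Function.uncurry h) 2 (γ.prod γ)) :
    ∀ᵐ b ∂γ, kerProj h γ b ^ 2 ≤ kerProj (fun a b => h a b ^ 2) γ b := by
  filter_upwards [h2.integrable_sq.prod_left_ae, h2.1.prodMk_right] with b hb hb'
  exact sq_integral_le_integral_sq ((memLp_two_iff_integrable_sq hb').2 hb)

lemma kerProj_memLp_two (hm : Measurable (Function.uncurry h))
    (h2 : MemLp (Function.uncurry h) 2 (γ.prod γ)) :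
    MemLp (kerProj h γ) 2 γ ∧
      ∫ b, kerProj h γ b ^ 2 ∂γ ≤ ∫ z, Function.uncurry h z ^ 2 ∂(γ.prod γ) := by
  have hi : Integrable (kerProj (fun a b => h a b ^ 2) γ) γ := h2.integrable_sq.integral_prod_right
  have hL : MemLp (kerProj h γ) 2 γ := by
    refine (memLp_two_iff_integrable_sq (measurable_kerProj hm).aestronglyMeasurable).2 ?_
    refine hi.mono' ((measurable_kerProj hm).pow_const 2).aestronglyMeasurable ?_
    filter_upwards [kerProj_sq_le_ae h2] with b hb
    rwa [Real.norm_of_nonneg (sq_nonneg _)]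
  refine ⟨hL, (integral_mono_ae hL.integrable_sq hi (kerProj_sq_le_ae h2)).trans_eq ?_⟩
  exact (integral_prod_symm _ h2.integrable_sq).symm

/-- Jensen on sections bounds the fourth power of the projection by the squared projection of `h²`,
which reduces the claim to `kerProj_memLp_two`. -/
lemma kerProj_memLp_four (hm : Measurable (Function.uncurry h))
    (h4 : MemLp (Function.uncurry h) 4 (γ.prod γ)) :
    MemLp (kerProj h γ) 4 γ ∧
      ∫ b, kerProj h γ b ^ 4 ∂γ ≤ ∫ z, Function.uncurry h z ^ 4 ∂(γ.prod γ) := by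
  have h2 : MemLp (Function.uncurry h) 2 (γ.prod γ) := h4.mono_exponent (by norm_num)
  obtain ⟨k1, k2⟩ := kerProj_memLp_two (h := fun a b => h a b ^ 2) (γ := γ) (hm.pow_const 2)
    h4.sq_of_four
  have hle : ∀ᵐ b ∂γ, kerProj h γ b ^ 4 ≤ kerProj (fun a b => h a b ^ 2) γ b ^ 2 := by
    filter_upwards [kerProj_sq_le_ae h2] with b hb
    calc kerProj h γ b ^ 4 = (kerProj h γ b ^ 2) ^ 2 := by ring
      _ ≤ _ := pow_le_pow_left₀ (sq_nonneg _) hb 2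
  have hL : MemLp (kerProj h γ) 4 γ := by
    refine memLp_four_of_integrable_pow (measurable_kerProj hm).aestronglyMeasurable ?_
    refine k1.integrable_sq.mono' ((measurable_kerProj hm).pow_const 4).aestronglyMeasurable ?_
    filter_upwards [hle] with b hb
    rwa [Real.norm_of_nonneg (by positivity)]
  refine ⟨hL, (integral_mono_ae hL.integrable_pow_four k1.integrable_sq hle).trans
    (k2.trans_eq ?_)⟩
  simp [Function.uncurry, ← pow_mul]

end Projection

/-! ### Convergence in probability to constants -/

section InProbability

variable {ι Ω : Type*} [MeasurableSpace Ω] {Pr : Measure Ω} {l : Filter ι}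

lemma tendstoInMeasure_of_tendsto_const [IsFiniteMeasure Pr] {c : ι → ℝ} {a : ℝ}
    (hc : Tendsto c l (𝓝 a)) :
    TendstoInMeasure Pr (fun k (_ : Ω) => c k) l (fun _ => a) := by
  rw [tendstoInMeasure_iff_measureReal_norm]
  intro ε hε
  refine tendsto_const_nhds.congr' ?_
  filter_upwards [(Metric.tendsto_nhds.1 hc) ε hε] with k hk
  rw [Real.dist_eq] at hk
  have : {x : Ω | ε ≤ ‖c k - a‖} = ∅ := by
    ext; simpa using hk
  rw [this, measureReal_empty]

lemma tendstoInMeasure_zero_of_integral_le [IsFiniteMeasure Pr] {F : ι → Ω → ℝ} {b : ι → ℝ}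
    (hF : ∀ᶠ k in l, (∀ ω, 0 ≤ F k ω) ∧ Integrable (F k) Pr ∧ ∫ ω, F k ω ∂Pr ≤ b k)
    (hb : Tendsto b l (𝓝 0)) : TendstoInMeasure Pr F l (fun _ => 0) := by
  rw [tendstoInMeasure_iff_measureReal_norm]
  intro ε hε
  refine squeeze_zero' (Eventually.of_forall fun _ => measureReal_nonneg) ?_
    (by simpa using hb.div_const ε)
  filter_upwards [hF] with k ⟨h0, hi, hk⟩
  rw [le_div_iff₀ hε, mul_comm]
  have := mul_meas_ge_le_integral_of_nonneg (ae_of_all Pr h0) hi ε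
  simp only [sub_zero, Real.norm_of_nonneg (h0 _)]
  exact this.trans hk

lemma tendstoInMeasure_zero_of_integral_sq_le [IsFiniteMeasure Pr] {F : ι → Ω → ℝ} {b : ι → ℝ}
    (hF : ∀ᶠ k in l, MemLp (F k) 2 Pr ∧ ∫ ω, F k ω ^ 2 ∂Pr ≤ b k)
    (hb : Tendsto b l (𝓝 0)) : TendstoInMeasure Pr F l (fun _ => 0) := by
  have h := tendstoInMeasure_zero_of_integral_le (F := fun k ω => F k ω ^ 2)
    (hF.mono fun k hk => ⟨fun ω => sq_nonneg _, hk.1.integrable_sq, hk.2⟩) hb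
  rw [tendstoInMeasure_iff_measureReal_norm] at h ⊢
  intro ε hε
  refine squeeze_zero' (Eventually.of_forall fun _ => measureReal_nonneg)
    (Eventually.of_forall fun k => measureReal_mono ?_) (h (ε ^ 2) (by positivity))
  intro ω hω
  simp only [Set.mem_ofPred_eq, sub_zero, norm_pow] at hω ⊢
  gcongr

variable {E E' : Type*} [PseudoMetricSpace E] [PseudoMetricSpace E']

lemma tendstoInMeasure_const_prodMk {F : ι → Ω → E} {G : ι → Ω → E'} {a : E} {b : E'}
    (hF : TendstoInMeasure Pr F l (fun _ => a)) (hG : TendstoInMeasure Pr G l (fun _ => b)) :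
    TendstoInMeasure Pr (fun k ω => (F k ω, G k ω)) l (fun _ => (a, b)) := by
  rw [tendstoInMeasure_iff_dist] at *
  intro ε hε
  refine tendsto_of_tendsto_of_tendsto_of_le_of_le tendsto_const_nhds
    (by simpa using (hF ε hε).add (hG ε hε)) (fun _ => zero_le) fun k => ?_
  refine (measure_mono fun ω hω => ?_).trans (measure_union_le _ _)
  simpa [Prod.dist_eq] using hω

/-- Continuity at the limit alone suffices, so inverses and quotients are allowed when the limiting
denominator is nonzero. -/
lemma tendstoInMeasure_const_comp {F : ι → Ω → E} {a : E} {φ : E → E'}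
    (hF : TendstoInMeasure Pr F l (fun _ => a)) (hφ : ContinuousAt φ a) :
    TendstoInMeasure Pr (fun k ω => φ (F k ω)) l (fun _ => φ a) := by
  rw [tendstoInMeasure_iff_dist] at *
  intro ε hε
  obtain ⟨δ, hδ, h⟩ := Metric.continuousAt_iff.1 hφ ε hε
  refine tendsto_of_tendsto_of_tendsto_of_le_of_le tendsto_const_nhds
    (hF δ hδ) (fun _ => zero_le) fun k => measure_mono fun ω hω => ?_
  by_contra hcon
  simp only [Set.mem_ofPred_eq, not_le] at hcon hω
  exact absurd hω (not_le.2 (h hcon))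

/-- The domination is needed only eventually, which accommodates identities valid for large `n`
only. -/
lemma tendstoInMeasure_of_dist_le {F : ι → Ω → E} {a : E} {G : ι → Ω → ℝ}
    (hG : TendstoInMeasure Pr G l (fun _ => 0))
    (hFG : ∀ᶠ k in l, ∀ ω, dist (F k ω) a ≤ G k ω) :
    TendstoInMeasure Pr F l (fun _ => a) := by
  rw [tendstoInMeasure_iff_dist] at *
  intro ε hε
  refine tendsto_of_tendsto_of_tendsto_of_le_of_le' tendsto_const_nhds
    (hG ε hε) (Eventually.of_forall fun _ => zero_le) ?_
  filter_upwards [hFG] with k hk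
  refine measure_mono fun ω hω => ?_
  simp only [Set.mem_ofPred_eq, Real.dist_eq, sub_zero] at hω ⊢
  exact (hω.trans (hk ω)).trans (le_abs_self _)

end InProbability

/-! ### Algebra of the statistics -/

section Algebra

variable {𝒴 : Type*} {h : 𝒴 → 𝒴 → ℝ}

lemma sum_sum_erase_hoeffding (g : 𝒴 → ℝ) (θ : ℝ) (n : ℕ) (y : ℕ → 𝒴) :
    ∑ i ∈ Finset.range n, ∑ j ∈ (Finset.range n).erase i,
        (h (y i) (y j) - g (y i) - g (y j) + θ)
      = ∑ i ∈ Finset.range n, ∑ j ∈ (Finset.range n).erase i, h (y i) (y j)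
        - 2 * ((n : ℝ) - 1) * ∑ i ∈ Finset.range n, g (y i) + n * ((n : ℝ) - 1) * θ := by
  have h1 : ∀ i ∈ Finset.range n, ∑ j ∈ (Finset.range n).erase i,
        (h (y i) (y j) - g (y i) - g (y j) + θ)
      = ∑ j ∈ (Finset.range n).erase i, h (y i) (y j) - ((n : ℝ) - 1) * g (y i)
        - (∑ j ∈ Finset.range n, g (y j) - g (y i)) + ((n : ℝ) - 1) * θ := by
    intro i hi
    have hn : 1 ≤ n := by have := Finset.mem_range.1 hi; omega
    rw [Finset.sum_add_distrib, Finset.sum_sub_distrib, Finset.sum_sub_distrib,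
      Finset.sum_const, Finset.sum_const, Finset.card_erase_of_mem hi, Finset.card_range,
      Finset.sum_erase_eq_sub (f := fun j => g (y j)) hi, nsmul_eq_mul, nsmul_eq_mul, Nat.cast_sub hn, Nat.cast_one]
  rw [Finset.sum_congr rfl h1, Finset.sum_add_distrib, Finset.sum_sub_distrib,
    Finset.sum_sub_distrib, Finset.sum_sub_distrib, ← Finset.mul_sum, Finset.sum_const,
    Finset.sum_const, Finset.card_range, nsmul_eq_mul, nsmul_eq_mul]
  ring

/-- The Hoeffding decomposition of a U-statistic. -/
lemma uStat_sub_eq (g : 𝒴 → ℝ) (θ : ℝ) {n : ℕ} (hn : 2 ≤ n) (y : ℕ → 𝒴) :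
    uStat h n y - θ = 2 * ((n : ℝ)⁻¹ * ∑ i ∈ Finset.range n, (g (y i) - θ))
      + ((n : ℝ) * ((n : ℝ) - 1))⁻¹ * ∑ i ∈ Finset.range n, ∑ j ∈ (Finset.range n).erase i,
        (h (y i) (y j) - g (y i) - g (y j) + θ) := by
  have hn2 : (2 : ℝ) ≤ n := by exact_mod_cast hn
  have h1 : (n : ℝ) ≠ 0 := by positivity
  have h2 : (n : ℝ) - 1 ≠ 0 := by linarith
  rw [sum_sum_erase_hoeffding, uStat, Finset.sum_sub_distrib, Finset.sum_const, Finset.card_range,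
    nsmul_eq_mul]
  field_simp
  ring

/-- The three products in `h_a` have equal sums after relabelling indices; what remains is the mean
of the squared row means. -/
lemma vStatA_eq (n : ℕ) (y : ℕ → 𝒴) :
    vStatA h n y = (n : ℝ)⁻¹ * ∑ i ∈ Finset.range n,
      ((n : ℝ)⁻¹ * ∑ j ∈ Finset.range n, h (y i) (y j)) ^ 2 := by
  set s := Finset.range n
  have e1 : ∑ i ∈ s, ∑ j ∈ s, ∑ k ∈ s, h (y i) (y j) * h (y i) (y k)
      = ∑ i ∈ s, (∑ j ∈ s, h (y i) (y j)) ^ 2 := by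
    simp_rw [sq, Finset.sum_mul_sum]
  have e2 : ∑ i ∈ s, ∑ j ∈ s, ∑ k ∈ s, h (y j) (y i) * h (y j) (y k)
      = ∑ i ∈ s, (∑ j ∈ s, h (y i) (y j)) ^ 2 := by
    rw [Finset.sum_comm, ← e1]
  have e3 : ∑ i ∈ s, ∑ j ∈ s, ∑ k ∈ s, h (y k) (y i) * h (y k) (y j)
      = ∑ i ∈ s, (∑ j ∈ s, h (y i) (y j)) ^ 2 := by
    rw [← e2]
    refine Finset.sum_congr rfl fun i _ => ?_
    rw [Finset.sum_comm]
  unfold vStatA kerA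
  simp_rw [← Finset.mul_sum, Finset.sum_add_distrib]
  rw [e1, e2, e3]
  simp_rw [mul_pow, ← Finset.mul_sum]
  rcases eq_or_ne (n : ℝ) 0 with hn | hn
  -- For `n = 0` both sides vanish because the inverse of zero is zero.
  · simp [hn]
  · field_simp
    ring

/-- With `vStatA_eq`, the difference of the two V-statistics becomes the empirical variance of the
row means. -/
lemma vStatB_eq (n : ℕ) (y : ℕ → 𝒴) :
    vStatB h n y = ((n : ℝ)⁻¹ * ∑ i ∈ Finset.range n,
      ((n : ℝ)⁻¹ * ∑ j ∈ Finset.range n, h (y i) (y j))) ^ 2 := by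
  set s := Finset.range n
  set T := ∑ i ∈ s, ∑ j ∈ s, h (y i) (y j)
  have e1 : ∑ i ∈ s, ∑ j ∈ s, ∑ k ∈ s, ∑ m ∈ s, h (y i) (y j) * h (y k) (y m) = T ^ 2 := by
    simp_rw [← Finset.mul_sum, ← Finset.sum_mul]
    rw [sq]
  have e2 : ∑ i ∈ s, ∑ j ∈ s, ∑ k ∈ s, ∑ m ∈ s, h (y i) (y k) * h (y j) (y m) = T ^ 2 := by
    rw [← e1]
    exact Finset.sum_congr rfl fun i _ => Finset.sum_comm
  have e3 : ∑ i ∈ s, ∑ j ∈ s, ∑ k ∈ s, ∑ m ∈ s, h (y i) (y m) * h (y j) (y k) = T ^ 2 := by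
    rw [← e2]
    refine Finset.sum_congr rfl fun i _ => Finset.sum_congr rfl fun j _ => Finset.sum_comm
  unfold vStatB kerB
  simp_rw [← Finset.mul_sum, Finset.sum_add_distrib]
  rw [e1, e2, e3]
  rcases eq_or_ne (n : ℝ) 0 with hn | hn
  · simp [hn]
  · field_simp
    ring

lemma empirical_variance_shift (n : ℕ) (hn : 1 ≤ n) (g : ℕ → ℝ) (θ : ℝ) :
    (n : ℝ)⁻¹ * ∑ i ∈ Finset.range n, g i ^ 2 - ((n : ℝ)⁻¹ * ∑ i ∈ Finset.range n, g i) ^ 2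
      = (n : ℝ)⁻¹ * ∑ i ∈ Finset.range n, (g i - θ) ^ 2
        - ((n : ℝ)⁻¹ * ∑ i ∈ Finset.range n, (g i - θ)) ^ 2 := by
  have h1 : (n : ℝ) ≠ 0 := by positivity
  have h2 : ∑ i ∈ Finset.range n, (g i - θ) ^ 2 = ∑ i ∈ Finset.range n, g i ^ 2
      - 2 * θ * ∑ i ∈ Finset.range n, g i + n * θ ^ 2 := by
    simp_rw [sub_sq, Finset.sum_add_distrib, Finset.sum_sub_distrib, Finset.mul_sum]
    simp only [Finset.sum_const, Finset.card_range, nsmul_eq_mul, add_left_inj, sub_right_inj]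
    exact Finset.sum_congr rfl fun i _ => by ring
  rw [h2, Finset.sum_sub_distrib, Finset.sum_const, Finset.card_range, nsmul_eq_mul]
  field_simp
  ring

lemma abs_mean_mul_le (n : ℕ) (a e : ℕ → ℝ) :
    |(n : ℝ)⁻¹ * ∑ i ∈ Finset.range n, a i * e i|
      ≤ √((n : ℝ)⁻¹ * ∑ i ∈ Finset.range n, a i ^ 2)
        * √((n : ℝ)⁻¹ * ∑ i ∈ Finset.range n, e i ^ 2) := by
  rw [← Real.sqrt_mul (by positivity)]
  refine Real.abs_le_sqrt ?_
  have := Finset.sum_mul_sq_le_sq_mul_sq (Finset.range n) a e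
  rw [mul_pow]
  calc _ ≤ (n : ℝ)⁻¹ ^ 2 * ((∑ i ∈ Finset.range n, a i ^ 2) * ∑ i ∈ Finset.range n, e i ^ 2) := by
        gcongr
    _ = _ := by ring

lemma abs_mean_le (n : ℕ) (e : ℕ → ℝ) :
    |(n : ℝ)⁻¹ * ∑ i ∈ Finset.range n, e i| ≤ √((n : ℝ)⁻¹ * ∑ i ∈ Finset.range n, e i ^ 2) := by
  rcases Nat.eq_zero_or_pos n with rfl | hn
  · simp
  have h1 : (n : ℝ) ≠ 0 := by positivity
  have := abs_mean_mul_le n e (fun _ => 1)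
  simpa [h1] using this

/-- Here `a` stands for the centred projections and `e` for the row-mean errors. Cauchy–Schwarz
bounds the cross term, so smallness of the mean of `a` and of the mean square of `e` is enough. -/
lemma abs_empirical_variance_sub_le (n : ℕ) (a e : ℕ → ℝ) :
    |(n : ℝ)⁻¹ * ∑ i ∈ Finset.range n, (a i + e i) ^ 2
        - ((n : ℝ)⁻¹ * ∑ i ∈ Finset.range n, (a i + e i)) ^ 2
        - (n : ℝ)⁻¹ * ∑ i ∈ Finset.range n, a i ^ 2|
      ≤ 2 * (√((n : ℝ)⁻¹ * ∑ i ∈ Finset.range n, a i ^ 2)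
          * √((n : ℝ)⁻¹ * ∑ i ∈ Finset.range n, e i ^ 2))
        + (n : ℝ)⁻¹ * ∑ i ∈ Finset.range n, e i ^ 2
        + (|(n : ℝ)⁻¹ * ∑ i ∈ Finset.range n, a i|
          + √((n : ℝ)⁻¹ * ∑ i ∈ Finset.range n, e i ^ 2)) ^ 2 := by
  have h1 := abs_mean_mul_le n a e
  have h2 := abs_mean_le n e
  have h3 : (n : ℝ)⁻¹ * ∑ i ∈ Finset.range n, (a i + e i) ^ 2
      = (n : ℝ)⁻¹ * ∑ i ∈ Finset.range n, a i ^ 2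
        + 2 * ((n : ℝ)⁻¹ * ∑ i ∈ Finset.range n, a i * e i)
        + (n : ℝ)⁻¹ * ∑ i ∈ Finset.range n, e i ^ 2 := by
    have : ∑ i ∈ Finset.range n, (a i + e i) ^ 2 = ∑ i ∈ Finset.range n, a i ^ 2
        + 2 * ∑ i ∈ Finset.range n, a i * e i + ∑ i ∈ Finset.range n, e i ^ 2 := by
      rw [Finset.mul_sum, ← Finset.sum_add_distrib, ← Finset.sum_add_distrib]
      exact Finset.sum_congr rfl fun i _ => by ring
    rw [this]; ring
  rw [h3, Finset.sum_add_distrib, mul_add]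
  have h5 : 0 ≤ (n : ℝ)⁻¹ * ∑ i ∈ Finset.range n, e i ^ 2 := by positivity
  generalize (n : ℝ)⁻¹ * ∑ i ∈ Finset.range n, a i ^ 2 = A at *
  generalize (n : ℝ)⁻¹ * ∑ i ∈ Finset.range n, e i ^ 2 = E at *
  generalize (n : ℝ)⁻¹ * ∑ i ∈ Finset.range n, a i * e i = C at *
  generalize (n : ℝ)⁻¹ * ∑ i ∈ Finset.range n, a i = a' at *
  generalize (n : ℝ)⁻¹ * ∑ i ∈ Finset.range n, e i = e' at *
  have h4 : (a' + e') ^ 2 ≤ (|a'| + √E) ^ 2 := by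
    rw [← sq_abs (a' + e')]
    gcongr
    exact (abs_add_le _ _).trans (by linarith)
  rw [abs_le] at h1 ⊢
  constructor <;> nlinarith [sq_nonneg (a' + e')]

end Algebra

/-! ### Quantitative bounds for U-statistics -/

section Bounds

variable {Ω 𝒴 : Type*} [MeasurableSpace Ω] [MeasurableSpace 𝒴] {Pr : Measure Ω} {γ : Measure 𝒴}
  [IsProbabilityMeasure Pr] [IsProbabilityMeasure γ] {X : ℕ → Ω → 𝒴} {h : 𝒴 → 𝒴 → ℝ}

lemma memLp_comp_fst {f : 𝒴 → ℝ} {p : ℝ≥0∞} (hf : MemLp f p γ) :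
    MemLp (fun z : 𝒴 × 𝒴 => f z.1) p (γ.prod γ) :=
  measurePreserving_fst.hasLaw.memLp_comp hf

lemma memLp_comp_snd {f : 𝒴 → ℝ} {p : ℝ≥0∞} (hf : MemLp f p γ) :
    MemLp (fun z : 𝒴 × 𝒴 => f z.2) p (γ.prod γ) :=
  measurePreserving_snd.hasLaw.memLp_comp hf

lemma integral_comp_fst {f : 𝒴 → ℝ} (hf : AEStronglyMeasurable f γ) :
    ∫ z : 𝒴 × 𝒴, f z.1 ∂(γ.prod γ) = ∫ y, f y ∂γ :=
  measurePreserving_fst.hasLaw.integral_comp hf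

lemma integral_comp_snd {f : 𝒴 → ℝ} (hf : AEStronglyMeasurable f γ) :
    ∫ z : 𝒴 × 𝒴, f z.2 ∂(γ.prod γ) = ∫ y, f y ∂γ :=
  measurePreserving_snd.hasLaw.integral_comp hf

omit [MeasurableSpace 𝒴] [IsProbabilityMeasure Pr] in
lemma memLp_const_mul_sum {F : ℕ → Ω → ℝ} {s : Finset ℕ} (hF : ∀ i ∈ s, MemLp (F i) 2 Pr) (c : ℝ) :
    MemLp (fun ω => c * ∑ i ∈ s, F i ω) 2 Pr :=
  (memLp_finsetSum s hF).const_mul c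

variable {M : ℝ} (hm : Measurable (Function.uncurry h))
  (h4 : MemLp (Function.uncurry h) 4 (γ.prod γ))
  (hM : ∫ z, Function.uncurry h z ^ 4 ∂(γ.prod γ) ≤ M)

include h4 in
lemma integrable_kernel : Integrable (Function.uncurry h) (γ.prod γ) :=
  h4.integrable (by norm_num)

include hm h4 in
lemma memLp_kerProj_sub : MemLp (fun b => kerProj h γ b - kerMean h γ) 4 γ :=
  (kerProj_memLp_four hm h4).1.sub (memLp_const _)

include hm h4 in
lemma integral_kerProj_sub : ∫ b, (kerProj h γ b - kerMean h γ) ∂γ = 0 := by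
  rw [integral_sub ((kerProj_memLp_four hm h4).1.integrable (by norm_num)) (integrable_const _),
    ← kerMean_eq_integral_kerProj (integrable_kernel h4)]
  simp

include hm h4 hM

lemma integral_kerProj_sub_pow_four_le :
    ∫ b, (kerProj h γ b - kerMean h γ) ^ 4 ∂γ ≤ 16 * M := by
  rw [kerMean_eq_integral_kerProj (integrable_kernel h4)]
  have h1 := kerProj_memLp_four hm h4
  exact (integral_pow_four_sub_le h1.1).trans (by linarith [h1.2])

omit hm in
lemma integral_kernel_sq_le : ∫ z, Function.uncurry h z ^ 2 ∂(γ.prod γ) ≤ 1 + M :=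
  (integral_sq_le_of_four h4).trans (by linarith)

lemma integral_kerProj_sq_le : ∫ b, kerProj h γ b ^ 2 ∂γ ≤ 1 + M :=
  (kerProj_memLp_two hm (h4.mono_exponent (by norm_num))).2.trans
    (integral_kernel_sq_le h4 hM)

lemma integral_kerProj_sub_sq_le : ∫ b, (kerProj h γ b - kerMean h γ) ^ 2 ∂γ ≤ 1 + M := by
  rw [kerMean_eq_integral_kerProj (integrable_kernel h4)]
  exact (integral_sq_sub_const_le (kerProj_memLp_two hm (h4.mono_exponent (by norm_num))).1).trans
    (integral_kerProj_sq_le hm h4 hM)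

omit hM in
lemma memLp_kernel_sub_kerProj :
    MemLp (Function.uncurry fun a b => h a b - kerProj h γ a) 2 (γ.prod γ) :=
  (h4.mono_exponent (by norm_num)).sub
    (memLp_comp_fst ((kerProj_memLp_four hm h4).1.mono_exponent (by norm_num)))

lemma integral_kernel_sub_kerProj_sq_le :
    ∫ z, (Function.uncurry fun a b => h a b - kerProj h γ a) z ^ 2 ∂(γ.prod γ)
      ≤ 4 * (1 + M) := by
  have h1 : MemLp (kerProj h γ) 2 γ := (kerProj_memLp_four hm h4).1.mono_exponent (by norm_num)
  refine (integral_sq_sub_le (h4.mono_exponent (by norm_num)) (memLp_comp_fst h1)).trans ?_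
  rw [integral_comp_fst (f := fun y => kerProj h γ y ^ 2) h1.integrable_sq.1]
  linarith [integral_kernel_sq_le h4 hM, integral_kerProj_sq_le hm h4 hM]

omit hM in
lemma memLp_degenerate : MemLp (Function.uncurry fun a b =>
    h a b - kerProj h γ a - kerProj h γ b + kerMean h γ) 2 (γ.prod γ) :=
  ((memLp_kernel_sub_kerProj hm h4).sub
    (memLp_comp_snd ((kerProj_memLp_four hm h4).1.mono_exponent (by norm_num)))).add
    (memLp_const _)

/-- The degenerate kernel is `h a b - kerProj h γ a` minus the centred projection at `b`; 10 = 2·4 +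
2·1. -/
lemma integral_degenerate_sq_le : ∫ z, (Function.uncurry fun a b =>
    h a b - kerProj h γ a - kerProj h γ b + kerMean h γ) z ^ 2 ∂(γ.prod γ) ≤ 10 * (1 + M) := by
  have h1 : MemLp (fun b => kerProj h γ b - kerMean h γ) 2 γ :=
    (memLp_kerProj_sub hm h4).mono_exponent (by norm_num)
  have h2 := integral_sq_sub_le (memLp_kernel_sub_kerProj hm h4) (memLp_comp_snd h1)
  rw [integral_comp_snd (f := fun y => (kerProj h γ y - kerMean h γ) ^ 2)
    h1.integrable_sq.1] at h2
  have h3 : ∀ z : 𝒴 × 𝒴, (Function.uncurry fun a b =>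
      h a b - kerProj h γ a - kerProj h γ b + kerMean h γ) z
      = (Function.uncurry fun a b => h a b - kerProj h γ a) z
        - (kerProj h γ z.2 - kerMean h γ) := fun z => by
    simp only [Function.uncurry]; ring
  simp_rw [h3]
  linarith [integral_kernel_sub_kerProj_sq_le hm h4 hM, integral_kerProj_sub_sq_le hm h4 hM]

variable (hs : ∀ a b, h a b = h b a)

omit hm h4 hM in
include hs in
-- The identity holds for every `a`, as the orthogonality lemmas demand: where the section of `h` is
-- not integrable, neither is the integrand, and its integral is zero by convention.
lemma integral_kernel_sub_kerProj (a : 𝒴) : ∫ b, (h a b - kerProj h γ a) ∂γ = 0 := by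
  by_cases hi : Integrable (fun b => h a b) γ
  · rw [integral_sub hi (integrable_const _)]
    simp [kerProj, hs _ a]
  · refine integral_undef fun hcon => hi ?_
    exact (hcon.add (integrable_const (kerProj h γ a))).congr (ae_of_all _ fun b => by simp)

omit hM in
include hm hs in
lemma integral_degenerate (b : 𝒴) :
    ∫ a, (h a b - kerProj h γ a - kerProj h γ b + kerMean h γ) ∂γ = 0 := by
  have h1 : Integrable (fun a => kerProj h γ a - kerMean h γ) γ :=
    (memLp_kerProj_sub hm h4).integrable (by norm_num)
  have h2 : ∀ a, h a b - kerProj h γ a - kerProj h γ b + kerMean h γ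
      = (h b a - kerProj h γ b) - (kerProj h γ a - kerMean h γ) := fun a => by rw [hs a b]; ring
  simp_rw [h2]
  by_cases hi : Integrable (fun a => h b a - kerProj h γ b) γ
  · rw [integral_sub hi h1, integral_kernel_sub_kerProj hs, integral_kerProj_sub hm h4, sub_zero]
  · refine integral_undef fun hcon => hi ?_
    exact (hcon.add h1).congr (ae_of_all _ fun a => by simp)

variable (hX : ∀ i, HasLaw (X i) γ Pr) (hind : iIndepFun X Pr)

include hX hind hs

/-- The degenerate part of a U-statistic is of order `1 / n` in `L²`. -/
lemma degenerate_part_bound {n : ℕ} (hn : 2 ≤ n) :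
    MemLp (fun ω => ((n : ℝ) * ((n : ℝ) - 1))⁻¹ * ∑ i ∈ Finset.range n,
      ∑ j ∈ (Finset.range n).erase i, (h (X i ω) (X j ω) - kerProj h γ (X i ω)
        - kerProj h γ (X j ω) + kerMean h γ)) 2 Pr ∧
    ∫ ω, (((n : ℝ) * ((n : ℝ) - 1))⁻¹ * ∑ i ∈ Finset.range n,
      ∑ j ∈ (Finset.range n).erase i, (h (X i ω) (X j ω) - kerProj h γ (X i ω)
        - kerProj h γ (X j ω) + kerMean h γ)) ^ 2 ∂Pr ≤ 20 * (1 + M) * ((n : ℝ) * (n - 1))⁻¹ := by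
  set d : 𝒴 → 𝒴 → ℝ := fun a b => h a b - kerProj h γ a - kerProj h γ b + kerMean h γ with hd
  have hd2 := memLp_degenerate hm h4
  have hdm : Measurable (Function.uncurry d) :=
    ((hm.sub ((measurable_kerProj hm).comp measurable_fst)).sub
      ((measurable_kerProj hm).comp measurable_snd)).add_const _
  have hds : ∀ a b, d a b = d b a := fun a b => by simp only [hd, hs a b]; ring
  have hint := integral_sq_sum_degenerate hX hind hdm hds (integral_degenerate hm h4 hs) hd2 n
  constructor
  · refine memLp_const_mul_sum (fun i _ => memLp_finsetSum _ fun j hj => ?_) _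
    exact (hasLaw_pair hX hind (Finset.ne_of_mem_erase hj).symm).memLp_comp hd2
  · simp_rw [mul_pow, integral_const_mul]
    change _ * ∫ ω, (∑ i ∈ Finset.range n, ∑ j ∈ (Finset.range n).erase i,
      d (X i ω) (X j ω)) ^ 2 ∂Pr ≤ _
    rw [hint, Finset.offDiag_card, Finset.card_range, Nat.cast_sub (by nlinarith), Nat.cast_mul]
    have hn2 : (2 : ℝ) ≤ n := by exact_mod_cast hn
    have hpos : 0 < (n : ℝ) * (n - 1) := by nlinarith
    have h1 := integral_degenerate_sq_le hm h4 hM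
    have e : ((n : ℝ) * n - n) = n * (n - 1) := by ring
    rw [e]
    calc _ = ((n : ℝ) * (n - 1))⁻¹ * (2 * ∫ z, Function.uncurry d z ^ 2 ∂(γ.prod γ)) := by
          field_simp
      _ ≤ ((n : ℝ) * (n - 1))⁻¹ * (2 * (10 * (1 + M))) := by gcongr
      _ = _ := by ring

omit hs in
lemma mean_kerProj_bound (n : ℕ) :
    MemLp (fun ω => (n : ℝ)⁻¹ * ∑ i ∈ Finset.range n,
      (kerProj h γ (X i ω) - kerMean h γ)) 2 Pr ∧
    ∫ ω, ((n : ℝ)⁻¹ * ∑ i ∈ Finset.range n, (kerProj h γ (X i ω) - kerMean h γ)) ^ 2 ∂Pr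
      ≤ (1 + M) * (n : ℝ)⁻¹ := by
  have hf : MemLp (fun b => kerProj h γ b - kerMean h γ) 2 γ :=
    (memLp_kerProj_sub hm h4).mono_exponent (by norm_num)
  constructor
  · exact memLp_const_mul_sum (fun i _ => (hX i).memLp_comp hf) _
  · simp_rw [mul_pow, integral_const_mul]
    rw [integral_sq_sum_centred hX hind (f := fun b => kerProj h γ b - kerMean h γ)
      ((measurable_kerProj hm).sub_const _) (integral_kerProj_sub hm h4) hf]
    have h1 := integral_kerProj_sub_sq_le hm h4 hM
    rcases Nat.eq_zero_or_pos n with rfl | hn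
    · simp
    calc _ = (n : ℝ)⁻¹ * ∫ z, (kerProj h γ z - kerMean h γ) ^ 2 ∂γ := by
          field_simp
      _ ≤ (n : ℝ)⁻¹ * (1 + M) := by gcongr
      _ = _ := by ring

omit hs in
-- A law of large numbers in `L²` for squared projections; this is where fourth moments of the
-- projection enter.
lemma mean_kerProj_sq_bound (n : ℕ) (hn : 1 ≤ n) :
    MemLp (fun ω => (n : ℝ)⁻¹ * ∑ i ∈ Finset.range n, (kerProj h γ (X i ω) - kerMean h γ) ^ 2
      - ∫ b, (kerProj h γ b - kerMean h γ) ^ 2 ∂γ) 2 Pr ∧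
    ∫ ω, ((n : ℝ)⁻¹ * ∑ i ∈ Finset.range n, (kerProj h γ (X i ω) - kerMean h γ) ^ 2
      - ∫ b, (kerProj h γ b - kerMean h γ) ^ 2 ∂γ) ^ 2 ∂Pr ≤ 16 * M * (n : ℝ)⁻¹ := by
  set v := ∫ b, (kerProj h γ b - kerMean h γ) ^ 2 ∂γ with hv
  have hf : MemLp (fun b => (kerProj h γ b - kerMean h γ) ^ 2) 2 γ :=
    (memLp_kerProj_sub hm h4).sq_of_four
  have hf' : MemLp (fun b => (kerProj h γ b - kerMean h γ) ^ 2 - v) 2 γ := hf.sub (memLp_const _)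
  have hn0 : (n : ℝ) ≠ 0 := by positivity
  have e : ∀ ω, (n : ℝ)⁻¹ * ∑ i ∈ Finset.range n, (kerProj h γ (X i ω) - kerMean h γ) ^ 2 - v
      = (n : ℝ)⁻¹ * ∑ i ∈ Finset.range n, ((kerProj h γ (X i ω) - kerMean h γ) ^ 2 - v) := by
    intro ω
    rw [Finset.sum_sub_distrib, Finset.sum_const, Finset.card_range, nsmul_eq_mul]
    field_simp
  simp_rw [e]
  constructor
  · exact memLp_const_mul_sum (fun i _ => (hX i).memLp_comp hf') _
  · simp_rw [mul_pow, integral_const_mul]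
    rw [integral_sq_sum_centred hX hind (f := fun b => (kerProj h γ b - kerMean h γ) ^ 2 - v)
      ((((measurable_kerProj hm).sub_const _).pow_const 2).sub_const _) ?_ hf']
    · have h1 : ∫ z, ((kerProj h γ z - kerMean h γ) ^ 2 - v) ^ 2 ∂γ ≤ 16 * M := by
        refine (integral_sq_sub_const_le hf).trans ?_
        simp only [← pow_mul]
        exact integral_kerProj_sub_pow_four_le hm h4 hM
      calc _ = (n : ℝ)⁻¹ * ∫ z, ((kerProj h γ z - kerMean h γ) ^ 2 - v) ^ 2 ∂γ := by
            field_simp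
        _ ≤ (n : ℝ)⁻¹ * (16 * M) := by gcongr
        _ = _ := by ring
    · rw [integral_sub (hf.integrable (by norm_num)) (integrable_const _)]
      simp [hv]

variable {N : ℝ} (hd : MemLp (fun y => h y y) 2 γ) (hN : ∫ y, h y y ^ 2 ∂γ ≤ N)

include hd hN

/-- The row means `n⁻¹ ∑_j h(Y_i, Y_j)` approximate the projection at `Y_i`. -/
lemma row_mean_bound {n i : ℕ} (hi : i ∈ Finset.range n) :
    MemLp (fun ω => (n : ℝ)⁻¹ * ∑ j ∈ Finset.range n, h (X i ω) (X j ω)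
      - kerProj h γ (X i ω)) 2 Pr ∧
    ∫ ω, ((n : ℝ)⁻¹ * ∑ j ∈ Finset.range n, h (X i ω) (X j ω)
      - kerProj h γ (X i ω)) ^ 2 ∂Pr ≤ (4 * N + 12 * (1 + M)) * (n : ℝ)⁻¹ := by
  have hn : 1 ≤ n := by have := Finset.mem_range.1 hi; omega
  have hn0 : (0 : ℝ) < n := by exact_mod_cast hn
  have hg : MemLp (kerProj h γ) 2 γ := (kerProj_memLp_four hm h4).1.mono_exponent (by norm_num)
  set e : 𝒴 → 𝒴 → ℝ := fun a b => h a b - kerProj h γ a with he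
  have he2 := memLp_kernel_sub_kerProj hm h4
  have hem : Measurable (Function.uncurry e) :=
    hm.sub ((measurable_kerProj hm).comp measurable_fst)
  have hD : MemLp (fun y => h y y - kerProj h γ y) 2 γ := hd.sub hg
  -- The V-statistic contains the diagonal term `j = i`. It is split off and controlled by the
  -- second moment of `h y y`; the other terms are centred given `X i`.
  have hid : ∀ ω, (n : ℝ)⁻¹ * ∑ j ∈ Finset.range n, h (X i ω) (X j ω) - kerProj h γ (X i ω)
      = (n : ℝ)⁻¹ * (h (X i ω) (X i ω) - kerProj h γ (X i ω))
        + (n : ℝ)⁻¹ * ∑ j ∈ (Finset.range n).erase i, e (X i ω) (X j ω) := by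
    intro ω
    have h1 : h (X i ω) (X i ω) - kerProj h γ (X i ω) = e (X i ω) (X i ω) := rfl
    rw [h1, ← mul_add, Finset.add_sum_erase _ (fun j => e (X i ω) (X j ω)) hi]
    simp only [he]
    rw [Finset.sum_sub_distrib, Finset.sum_const, Finset.card_range, nsmul_eq_mul]
    field_simp
  simp_rw [hid]
  have m1 : MemLp (fun ω => (n : ℝ)⁻¹ * (h (X i ω) (X i ω) - kerProj h γ (X i ω))) 2 Pr :=
    ((hX i).memLp_comp hD).const_mul _
  have m2 : MemLp (fun ω => (n : ℝ)⁻¹ * ∑ j ∈ (Finset.range n).erase i,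
      e (X i ω) (X j ω)) 2 Pr :=
    memLp_const_mul_sum (fun j hj =>
      (hasLaw_pair hX hind (Finset.ne_of_mem_erase hj).symm).memLp_comp he2) _
  refine ⟨m1.add m2, (integral_sq_add_le m1 m2).trans ?_⟩
  simp_rw [mul_pow, integral_const_mul]
  have b1 : ∫ ω, (h (X i ω) (X i ω) - kerProj h γ (X i ω)) ^ 2 ∂Pr ≤ 2 * N + 2 * (1 + M) := by
    have := (hX i).integral_comp (f := fun y => (h y y - kerProj h γ y) ^ 2) hD.integrable_sq.1
    change ∫ ω, (h (X i ω) (X i ω) - kerProj h γ (X i ω)) ^ 2 ∂Pr = _ at this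
    rw [this]
    exact (integral_sq_sub_le hd hg).trans (by linarith [integral_kerProj_sq_le hm h4 hM])
  have b2 : ∫ ω, (∑ j ∈ (Finset.range n).erase i, e (X i ω) (X j ω)) ^ 2 ∂Pr
      ≤ n * (4 * (1 + M)) := by
    rw [integral_sq_sum_row hX hind hem (integral_kernel_sub_kerProj hs) he2 i
      (Finset.notMem_erase _ _)]
    have hc : (((Finset.range n).erase i).card : ℝ) ≤ n := by
      exact_mod_cast (Finset.card_erase_le).trans (Finset.card_range n).le
    exact mul_le_mul hc (integral_kernel_sub_kerProj_sq_le hm h4 hM)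
      (integral_nonneg fun z => sq_nonneg _) hn0.le
  have hN0 : 0 ≤ 2 * N + 2 * (1 + M) := (integral_nonneg fun _ => sq_nonneg _).trans b1
  have hinv : (n : ℝ)⁻¹ ^ 2 ≤ (n : ℝ)⁻¹ := by
    have : (n : ℝ)⁻¹ ≤ 1 := inv_le_one_of_one_le₀ (by exact_mod_cast hn)
    have h0 : 0 ≤ (n : ℝ)⁻¹ := by positivity
    nlinarith
  calc _ ≤ 2 * ((n : ℝ)⁻¹ ^ 2 * (2 * N + 2 * (1 + M)))
        + 2 * ((n : ℝ)⁻¹ ^ 2 * (n * (4 * (1 + M)))) := by gcongr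
    _ ≤ 2 * ((n : ℝ)⁻¹ * (2 * N + 2 * (1 + M)))
        + 2 * ((n : ℝ)⁻¹ ^ 2 * (n * (4 * (1 + M)))) := by gcongr
    _ = _ := by field_simp; ring

lemma mean_row_error_bound {n : ℕ} (hn : 1 ≤ n) :
    Integrable (fun ω => (n : ℝ)⁻¹ * ∑ i ∈ Finset.range n, ((n : ℝ)⁻¹ *
      ∑ j ∈ Finset.range n, h (X i ω) (X j ω) - kerProj h γ (X i ω)) ^ 2) Pr ∧
    ∫ ω, (n : ℝ)⁻¹ * ∑ i ∈ Finset.range n, ((n : ℝ)⁻¹ *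
      ∑ j ∈ Finset.range n, h (X i ω) (X j ω) - kerProj h γ (X i ω)) ^ 2 ∂Pr
      ≤ (4 * N + 12 * (1 + M)) * (n : ℝ)⁻¹ := by
  have hb := fun i hi => row_mean_bound hm h4 hM hs hX hind hd hN (n := n) (i := i) hi
  have hi : ∀ i ∈ Finset.range n, Integrable (fun ω => ((n : ℝ)⁻¹ *
      ∑ j ∈ Finset.range n, h (X i ω) (X j ω) - kerProj h γ (X i ω)) ^ 2) Pr :=
    fun i hi => (hb i hi).1.integrable_sq
  refine ⟨(integrable_finsetSum _ hi).const_mul _, ?_⟩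
  rw [integral_const_mul, integral_finsetSum _ hi]
  have hn0 : (n : ℝ) ≠ 0 := by positivity
  calc _ ≤ (n : ℝ)⁻¹ * ∑ i ∈ Finset.range n, (4 * N + 12 * (1 + M)) * (n : ℝ)⁻¹ := by
        gcongr with i hi
        exact (hb i hi).2
    _ = _ := by
        rw [Finset.sum_const, Finset.card_range, nsmul_eq_mul]
        field_simp

end Bounds

/-! ### Asymptotics of studentized U-statistics -/

section Asymptotics

variable {ι Ω 𝒴 : Type*} [MeasurableSpace Ω] [MeasurableSpace 𝒴] {Pr : Measure Ω}
  [IsProbabilityMeasure Pr] {l : Filter ι} {n : ι → ℕ}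
  {γ : ι → Measure 𝒴} [∀ k, IsProbabilityMeasure (γ k)] {X : ι → ℕ → Ω → 𝒴} {h : 𝒴 → 𝒴 → ℝ}

lemma projVar_eq {γ : Measure 𝒴} [IsProbabilityMeasure γ] (hm : Measurable (Function.uncurry h))
    (hi : Integrable (Function.uncurry h) (γ.prod γ)) :
    projVar h γ = 4 * ∫ b, (kerProj h γ b - kerMean h γ) ^ 2 ∂γ := by
  have h1 : projVar h γ = 4 * variance (kerProj h γ) γ := rfl
  rw [h1, variance_eq_integral (measurable_kerProj hm).aemeasurable,
    kerMean_eq_integral_kerProj hi]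

omit [IsProbabilityMeasure Pr] in
lemma aemeasurable_uStat (hm : Measurable (Function.uncurry h)) {X : ℕ → Ω → 𝒴}
    (hX : ∀ i, AEMeasurable (X i) Pr) (n : ℕ) :
    AEMeasurable (fun ω => uStat h n (fun i => X i ω)) Pr := by
  refine AEMeasurable.const_mul ?_ _
  refine Finset.aemeasurable_fun_sum _ fun i _ => Finset.aemeasurable_fun_sum _ fun j _ => ?_
  exact hm.comp_aemeasurable ((hX i).prodMk (hX j))

omit [IsProbabilityMeasure Pr] in
lemma aemeasurable_sigmaEst (hm : Measurable (Function.uncurry h)) {X : ℕ → Ω → 𝒴}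
    (hX : ∀ i, AEMeasurable (X i) Pr) (n : ℕ) :
    AEMeasurable (fun ω => sigmaEst h n (fun i => X i ω)) Pr := by
  have hp : ∀ i j, AEMeasurable (fun ω => h (X i ω) (X j ω)) Pr :=
    fun i j => hm.comp_aemeasurable ((hX i).prodMk (hX j))
  unfold sigmaEst
  simp_rw [vStatA_eq, vStatB_eq]
  refine (AEMeasurable.const_mul (AEMeasurable.sub (AEMeasurable.const_mul ?_ _) ?_) _).sqrt
  · exact Finset.aemeasurable_fun_sum _ fun i _ => AEMeasurable.pow_const
      ((Finset.aemeasurable_fun_sum _ fun j _ => hp i j).const_mul _) 2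
  · exact AEMeasurable.pow_const ((Finset.aemeasurable_fun_sum _ fun i _ =>
      (Finset.aemeasurable_fun_sum _ fun j _ => hp i j).const_mul _).const_mul _) 2

variable (hn : Tendsto n l atTop) (hX : ∀ k i, HasLaw (X k i) (γ k) Pr)
  (hind : ∀ k, iIndepFun (X k) Pr) (hm : Measurable (Function.uncurry h)) {M : ℝ}
  (hM : ∀ᶠ k in l, MemLp (Function.uncurry h) 4 ((γ k).prod (γ k)) ∧
    ∫ z, Function.uncurry h z ^ 4 ∂((γ k).prod (γ k)) ≤ M)

include hn hX hind hm hM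

omit hX hind hm hM in
lemma tendsto_const_mul_inv_natCast (C : ℝ) : Tendsto (fun k => C * (n k : ℝ)⁻¹) l (𝓝 0) := by
  simpa using (tendsto_inv_atTop_zero.comp (tendsto_natCast_atTop_atTop.comp hn)).const_mul C

lemma tendstoInMeasure_mean_kerProj : TendstoInMeasure Pr (fun k ω => (n k : ℝ)⁻¹ *
    ∑ i ∈ Finset.range (n k), (kerProj h (γ k) (X k i ω) - kerMean h (γ k))) l (fun _ => 0) := by
  refine tendstoInMeasure_zero_of_integral_sq_le ?_ (tendsto_const_mul_inv_natCast hn (1 + M))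
  filter_upwards [hM] with k hk
  exact mean_kerProj_bound hm hk.1 hk.2 (hX k) (hind k) (n k)

lemma tendstoInMeasure_mean_kerProj_sq {v : ℝ}
    (hv : Tendsto (fun k => ∫ b, (kerProj h (γ k) b - kerMean h (γ k)) ^ 2 ∂(γ k)) l (𝓝 v)) :
    TendstoInMeasure Pr (fun k ω => (n k : ℝ)⁻¹ * ∑ i ∈ Finset.range (n k),
      (kerProj h (γ k) (X k i ω) - kerMean h (γ k)) ^ 2) l (fun _ => v) := by
  have h1 : TendstoInMeasure Pr (fun k ω => (n k : ℝ)⁻¹ * ∑ i ∈ Finset.range (n k),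
      (kerProj h (γ k) (X k i ω) - kerMean h (γ k)) ^ 2
      - ∫ b, (kerProj h (γ k) b - kerMean h (γ k)) ^ 2 ∂(γ k)) l (fun _ => 0) := by
    refine tendstoInMeasure_zero_of_integral_sq_le ?_ (tendsto_const_mul_inv_natCast hn (16 * M))
    filter_upwards [hM, hn.eventually_ge_atTop 1] with k hk hk1
    exact mean_kerProj_sq_bound hm hk.1 hk.2 (hX k) (hind k) (n k) hk1
  have h2 := tendstoInMeasure_const_comp (φ := fun p : ℝ × ℝ => p.1 + p.2)
    (tendstoInMeasure_const_prodMk h1 (tendstoInMeasure_of_tendsto_const (Pr := Pr) hv))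
    (by fun_prop)
  simpa using h2

variable (hs : ∀ a b, h a b = h b a)

include hs

/-- The degenerate part of a U-statistic is negligible, even when multiplied by `√n`. -/
lemma tendstoInMeasure_degenerate_part {c : ι → ℝ} (hc : ∀ k, c k ^ 2 ≤ n k) :
    TendstoInMeasure Pr (fun k ω => c k * (((n k : ℝ) * ((n k : ℝ) - 1))⁻¹ *
      ∑ i ∈ Finset.range (n k), ∑ j ∈ (Finset.range (n k)).erase i,
        (h (X k i ω) (X k j ω) - kerProj h (γ k) (X k i ω)
        - kerProj h (γ k) (X k j ω) + kerMean h (γ k)))) l (fun _ => 0) := by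
  refine tendstoInMeasure_zero_of_integral_sq_le ?_
    (tendsto_const_mul_inv_natCast hn (40 * (1 + M)))
  filter_upwards [hM, hn.eventually_ge_atTop 2] with k hk hk2
  obtain ⟨b1, b2⟩ := degenerate_part_bound hm hk.1 hk.2 hs (hX k) (hind k) hk2
  refine ⟨b1.const_mul _, ?_⟩
  have hn2 : (2 : ℝ) ≤ n k := by exact_mod_cast hk2
  have hM0 : 0 ≤ 1 + M := by
    have : 0 ≤ ∫ z, Function.uncurry h z ^ 4 ∂((γ k).prod (γ k)) :=
      integral_nonneg fun _ => by positivity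
    linarith [hk.2]
  simp_rw [mul_pow (c k), integral_const_mul]
  calc _ ≤ (n k : ℝ) * (20 * (1 + M) * ((n k : ℝ) * (n k - 1))⁻¹) := by
        refine mul_le_mul (hc k) b2 (integral_nonneg fun _ => sq_nonneg _) (by linarith)
    _ = 20 * (1 + M) * ((n k : ℝ) - 1)⁻¹ := by
        have : (n k : ℝ) - 1 ≠ 0 := by linarith
        field_simp
    -- For n ≥ 2, (n - 1)⁻¹ ≤ 2n⁻¹, whence 40 = 2·20.
    _ ≤ 20 * (1 + M) * (2 * (n k : ℝ)⁻¹) := by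
        gcongr
        rw [inv_le_iff_one_le_mul₀ (by linarith)]
        field_simp
        linarith
    _ = _ := by ring

/-- Weak law of large numbers for U-statistics. -/
lemma tendstoInMeasure_uStat : TendstoInMeasure Pr (fun k ω =>
    uStat h (n k) (fun i => X k i ω) - kerMean h (γ k)) l (fun _ => 0) := by
  have h1 := tendstoInMeasure_mean_kerProj hn hX hind hm hM
  -- The factor is eventually 1; it is set to 0 at `n k = 0` so that its square is at most `n k` for
  -- every `k`.
  have h2 : TendstoInMeasure Pr (fun k ω => (if 1 ≤ n k then (1 : ℝ) else 0) *
      (((n k : ℝ) * ((n k : ℝ) - 1))⁻¹ *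
      ∑ i ∈ Finset.range (n k), ∑ j ∈ (Finset.range (n k)).erase i,
        (h (X k i ω) (X k j ω) - kerProj h (γ k) (X k i ω)
        - kerProj h (γ k) (X k j ω) + kerMean h (γ k)))) l (fun _ => 0) := by
    refine tendstoInMeasure_degenerate_part hn hX hind hm hM hs fun k => ?_
    split_ifs with hk
    · simpa using hk
    · simp
  have h3 := tendstoInMeasure_const_comp (φ := fun p : ℝ × ℝ => |2 * p.1 + p.2|)
    (tendstoInMeasure_const_prodMk h1 h2) (by fun_prop)
  simp only [mul_zero, add_zero, abs_zero] at h3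
  refine tendstoInMeasure_of_dist_le h3 ?_
  filter_upwards [hn.eventually_ge_atTop 2] with k hk ω
  rw [Real.dist_eq, sub_zero, uStat_sub_eq (kerProj h (γ k)) (kerMean h (γ k)) hk,
    if_pos (by omega), one_mul]

variable {N : ℝ} (hN : ∀ᶠ k in l, MemLp (fun y => h y y) 2 (γ k) ∧ ∫ y, h y y ^ 2 ∂(γ k) ≤ N)

include hN

/-- Consistency of the variance estimator. -/
lemma tendstoInMeasure_sigmaEst {σ : ℝ} (hσ : 0 < σ)
    (hv : Tendsto (fun k => projVar h (γ k)) l (𝓝 (σ ^ 2))) :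
    TendstoInMeasure Pr (fun k ω => sigmaEst h (n k) (fun i => X k i ω)) l (fun _ => σ) := by
  have hv' : Tendsto (fun k => ∫ b, (kerProj h (γ k) b - kerMean h (γ k)) ^ 2 ∂(γ k)) l
      (𝓝 (σ ^ 2 / 4)) := by
    refine (hv.div_const 4).congr' ?_
    filter_upwards [hM] with k hk
    rw [projVar_eq hm (integrable_kernel hk.1)]
    ring
  have hA := tendstoInMeasure_mean_kerProj_sq hn hX hind hm hM hv'
  have hB := tendstoInMeasure_mean_kerProj hn hX hind hm hM
  have hE : TendstoInMeasure Pr (fun k ω => (n k : ℝ)⁻¹ * ∑ i ∈ Finset.range (n k),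
      ((n k : ℝ)⁻¹ * ∑ j ∈ Finset.range (n k), h (X k i ω) (X k j ω)
        - kerProj h (γ k) (X k i ω)) ^ 2) l (fun _ => 0) := by
    refine tendstoInMeasure_zero_of_integral_le ?_
      (tendsto_const_mul_inv_natCast hn (4 * N + 12 * (1 + M)))
    filter_upwards [hM, hN, hn.eventually_ge_atTop 1] with k hk hk' hk1
    exact ⟨fun ω => by positivity,
      mean_row_error_bound hm hk.1 hk.2 hs (hX k) (hind k) hk'.1 hk'.2 hk1⟩
  have hV : TendstoInMeasure Pr (fun k ω => vStatA h (n k) (fun i => X k i ω)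
      - vStatB h (n k) (fun i => X k i ω)) l (fun _ => σ ^ 2 / 4) := by
    -- This function is the bound of `abs_empirical_variance_sub_le` plus the error of the law of
    -- large numbers; it is continuous and vanishes at (σ²/4, 0, 0).
    have h3 := tendstoInMeasure_const_comp
      (φ := fun p : ℝ × ℝ × ℝ => |p.1 - σ ^ 2 / 4| + (2 * (√p.1 * √p.2.2) + p.2.2
        + (|p.2.1| + √p.2.2) ^ 2))
      (tendstoInMeasure_const_prodMk hA (tendstoInMeasure_const_prodMk hB hE)) (by fun_prop)
    simp only [sub_self, abs_zero, Real.sqrt_zero, mul_zero, add_zero, ne_eq, OfNat.ofNat_ne_zero,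
      not_false_eq_true, zero_pow] at h3
    refine tendstoInMeasure_of_dist_le h3 ?_
    filter_upwards [hn.eventually_ge_atTop 1] with k hk ω
    rw [Real.dist_eq, vStatA_eq, vStatB_eq, empirical_variance_shift (n k) hk _ (kerMean h (γ k))]
    have hb := abs_empirical_variance_sub_le (n k)
      (fun i => kerProj h (γ k) (X k i ω) - kerMean h (γ k))
      (fun i => (n k : ℝ)⁻¹ * ∑ j ∈ Finset.range (n k), h (X k i ω) (X k j ω)
        - kerProj h (γ k) (X k i ω))
    have he : ∀ i, kerProj h (γ k) (X k i ω) - kerMean h (γ k)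
        + ((n k : ℝ)⁻¹ * ∑ j ∈ Finset.range (n k), h (X k i ω) (X k j ω)
        - kerProj h (γ k) (X k i ω)) = (n k : ℝ)⁻¹ * ∑ j ∈ Finset.range (n k),
          h (X k i ω) (X k j ω) - kerMean h (γ k) := fun i => by ring
    simp only [he] at hb
    have := abs_sub_le ((n k : ℝ)⁻¹ * ∑ i ∈ Finset.range (n k), ((n k : ℝ)⁻¹ *
        ∑ j ∈ Finset.range (n k), h (X k i ω) (X k j ω) - kerMean h (γ k)) ^ 2
      - ((n k : ℝ)⁻¹ * ∑ i ∈ Finset.range (n k), ((n k : ℝ)⁻¹ *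
        ∑ j ∈ Finset.range (n k), h (X k i ω) (X k j ω) - kerMean h (γ k))) ^ 2)
      ((n k : ℝ)⁻¹ * ∑ i ∈ Finset.range (n k), (kerProj h (γ k) (X k i ω) - kerMean h (γ k)) ^ 2)
      (σ ^ 2 / 4)
    linarith
  have hc : Tendsto (fun k => 4 * (((n k : ℝ) - 2) / ((n k : ℝ) - 1))) l (𝓝 4) := by
    have hnR : Tendsto (fun k => (n k : ℝ) - 1) l atTop :=
      tendsto_atTop_add_const_right _ _ (tendsto_natCast_atTop_atTop.comp hn)
    have h0 : Tendsto (fun k => 4 * (1 - ((n k : ℝ) - 1)⁻¹)) l (𝓝 4) := by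
      simpa using (((tendsto_inv_atTop_zero.comp hnR).const_sub 1).const_mul 4)
    refine h0.congr' ?_
    filter_upwards [hnR.eventually_gt_atTop 0] with k hk
    field_simp
    ring
  have h4 := tendstoInMeasure_const_comp (φ := fun p : ℝ × ℝ => √(p.1 * p.2))
    (tendstoInMeasure_const_prodMk (tendstoInMeasure_of_tendsto_const (Pr := Pr) hc) hV)
    (by fun_prop)
  have e : √(4 * (σ ^ 2 / 4)) = σ := by
    rw [mul_div_cancel₀ _ (by norm_num), Real.sqrt_sq hσ.le]
  simp only [e] at h4
  exact h4

omit hN in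
/-- Central limit theorem for U-statistics of triangular arrays. -/
lemma tendstoInDistribution_uStat [l.IsCountablyGenerated] {σ : ℝ}
    (hv : Tendsto (fun k => projVar h (γ k)) l (𝓝 (σ ^ 2))) :
    TendstoInDistribution (fun k ω => √(n k : ℝ) *
      (uStat h (n k) (fun i => X k i ω) - kerMean h (γ k))) l
      (fun x : ℝ => x) (fun _ => Pr) (gaussianReal 0 (σ ^ 2).toNNReal) := by
  have hf : ∀ k, Measurable fun b => 2 * (kerProj h (γ k) b - kerMean h (γ k)) :=
    fun k => ((measurable_kerProj hm).sub_const _).const_mul 2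
  have hL : ∀ᶠ k in l, MemLp (fun b => 2 * (kerProj h (γ k) b - kerMean h (γ k))) 4 (γ k) := by
    filter_upwards [hM] with k hk
    exact (memLp_kerProj_sub hm hk.1).const_mul 2
  -- The factor 2 reflects that each observation enters both arguments of `h`; the variance of this
  -- law is `projVar`.
  let ν : ι → Measure ℝ := fun k =>
    (γ k).map fun b => 2 * (kerProj h (γ k) b - kerMean h (γ k))
  have hν : ∀ k, IsProbabilityMeasure (ν k) := fun k =>
    Measure.isProbabilityMeasure_map (hf k).aemeasurable
  have hlaw : ∀ k i, HasLaw (fun ω => 2 * (kerProj h (γ k) (X k i ω) - kerMean h (γ k)))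
      (ν k) Pr := fun k i =>
    HasLaw.fun_comp (Y := fun b => 2 * (kerProj h (γ k) b - kerMean h (γ k)))
      ⟨(hf k).aemeasurable, rfl⟩ (hX k i)
  -- Third moments come from |x|³ ≤ 1 + x⁴; one factor 16 is 2⁴, the other is the price of centring.
  have hclt := tendstoInDistribution_triangular (v := (σ ^ 2).toNNReal) (M := 1 + 16 * 16 * M)
    hn hlaw (fun k => (hind k).comp
      (fun _ b => 2 * (kerProj h (γ k) b - kerMean h (γ k))) fun _ => hf k) ?_ ?_ ?_
  · refine tendstoInDistribution_of_tendstoInMeasure_sub _ _ hclt ?_ fun k =>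
      ((aemeasurable_uStat hm (fun i => (hX k i).aemeasurable) _).sub_const _).const_mul _
    have hdeg := tendstoInMeasure_const_comp (φ := fun x : ℝ => |x|)
      (tendstoInMeasure_degenerate_part hn hX hind hm hM hs (c := fun k => √(n k : ℝ))
      fun k => (Real.sq_sqrt (Nat.cast_nonneg _)).le) (by fun_prop)
    simp only [abs_zero] at hdeg
    refine tendstoInMeasure_of_dist_le (a := (0 : ℝ)) hdeg ?_
    filter_upwards [hn.eventually_ge_atTop 2] with k hk ω
    rw [Real.dist_eq, sub_zero, Pi.sub_apply, Pi.sub_apply,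
      uStat_sub_eq (kerProj h (γ k)) (kerMean h (γ k)) hk]
    refine le_of_eq (congrArg _ ?_)
    have hr : √(n k : ℝ) * (n k : ℝ)⁻¹ = (√(n k : ℝ))⁻¹ := by
      have : (0 : ℝ) < n k := by positivity
      rw [← div_eq_mul_inv, Real.sqrt_div_self]
    rw [← Finset.mul_sum, ← hr]
    ring
  · filter_upwards [hM] with k hk
    rw [integral_map (hf k).aemeasurable (by fun_prop), integral_const_mul,
      integral_kerProj_sub hm hk.1, mul_zero]
  · filter_upwards [hM, hL] with k hk hk'
    constructor
    · exact (memLp_map_measure_iff (by fun_prop) (hf k).aemeasurable).2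
        (hk'.mono_exponent (by norm_num))
    · rw [integral_map (hf k).aemeasurable (by fun_prop)]
      refine (integral_abs_cube_le_of_four hk').trans ?_
      simp_rw [mul_pow, integral_const_mul]
      linarith [integral_kerProj_sub_pow_four_le hm hk.1 hk.2]
  · rw [Real.coe_toNNReal _ (sq_nonneg σ)]
    refine hv.congr' ?_
    filter_upwards [hM] with k hk
    rw [integral_map (hf k).aemeasurable (by fun_prop), projVar_eq hm (integrable_kernel hk.1)]
    simp_rw [mul_pow, integral_const_mul]
    norm_num

/-- Asymptotic normality of the studentized U-statistic, centred at `μ`. -/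
theorem tendstoInDistribution_studentized [l.IsCountablyGenerated] {σ : ℝ} (hσ : 0 < σ)
    (hv : Tendsto (fun k => projVar h (γ k)) l (𝓝 (σ ^ 2))) {μ : ℝ}
    (hμ : Tendsto (fun k => √(n k : ℝ) * (kerMean h (γ k) - μ)) l (𝓝 0)) :
    TendstoInDistribution (fun k ω => √(n k : ℝ) *
      (uStat h (n k) (fun i => X k i ω) - μ) / sigmaEst h (n k) (fun i => X k i ω)) l
      (fun x : ℝ => x) (fun _ => Pr) (gaussianReal 0 1) := by
  -- The bias condition moves the centring from the current mean to `μ`; Slutsky's lemma then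
  -- divides by the estimator.
  have h1 := (tendstoInDistribution_uStat hn hX hind hm hM hs hv).add_of_tendstoInMeasure_const
    (tendstoInMeasure_of_tendsto_const (Pr := Pr) hμ) (fun k => aemeasurable_const)
  have h2 := tendstoInMeasure_const_comp (φ := fun x : ℝ => x⁻¹)
    (tendstoInMeasure_sigmaEst hn hX hind hm hM hs hN hσ hv) (continuousAt_inv₀ hσ.ne')
  have h3 := h1.continuous_comp_prodMk_of_tendstoInMeasure_const (g := fun p : ℝ × ℝ => p.1 * p.2)
    (by fun_prop) h2 fun k =>
      (aemeasurable_sigmaEst hm (fun i => (hX k i).aemeasurable) _).inv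
  have hfin : TendstoInDistribution (fun k ω => √(n k : ℝ) *
      (uStat h (n k) (fun i => X k i ω) - μ) / sigmaEst h (n k) (fun i => X k i ω)) l
      (fun x : ℝ => (x + 0) * σ⁻¹) (fun _ => Pr)
      (gaussianReal 0 (σ ^ 2).toNNReal) := by
    convert h3 using 3 with k ω
    simp only [Pi.add_apply]
    rw [div_eq_mul_inv]
    ring
  refine ⟨hfin.forall_aemeasurable, aemeasurable_id', ?_⟩
  convert hfin.tendsto using 2
  refine congrArg _ (Subtype.ext ?_)
  simp only [add_zero, Measure.map_id']
  rw [gaussianReal_map_mul_const]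
  congr 1
  · simp
  · ext
    have : σ ^ 2 ≠ 0 := by positivity
    simp [max_eq_left (sq_nonneg σ), inv_mul_cancel₀ this]

end Asymptotics

/-! ### Tail probabilities of the test statistic -/

section Tests

variable {ι Ω : Type*} [MeasurableSpace Ω] {Pr : Measure Ω} [IsProbabilityMeasure Pr]
  {l : Filter ι}

/-- The portmanteau theorem applies because the boundary point of the half-line is a Gaussian null
set. -/
lemma tendsto_measureReal_gt_of_tendstoInDistribution {T : ι → Ω → ℝ}
    (hT : TendstoInDistribution T l (fun x : ℝ => x) (fun _ => Pr) (gaussianReal 0 1))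
    {α τ : ℝ} (hτ : cdf (gaussianReal 0 1) τ = 1 - α) :
    Tendsto (fun k => Pr.real {ω | τ < T k ω}) l (𝓝 α) := by
  have : NullSingletonClass (gaussianReal 0 1) := nullSingletonClass_gaussianReal one_ne_zero
  have h0 : (gaussianReal 0 1) (frontier (Set.Ioi τ)) = 0 := by
    rw [frontier_Ioi]; exact measure_singleton τ
  have h1 := ProbabilityMeasure.tendsto_measure_of_null_frontier_of_tendsto' hT.tendsto
    (E := Set.Ioi τ) (by simpa only [ProbabilityMeasure.coe_mk, Measure.map_id'] using h0)
  simp only [ProbabilityMeasure.coe_mk, Measure.map_id'] at h1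
  have h2 : (gaussianReal 0 1).real (Set.Ioi τ) = α := by
    rw [cdf_eq_real] at hτ
    rw [← Set.compl_Iic, probReal_compl_eq_one_sub measurableSet_Iic, hτ]
    ring
  have h3 := (ENNReal.tendsto_toReal (measure_ne_top _ _)).comp h1
  rw [← h2]
  refine h3.congr fun k => ?_
  rw [Function.comp_apply, Measure.map_apply_of_aemeasurable (hT.forall_aemeasurable k)
    measurableSet_Ioi]
  rfl

variable {n : ι → ℕ} (hn : Tendsto n l atTop) {G : ι → Ω → ℝ} {c : ℝ}
  (hG : TendstoInMeasure Pr G l (fun _ => c))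

include hn hG

/-- Once √n·c/2 ≤ τ, the event forces `G` above c/2, a deviation from `c` of at least -c/2. -/
lemma tendsto_measureReal_gt_zero_of_neg (hc : c < 0) (τ : ℝ) :
    Tendsto (fun k => Pr.real {ω | τ < √(n k : ℝ) * G k ω}) l (𝓝 0) := by
  rw [tendstoInMeasure_iff_measureReal_norm] at hG
  have hs : Tendsto (fun k => √(n k : ℝ) * (-c / 2)) l atTop :=
    (Real.tendsto_sqrt_atTop.comp (tendsto_natCast_atTop_atTop.comp hn)).atTop_mul_const
      (by linarith)
  refine squeeze_zero' (Eventually.of_forall fun _ => measureReal_nonneg) ?_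
    (hG (-c / 2) (by linarith))
  filter_upwards [hs.eventually_ge_atTop (-τ)] with k hk
  refine measureReal_mono fun ω hω => ?_
  simp only [Set.mem_ofPred_eq, Real.norm_eq_abs] at hω ⊢
  by_contra! hcon
  have h1 := (abs_lt.1 hcon).2
  have : √(n k : ℝ) * G k ω ≤ √(n k : ℝ) * (c / 2) := by
    gcongr; linarith
  linarith

lemma tendsto_measureReal_gt_one_of_pos (hc : 0 < c) (τ : ℝ) :
    Tendsto (fun k => Pr.real {ω | τ < √(n k : ℝ) * G k ω}) l (𝓝 1) := by
  rw [tendstoInMeasure_iff_measureReal_norm] at hG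
  have hs : Tendsto (fun k => √(n k : ℝ) * (c / 2)) l atTop :=
    (Real.tendsto_sqrt_atTop.comp (tendsto_natCast_atTop_atTop.comp hn)).atTop_mul_const
      (by linarith)
  refine tendsto_of_tendsto_of_tendsto_of_le_of_le' (g := fun k =>
    1 - Pr.real {ω | c / 2 ≤ ‖G k ω - c‖}) (h := fun _ => 1)
    (by simpa using (hG (c / 2) (by linarith)).const_sub 1) tendsto_const_nhds ?_
    (Eventually.of_forall fun _ => measureReal_le_one)
  filter_upwards [hs.eventually_gt_atTop τ] with k hk
  have hcov : (Set.univ : Set Ω) ⊆ {ω | τ < √(n k : ℝ) * G k ω} ∪ {ω | c / 2 ≤ ‖G k ω - c‖} := by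
    intro ω _
    by_contra hcon
    simp only [Set.mem_union, Set.mem_ofPred_eq, Real.norm_eq_abs, not_or, not_le] at hcon
    have h1 := (abs_lt.1 hcon.2).1
    have : √(n k : ℝ) * (c / 2) ≤ √(n k : ℝ) * G k ω := by
      gcongr; linarith
    exact hcon.1 (by linarith)
  have h1 : (1 : ℝ) ≤ _ := (probReal_univ (μ := Pr)).symm.le.trans
    ((measureReal_mono hcov).trans (measureReal_union_le _ _))
  linarith

end Tests

section StudentizedTest

variable {ι Ω 𝒴 : Type*} [MeasurableSpace Ω] [MeasurableSpace 𝒴] {Pr : Measure Ω}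
  [IsProbabilityMeasure Pr] {l : Filter ι} [l.IsCountablyGenerated] {n : ι → ℕ}
  {γ : ι → Measure 𝒴} [∀ k, IsProbabilityMeasure (γ k)] {X : ι → ℕ → Ω → 𝒴} {h : 𝒴 → 𝒴 → ℝ}

/-- Limits of the rejection probabilities of the studentized test of `μ ≤ 0`. -/
theorem tendsto_rejection_probability (hn : Tendsto n l atTop)
    (hX : ∀ k i, HasLaw (X k i) (γ k) Pr)
    (hind : ∀ k, iIndepFun (X k) Pr) (hm : Measurable (Function.uncurry h)) {M : ℝ}
    (hM : ∀ᶠ k in l, MemLp (Function.uncurry h) 4 ((γ k).prod (γ k)) ∧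
      ∫ z, Function.uncurry h z ^ 4 ∂((γ k).prod (γ k)) ≤ M)
    (hs : ∀ a b, h a b = h b a) {N : ℝ}
    (hN : ∀ᶠ k in l, MemLp (fun y => h y y) 2 (γ k) ∧ ∫ y, h y y ^ 2 ∂(γ k) ≤ N)
    {σ : ℝ} (hσ : 0 < σ) (hv : Tendsto (fun k => projVar h (γ k)) l (𝓝 (σ ^ 2))) {μ : ℝ}
    (hμ : Tendsto (fun k => √(n k : ℝ) * (kerMean h (γ k) - μ)) l (𝓝 0))
    {α τ : ℝ} (hα : 0 < α) (hτ : cdf (gaussianReal 0 1) τ = 1 - α) :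
    (μ ≤ 0 → ∃ ℓ ≤ α, Tendsto (fun k => Pr.real {ω | τ < √(n k : ℝ) *
      uStat h (n k) (fun i => X k i ω) / sigmaEst h (n k) (fun i => X k i ω)}) l (𝓝 ℓ)) ∧
    (0 < μ → Tendsto (fun k => Pr.real {ω | τ < √(n k : ℝ) *
      uStat h (n k) (fun i => X k i ω) / sigmaEst h (n k) (fun i => X k i ω)}) l (𝓝 1)) := by
  have hroot : Tendsto (fun k => √(n k : ℝ)) l atTop :=
    Real.tendsto_sqrt_atTop.comp (tendsto_natCast_atTop_atTop.comp hn)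
  -- Dividing the bias condition by √n gives convergence of the means themselves.
  have hθ : Tendsto (fun k => kerMean h (γ k)) l (𝓝 μ) := by
    have h1 := ((tendsto_inv_atTop_zero.comp hroot).mul hμ).add_const μ
    simp only [mul_zero, zero_add] at h1
    refine h1.congr' ?_
    filter_upwards [hroot.eventually_gt_atTop 0] with k hk
    simp only [Function.comp_apply]
    field_simp
    ring
  have hG : TendstoInMeasure Pr (fun k ω => uStat h (n k) (fun i => X k i ω) /
      sigmaEst h (n k) (fun i => X k i ω)) l (fun _ => μ / σ) := by
    have h1 := tendstoInMeasure_const_comp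
      (φ := fun p : (ℝ × ℝ) × ℝ => (p.1.1 + p.1.2) / p.2)
      (tendstoInMeasure_const_prodMk (tendstoInMeasure_const_prodMk
        (tendstoInMeasure_uStat hn hX hind hm hM hs)
        (tendstoInMeasure_of_tendsto_const (Pr := Pr) hθ))
        (tendstoInMeasure_sigmaEst hn hX hind hm hM hs hN hσ hv))
      (by
        refine ContinuousAt.div (by fun_prop) (by fun_prop) hσ.ne')
    simpa using h1
  simp_rw [mul_div_assoc]
  refine ⟨fun h0 => ?_, fun h0 => ?_⟩
  -- Inside the hypothesis the ratio has a negative limit and √n drives the probability to 0; only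
  -- at `μ = 0` is the normal limit needed, and it gives exactly `α`.
  · rcases h0.lt_or_eq with h0 | h0
    · exact ⟨0, hα.le, tendsto_measureReal_gt_zero_of_neg hn hG (div_neg_of_neg_of_pos h0 hσ) τ⟩
    · subst h0
      refine ⟨α, le_rfl, ?_⟩
      have := tendsto_measureReal_gt_of_tendstoInDistribution
        (tendstoInDistribution_studentized hn hX hind hm hM hs hN hσ hv hμ) hτ
      simpa only [sub_zero, mul_div_assoc] using this
  · exact tendsto_measureReal_gt_one_of_pos hn hG (div_pos h0 hσ) τ

end StudentizedTest

open scoped RealInnerProductSpace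

/-! ### Derivatives of the feature map of a reproducing kernel Hilbert space -/

section HilbertCurves

variable {H : Type*} [NormedAddCommGroup H] [InnerProductSpace ℝ H]

/-- The squared distance of two values of `F` is a combination of three values of the Gram kernel.
-/
lemma continuous_of_continuous_inner {T : Type*} [TopologicalSpace T] {F : T → H}
    (hF : Continuous fun a : T × T => ⟪F a.1, F a.2⟫) : Continuous F := by
  rw [continuous_iff_continuousAt]
  intro x
  rw [ContinuousAt, tendsto_iff_norm_sub_tendsto_zero]
  have h1 : Continuous fun a : T => ⟪F a, F a⟫ - 2 * ⟪F a, F x⟫ + ⟪F x, F x⟫ :=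
    ((hF.comp (continuous_id.prodMk continuous_id)).sub
      ((hF.comp (continuous_id.prodMk continuous_const)).const_mul 2)).add continuous_const
  have h2 := (Real.continuous_sqrt.comp h1).tendsto x
  have h3 : √(⟪F x, F x⟫ - 2 * ⟪F x, F x⟫ + ⟪F x, F x⟫) = 0 := by
    rw [show ⟪F x, F x⟫ - 2 * ⟪F x, F x⟫ + ⟪F x, F x⟫ = 0 by ring, Real.sqrt_zero]
  rw [Function.comp_apply, h3] at h2
  refine h2.congr fun a => ?_
  rw [Function.comp_apply, real_inner_self_eq_norm_sq, real_inner_self_eq_norm_sq,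
    ← norm_sub_sq_real, Real.sqrt_sq (norm_nonneg _)]

/-- The squared distance of two values of `q` tends to m - 2m + m = 0, so completeness yields a
limit without naming it in advance. -/
lemma exists_tendsto_of_tendsto_inner [CompleteSpace H] {β : Type*} {F : Filter β} [F.NeBot]
    {q : β → H} {m : ℝ} (h : Tendsto (fun p : β × β => ⟪q p.1, q p.2⟫) (F ×ˢ F) (𝓝 m)) :
    ∃ v, Tendsto q F (𝓝 v) := by
  rw [← cauchy_map_iff_exists_tendsto, cauchy_map_iff]
  refine ⟨inferInstance, ?_⟩
  have h11 : Tendsto (fun p : β × β => ⟪q p.1, q p.1⟫) (F ×ˢ F) (𝓝 m) :=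
    h.comp (tendsto_fst.prodMk tendsto_fst)
  have h22 : Tendsto (fun p : β × β => ⟪q p.2, q p.2⟫) (F ×ˢ F) (𝓝 m) :=
    h.comp (tendsto_snd.prodMk tendsto_snd)
  have h3 := (Real.continuous_sqrt.tendsto _).comp ((h11.sub (h.const_mul 2)).add h22)
  rw [show m - 2 * m + m = 0 by ring, Real.sqrt_zero] at h3
  rw [tendsto_uniformity_iff_dist_tendsto_zero]
  refine h3.congr fun p => ?_
  rw [Function.comp_apply, real_inner_self_eq_norm_sq, real_inner_self_eq_norm_sq,
    ← norm_sub_sq_real, Real.sqrt_sq (norm_nonneg _), dist_eq_norm]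

lemma exists_mul_eq_sub_of_hasDerivAt {f f' : ℝ → ℝ} {ε : ℝ}
    (hf : ∀ t, |t| < ε → HasDerivAt f (f' t) t) {s : ℝ} (hs : |s| < ε) :
    ∃ c, |c| ≤ |s| ∧ f s - f 0 = s * f' c := by
  rcases lt_trichotomy s 0 with h | h | h
  · have hm : ∀ t ∈ Set.Icc s 0, |t| < ε := fun t ht => by
      rw [abs_of_nonpos ht.2]; rw [abs_of_neg h] at hs; linarith [ht.1]
    obtain ⟨c, hc, he⟩ := exists_hasDerivAt_eq_slope f f' h
      (fun t ht => (hf t (hm t ht)).continuousAt.continuousWithinAt)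
      (fun t ht => hf t (hm t (Set.Ioo_subset_Icc_self ht)))
    refine ⟨c, ?_, ?_⟩
    · rw [abs_of_neg hc.2, abs_of_neg h]; linarith [hc.1]
    · rw [he]; field_simp; ring
  · exact ⟨0, by simp, by simp [h]⟩
  · have hm : ∀ t ∈ Set.Icc 0 s, |t| < ε := fun t ht => by
      rw [abs_of_nonneg ht.1]; rw [abs_of_pos h] at hs; linarith [ht.2]
    obtain ⟨c, hc, he⟩ := exists_hasDerivAt_eq_slope f f' h
      (fun t ht => (hf t (hm t ht)).continuousAt.continuousWithinAt)
      (fun t ht => hf t (hm t (Set.Ioo_subset_Icc_self ht)))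
    refine ⟨c, ?_, ?_⟩
    · rw [abs_of_pos hc.1, abs_of_pos h]; exact hc.2.le
    · rw [he]; field_simp; ring

/-- The mean value theorem is applied in the first variable to the difference of two sections, then
in the second variable to `k₁`. -/
lemma exists_second_difference_eq {k k₁ k₁₂ : ℝ → ℝ → ℝ} {ε : ℝ}
    (h₁ : ∀ a b, |a| < ε → |b| < ε → HasDerivAt (fun a => k a b) (k₁ a b) a)
    (h₁₂ : ∀ a b, |a| < ε → |b| < ε → HasDerivAt (fun b => k₁ a b) (k₁₂ a b) b)
    {s t : ℝ} (hs : |s| < ε) (ht : |t| < ε) :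
    ∃ a b, |a| ≤ |s| ∧ |b| ≤ |t| ∧ k s t - k s 0 - k 0 t + k 0 0 = s * t * k₁₂ a b := by
  have h0 : |(0 : ℝ)| < ε := by rw [abs_zero]; exact (abs_nonneg s).trans_lt hs
  obtain ⟨a, ha, hea⟩ := exists_mul_eq_sub_of_hasDerivAt (f := fun a => k a t - k a 0)
    (fun a ha => (h₁ a t ha ht).sub (h₁ a 0 ha h0)) hs
  obtain ⟨b, hb, heb⟩ := exists_mul_eq_sub_of_hasDerivAt
    (fun b hb => h₁₂ a b (ha.trans_lt hs) hb) ht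
  refine ⟨a, b, ha, hb, ?_⟩
  rw [heb] at hea
  linarith

/-- A curve in a Hilbert space is differentiable if its Gram kernel has a continuous mixed
derivative. -/
lemma exists_hasDerivAt_of_inner [CompleteSpace H] {c : ℝ → H} {k₁ k₁₂ : ℝ → ℝ → ℝ} {ε : ℝ}
    (hε : 0 < ε)
    (h₁ : ∀ a b, |a| < ε → |b| < ε → HasDerivAt (fun a => ⟪c a, c b⟫) (k₁ a b) a)
    (h₁₂ : ∀ a b, |a| < ε → |b| < ε → HasDerivAt (fun b => k₁ a b) (k₁₂ a b) b)
    (hc : ContinuousAt (fun p : ℝ × ℝ => k₁₂ p.1 p.2) (0, 0)) :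
    ∃ v, HasDerivAt c v 0 := by
  -- Inner products of difference quotients are second differences of the Gram kernel divided by st,
  -- that is, values of `k₁₂` near the origin; their convergence makes the quotients Cauchy.
  suffices h : Tendsto (fun p : ℝ × ℝ => ⟪p.1⁻¹ • (c (0 + p.1) - c 0),
      p.2⁻¹ • (c (0 + p.2) - c 0)⟫) (𝓝[≠] 0 ×ˢ 𝓝[≠] 0) (𝓝 (k₁₂ 0 0)) by
    obtain ⟨v, hv⟩ := exists_tendsto_of_tendsto_inner (F := 𝓝[≠] (0 : ℝ))
      (q := fun s => s⁻¹ • (c (0 + s) - c 0)) h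
    exact ⟨v, hasDerivAt_iff_tendsto_slope_zero.2 hv⟩
  rw [Metric.tendsto_nhds]
  intro δ hδ
  obtain ⟨r, hr, hcr⟩ := Metric.continuousAt_iff.1 hc δ hδ
  have hev : ∀ᶠ s : ℝ in 𝓝[≠] 0, s ≠ 0 ∧ |s| < min ε r := by
    refine (eventually_mem_nhdsWithin (a := (0 : ℝ)) (s := {0}ᶜ)).and (nhdsWithin_le_nhds ?_)
    have := Metric.ball_mem_nhds (0 : ℝ) (lt_min hε hr)
    filter_upwards [this] with s hs
    simpa [Real.norm_eq_abs] using hs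
  filter_upwards [hev.prod_mk hev] with p hp
  obtain ⟨⟨hs0, hs⟩, ht0, ht⟩ := hp
  obtain ⟨a, b, ha, hb, he⟩ := exists_second_difference_eq (k := fun a b => ⟪c a, c b⟫) h₁ h₁₂
    (hs.trans_le (min_le_left _ _)) (ht.trans_le (min_le_left _ _))
  have hval : ⟪p.1⁻¹ • (c (0 + p.1) - c 0), p.2⁻¹ • (c (0 + p.2) - c 0)⟫ = k₁₂ a b := by
    rw [inner_smul_left, inner_smul_right, zero_add, zero_add, inner_sub_left, inner_sub_right,
      inner_sub_right]
    simp only [conj_trivial]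
    have h1 : p.1 ≠ 0 := hs0
    have h2 : p.2 ≠ 0 := ht0
    field_simp
    linarith
  rw [hval]
  refine hcr (x := (a, b)) ?_
  rw [Prod.dist_eq, Real.dist_eq, Real.dist_eq, sub_zero, sub_zero]
  exact max_lt (ha.trans_lt (hs.trans_le (min_le_right _ _)))
    (hb.trans_lt (ht.trans_le (min_le_right _ _)))

end HilbertCurves

section Euclidean

variable {D : ℕ} {X : TopologicalSpace.Opens (EuclideanSpace ℝ (Fin D))}

lemma extend_val_apply {V : Type*} [Zero V] (f : X → V) (x : X) :
    Function.extend (Subtype.val : X → EuclideanSpace ℝ (Fin D)) f 0 x.1 = f x :=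
  Subtype.val_injective.extend_apply f 0 x

lemma HasPartialDeriv.hasDerivAt {d : Fin D} {f : X → ℝ} {x : EuclideanSpace ℝ (Fin D)} {a : ℝ}
    {y : X} (hy : y.1 = x + a • EuclideanSpace.single d (1 : ℝ)) (h : HasPartialDeriv d f y) :
    HasDerivAt (fun s : ℝ => Function.extend (Subtype.val : X → EuclideanSpace ℝ (Fin D)) f 0
      (x + s • EuclideanSpace.single d (1 : ℝ))) (partialDeriv d f y) a := by
  have h1 : HasDerivAt (fun t : ℝ => Function.extend (Subtype.val : X → EuclideanSpace ℝ (Fin D))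
      f 0 (y.1 + t • EuclideanSpace.single d (1 : ℝ))) (partialDeriv d f y) (a - a) := by
    rw [sub_self]
    exact LineDifferentiableAt.hasLineDerivAt h
  have h2 := h1.comp_sub_const a a
  refine h2.congr_of_eventuallyEq (Eventually.of_forall fun s => ?_)
  simp only [hy]
  congr 1
  module

variable {H : Type*} [NormedAddCommGroup H] [InnerProductSpace ℝ H] [CompleteSpace H]

/-- The feature map of a `C^(1,1)` kernel has partial derivatives. -/
lemma exists_hasLineDerivAt_feature {K : X → X → ℝ} {Φ : X → H} (hΦ : ∀ x y, ⟪Φ x, Φ y⟫ = K x y)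
    {d : Fin D} (h₁ : ∀ x y : X, HasPartialDeriv d (fun x' : X => K x' y) x)
    (h₁₂ : ∀ x y : X, HasPartialDeriv d (fun y' : X => partialDeriv d (fun x' : X => K x' y') x) y)
    (hc : Continuous (fun a : X × X =>
      partialDeriv d (fun y' : X => partialDeriv d (fun x' : X => K x' y') a.1) a.2)) (x : X) :
    ∃ v, HasLineDerivAt ℝ (Function.extend (Subtype.val : X → EuclideanSpace ℝ (Fin D)) Φ 0) v
      x.1 (EuclideanSpace.single d (1 : ℝ)) := by
  classical
  set e : EuclideanSpace ℝ (Fin D) := EuclideanSpace.single d (1 : ℝ) with he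
  have hline : Continuous fun s : ℝ => x.1 + s • e := by fun_prop
  have hmem : ∀ᶠ s : ℝ in 𝓝 0, x.1 + s • e ∈ X := by
    refine hline.continuousAt.eventually (X.isOpen.mem_nhds ?_)
    simp
  obtain ⟨ε, hε, hball⟩ := Metric.eventually_nhds_iff.1 hmem
  have hball' : ∀ s : ℝ, |s| < ε → x.1 + s • e ∈ X := fun s hs => hball (by simpa using hs)
  let pt : ℝ → X := fun s => if h : x.1 + s • e ∈ X then ⟨_, h⟩ else x
  have hpt : ∀ s, |s| < ε → (pt s).1 = x.1 + s • e := fun s hs => by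
    simp only [pt, dif_pos (hball' s hs)]
  have hext : ∀ (f : X → ℝ) (s : ℝ), |s| < ε →
      Function.extend (Subtype.val : X → EuclideanSpace ℝ (Fin D)) f 0 (x.1 + s • e)
        = f (pt s) := fun f s hs => by rw [← hpt s hs, extend_val_apply]
  have hnhds : ∀ a : ℝ, |a| < ε → ∀ᶠ s in 𝓝 a, |s| < ε := fun a ha =>
    continuous_abs.continuousAt.eventually (gt_mem_nhds ha)
  have h0 : |(0 : ℝ)| < ε := by simpa using hε
  have hpt0 : pt 0 = x := Subtype.ext (by rw [hpt 0 h0]; simp)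
  have hptc : ContinuousAt pt 0 := by
    rw [ContinuousAt, tendsto_subtype_rng, hpt0]
    have := hline.tendsto 0
    rw [zero_smul, add_zero] at this
    refine this.congr' ?_
    filter_upwards [hnhds 0 h0] with s hs using (hpt s hs).symm
  suffices hex : ∃ v, HasDerivAt (fun s => Φ (pt s)) v 0 by
    obtain ⟨v, hv⟩ := hex
    refine ⟨v, hv.congr_of_eventuallyEq ?_⟩
    filter_upwards [hnhds 0 h0] with s hs
    rw [← hpt s hs, extend_val_apply]
  refine exists_hasDerivAt_of_inner (H := H) (c := fun s => Φ (pt s))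
    (k₁ := fun a b => partialDeriv d (fun x' : X => K x' (pt b)) (pt a))
    (k₁₂ := fun a b => partialDeriv d (fun y' : X =>
      partialDeriv d (fun x' : X => K x' y') (pt a)) (pt b)) hε ?_ ?_ ?_
  · intro a b ha hb
    refine (HasPartialDeriv.hasDerivAt (hpt a ha) (h₁ (pt a) (pt b))).congr_of_eventuallyEq ?_
    filter_upwards [hnhds a ha] with s hs
    exact (hΦ _ _).trans (hext (fun x' => K x' (pt b)) s hs).symm
  · intro a b ha hb
    refine (HasPartialDeriv.hasDerivAt (hpt b hb) (h₁₂ (pt a) (pt b))).congr_of_eventuallyEq ?_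
    filter_upwards [hnhds b hb] with s hs
    exact (hext (fun y' : X => partialDeriv d (fun x' : X => K x' y') (pt a)) s hs).symm
  · have h3 : ContinuousAt (fun p : ℝ × ℝ => (pt p.1, pt p.2)) (0, 0) :=
      (hptc.comp_of_eq continuousAt_fst rfl).prodMk (hptc.comp_of_eq continuousAt_snd rfl)
    exact ContinuousAt.comp (f := fun p : ℝ × ℝ => (pt p.1, pt p.2)) hc.continuousAt h3

variable [RKHS ℝ H X ℝ]

/-- The reproducing property survives extension by zero, so a derivative of the feature map
transfers to `f` through a bounded linear functional. -/
lemma extend_eq_inner (f : H) : Function.extend (Subtype.val : X → EuclideanSpace ℝ (Fin D))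
    (f : X → ℝ) 0 = fun z => ⟪f, Function.extend (Subtype.val : X → EuclideanSpace ℝ (Fin D))
      (fun x => RKHS.kerFun H x (1 : ℝ)) 0 z⟫ := by
  classical
  ext z
  by_cases hz : z ∈ X
  · rw [show z = (⟨z, hz⟩ : X).1 from rfl, extend_val_apply, extend_val_apply, RKHS.inner_kerFun]
    simp
  · have h1 : ¬ ∃ a : X, a.1 = z := fun ⟨a, ha⟩ => hz (ha ▸ a.2)
    rw [Function.extend_apply' _ _ _ h1, Function.extend_apply' _ _ _ h1]
    simp

variable (H) in
/-- Functions in the reproducing kernel Hilbert space of a `C^(1,1)` kernel have partial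
derivatives, which are represented by continuous feature maps. -/
lemma exists_continuous_partialDeriv_feature
    (hk : (DataSpace.euclidean X).RegularKernel ((DataSpace.euclidean X).ker H)) :
    Continuous (fun x : X => RKHS.kerFun H x (1 : ℝ)) ∧
    ∃ Ψ : Fin D → X → H, (∀ d, Continuous (Ψ d)) ∧ ∀ (d : Fin D) (f : H) (x : X),
      HasPartialDeriv d (f : X → ℝ) x ∧ partialDeriv d (f : X → ℝ) x = ⟪Ψ d x, f⟫ := by
  obtain ⟨k0, k1, k2, k3, k4⟩ := hk
  set K : X → X → ℝ := (DataSpace.euclidean X).ker H with hK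
  have hΦ : ∀ x y : X, ⟪RKHS.kerFun H x (1 : ℝ), RKHS.kerFun H y (1 : ℝ)⟫ = K x y := by
    intro x y
    rw [RKHS.kerFun_inner, RKHS.kerFun_apply]
    simp [hK, DataSpace.ker]
    rfl
  refine ⟨continuous_of_continuous_inner (by simpa only [hΦ] using k0), ?_⟩
  choose Ψ hΨ using fun (d : Fin D) (x : X) =>
    exists_hasLineDerivAt_feature hΦ (k1 d) (k3 d d) (k4 d d) x
  have hd : ∀ (d : Fin D) (f : H) (x : X), HasLineDerivAt ℝ
      (Function.extend (Subtype.val : X → EuclideanSpace ℝ (Fin D)) (f : X → ℝ) 0) ⟪Ψ d x, f⟫ x.1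
      (EuclideanSpace.single d (1 : ℝ)) := by
    intro d f x
    rw [extend_eq_inner, real_inner_comm]
    exact (innerSL ℝ f).hasFDerivAt.comp_hasDerivAt (0 : ℝ) (hΨ d x)
  have hp : ∀ (d : Fin D) (f : H) (x : X), partialDeriv d (f : X → ℝ) x = ⟪Ψ d x, f⟫ :=
    fun d f x => (hd d f x).lineDeriv
  refine ⟨Ψ, fun d => continuous_of_continuous_inner ?_, fun d f x =>
    ⟨(hd d f x).lineDifferentiableAt, hp d f x⟩⟩
  have hsec : ∀ y : X, (fun x' : X => K x' y) = (RKHS.kerFun H y (1 : ℝ) : H) := fun y => by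
    ext x'
    rw [RKHS.kerFun_apply]
    simp [hK, DataSpace.ker]
    rfl
  -- The Gram kernel of `Ψ d` is the mixed derivative of the kernel, whose continuity gives that of
  -- `Ψ d`.
  refine (k4 d d).congr fun a => ?_
  have hinner : (fun y' : X => partialDeriv d (fun x' : X => K x' y') a.1) = (Ψ d a.1 : H) := by
    ext y'
    rw [hsec, hp, RKHS.inner_kerFun]
    simp
  rw [hinner, hp, real_inner_comm]

end Euclidean

/-! ### Difference operators on the two kinds of data spaces -/

section EuclideanDerivative

variable {D : ℕ} {X : TopologicalSpace.Opens (EuclideanSpace ℝ (Fin D))}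

lemma IsDifferentiable.hasPartialDeriv {f : X → ℝ} (hf : IsDifferentiable f) (d : Fin D) (x : X) :
    HasPartialDeriv d f x :=
  (hf x).lineDifferentiableAt

lemma partialDeriv_mul {d : Fin D} {f g : X → ℝ} {x : X} (hf : HasPartialDeriv d f x)
    (hg : HasPartialDeriv d g x) :
    partialDeriv d (fun x => f x * g x) x = partialDeriv d f x * g x + f x * partialDeriv d g x := by
  have h1 : HasDerivAt _ _ (0 : ℝ) := LineDifferentiableAt.hasLineDerivAt hf
  have h2 : HasDerivAt _ _ (0 : ℝ) := LineDifferentiableAt.hasLineDerivAt hg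
  have h3 := h1.mul h2
  simp only [zero_smul, add_zero, extend_val_apply] at h3
  refine HasLineDerivAt.lineDeriv (h3.congr_of_eventuallyEq (Eventually.of_forall fun t => ?_))
  simp only [Pi.mul_apply]
  by_cases hz : x.1 + t • EuclideanSpace.single d (1 : ℝ) ∈ X
  · have he : x.1 + t • EuclideanSpace.single d (1 : ℝ) = (⟨_, hz⟩ : X).1 := rfl
    rw [he, extend_val_apply, extend_val_apply, extend_val_apply]
  · have h4 : ¬ ∃ a : X, a.1 = x.1 + t • EuclideanSpace.single d (1 : ℝ) :=
      fun ⟨a, ha⟩ => hz (ha ▸ a.2)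
    rw [Function.extend_apply' _ _ _ h4, Function.extend_apply' _ _ _ h4,
      Function.extend_apply' _ _ _ h4]
    simp

/-- The derivative is the pointwise limit of difference quotients with step 1/(n + 1). They are
jointly measurable because zero extension along a measurable embedding is. -/
lemma measurable_partialDeriv {Z : Type*} [MeasurableSpace Z] {f : Z → X → ℝ}
    (hf : Measurable (Function.uncurry f)) {d : Fin D}
    (hd : ∀ z x, HasPartialDeriv d (f z) x) :
    Measurable fun a : X × Z => partialDeriv d (f a.2) a.1 := by
  have hval : MeasurableEmbedding (Subtype.val : X → EuclideanSpace ℝ (Fin D)) :=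
    MeasurableEmbedding.subtype_coe X.isOpen.measurableSet
  have hemb : MeasurableEmbedding (Prod.map id Subtype.val :
      Z × X → Z × EuclideanSpace ℝ (Fin D)) := MeasurableEmbedding.id.prodMap hval
  have hext := hemb.measurable_extend hf (measurable_const (a := (0 : ℝ)))
  have heq : ∀ z y, Function.extend (Subtype.val : X → EuclideanSpace ℝ (Fin D)) (f z) 0 y
      = Function.extend (Prod.map id Subtype.val : Z × X → Z × EuclideanSpace ℝ (Fin D))
        (Function.uncurry f) (fun _ => 0) (z, y) := by
    intro z y
    by_cases hy : y ∈ X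
    · rw [show y = (⟨y, hy⟩ : X).1 from rfl, extend_val_apply]
      exact (hemb.injective.extend_apply (Function.uncurry f) (fun _ => 0) (z, ⟨y, hy⟩)).symm
    · rw [Function.extend_apply' _ _ _ fun ⟨a, ha⟩ => hy (ha ▸ a.2),
        Function.extend_apply' _ _ _ fun ⟨a, ha⟩ => hy <| by
          have h : a.2.1 = y := (Prod.ext_iff.1 ha).2
          exact h ▸ a.2.2]
      rfl
  have hseq : Tendsto (fun n : ℕ => ((n : ℝ) + 1)⁻¹) atTop (𝓝[≠] 0) := by
    refine tendsto_nhdsWithin_iff.2 ⟨?_, Eventually.of_forall fun n => ?_⟩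
    · simpa [one_div] using tendsto_one_div_add_atTop_nhds_zero_nat (𝕜 := ℝ)
    · have : ((n : ℝ) + 1) ≠ 0 := by positivity
      simpa using this
  refine measurable_of_tendsto_metrizable (f := fun (n : ℕ) (a : X × Z) =>
    ((n : ℝ) + 1)⁻¹⁻¹ • (Function.extend (Subtype.val : X → EuclideanSpace ℝ (Fin D)) (f a.2) 0
      (a.1.1 + ((n : ℝ) + 1)⁻¹ • EuclideanSpace.single d (1 : ℝ))
      - Function.extend (Subtype.val : X → EuclideanSpace ℝ (Fin D)) (f a.2) 0 a.1.1))
    (fun n => ?_) ?_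
  · simp only [heq]
    have m1 : Measurable fun a : X × Z => (a.2, a.1.1) :=
      measurable_snd.prodMk (measurable_subtype_coe.comp measurable_fst)
    have m2 : Measurable fun a : X × Z =>
        (a.2, a.1.1 + ((n : ℝ) + 1)⁻¹ • EuclideanSpace.single d (1 : ℝ)) :=
      measurable_snd.prodMk ((measurable_subtype_coe.comp measurable_fst).add_const _)
    exact ((hext.comp m2).sub (hext.comp m1)).const_mul _
  · rw [tendsto_pi_nhds]
    intro a
    exact (hasLineDerivAt_iff_tendsto_slope_zero.1
      (LineDifferentiableAt.hasLineDerivAt (hd a.2 a.1))).comp hseq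

end EuclideanDerivative

/-! ### Shifts on the cyclic lattice -/

section CyclicShift

variable {D L : ℕ}

lemma cyclicShift_cyclicShift (hL : 1 < L) {s t : ℕ} (hst : s + t = L) (d : Fin D)
    (x : Fin D → Fin L) : cyclicShift hL t d (cyclicShift hL s d x) = x := by
  unfold cyclicShift
  rw [Function.update_idem, Function.update_eq_self_iff]
  apply Fin.ext
  simp only [Function.update_self]
  have := (x d).2
  rw [Nat.mod_add_mod, add_assoc, hst, Nat.add_mod_right, Nat.mod_eq_of_lt this]

/-- The backward shift is a bijection with the forward shift as inverse; this is summation by parts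
without boundary terms. -/
lemma sum_cyclicShift (hL : 1 < L) (d : Fin D) (f : (Fin D → Fin L) → ℝ) :
    ∑ x, f (cyclicShift hL (L - 1) d x) = ∑ x, f x :=
  Equiv.sum_comp (⟨cyclicShift hL (L - 1) d, cyclicShift hL 1 d,
    cyclicShift_cyclicShift hL (by omega) d, cyclicShift_cyclicShift hL (by omega) d⟩ :
    (Fin D → Fin L) ≃ (Fin D → Fin L)) f

end CyclicShift

/-! ### Posteriors and scores of latent variable models -/

namespace LatentModel

variable {D : ℕ} {S : DataSpace D} {Z : Type*} [MeasurableSpace Z] (M : LatentModel S Z)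

lemma marginal_pos (x : S.Point) : 0 < M.marginal x := by
  refine (integral_pos_iff_support_of_nonneg (fun z => (M.lik_pos z x).le)
    (M.integrable_lik x)).2 ?_
  have : Function.support (fun z => M.lik z x) = Set.univ := by
    ext z; simpa using (M.lik_pos z x).ne'
  rw [this, measure_univ]
  exact one_pos

lemma measurable_marginal : Measurable M.marginal :=
  M.measurable_lik.stronglyMeasurable.integral_prod_left.measurable

lemma measurable_posterior_density : Measurable (Function.uncurry fun x z =>
    ENNReal.ofReal (M.lik z x / M.marginal x)) :=
  ((M.measurable_lik.comp measurable_swap).div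
    (M.measurable_marginal.comp measurable_fst)).ennreal_ofReal

lemma posterior_apply (x : S.Point) : M.posterior x =
    M.prior.withDensity fun z => ENNReal.ofReal (M.lik z x / M.marginal x) := by
  rw [posterior, Kernel.withDensity_apply _ M.measurable_posterior_density, Kernel.const_apply]

instance : IsMarkovKernel M.posterior where
  isProbabilityMeasure x := by
    constructor
    rw [posterior_apply, withDensity_apply _ MeasurableSet.univ, Measure.restrict_univ,
      ← ofReal_integral_eq_lintegral_ofReal ((M.integrable_lik x).div_const _)
      (ae_of_all _ fun z => (div_pos (M.lik_pos z x) (M.marginal_pos x)).le), integral_div]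
    rw [show ∫ z, M.lik z x ∂M.prior = M.marginal x from rfl, div_self (M.marginal_pos x).ne',
      ENNReal.ofReal_one]

lemma integrable_posterior {f : Z → ℝ} {x : S.Point}
    (hf : Integrable (fun z => M.lik z x * f z) M.prior) : Integrable f (M.posterior x) := by
  have hm : Measurable fun z => ENNReal.ofReal (M.lik z x / M.marginal x) :=
    M.measurable_posterior_density.comp (measurable_const.prodMk measurable_id)
  rw [posterior_apply, integrable_withDensity_iff_integrable_smul' hm
    (ae_of_all _ fun _ => ENNReal.ofReal_lt_top)]
  refine (hf.const_mul (M.marginal x)⁻¹).congr (ae_of_all _ fun z => ?_)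
  simp only
  rw [ENNReal.toReal_ofReal (div_pos (M.lik_pos z x) (M.marginal_pos x)).le, smul_eq_mul]
  ring

lemma integral_posterior (f : Z → ℝ) (x : S.Point) :
    ∫ z, f z ∂(M.posterior x) = (M.marginal x)⁻¹ * ∫ z, M.lik z x * f z ∂M.prior := by
  have hm : Measurable fun z => ENNReal.ofReal (M.lik z x / M.marginal x) :=
    M.measurable_posterior_density.comp (measurable_const.prodMk measurable_id)
  rw [posterior_apply, integral_withDensity_eq_integral_toReal_smul hm
    (ae_of_all _ fun _ => ENNReal.ofReal_lt_top), ← integral_const_mul]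
  congr 1
  ext z
  rw [ENNReal.toReal_ofReal (div_pos (M.lik_pos z x) (M.marginal_pos x)).le, smul_eq_mul]
  ring

variable {M}

lemma measurable_fwd (hM : M.Regular) (d : Fin D) :
    Measurable fun a : S.Point × Z => S.fwd d (M.lik a.2) a.1 := by
  cases S with
  | euclidean X =>
    exact measurable_partialDeriv (X := X) (f := M.lik) M.measurable_lik
      fun z x => (hM.1 z).hasPartialDeriv d x
  | lattice L hL =>
    have hsh : Measurable (cyclicShift (D := D) hL 1 d) := measurable_of_countable _
    have h1 : Measurable fun a : (Fin D → Fin L) × Z => M.lik a.2 (cyclicShift hL 1 d a.1) :=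
      M.measurable_lik.comp (measurable_snd.prodMk (hsh.comp measurable_fst))
    have h2 : Measurable fun a : (Fin D → Fin L) × Z => M.lik a.2 a.1 :=
      M.measurable_lik.comp measurable_swap
    exact h1.sub h2

lemma measurable_score_lik (hM : M.Regular) (d : Fin D) :
    Measurable fun a : S.Point × Z => S.score (M.lik a.2) a.1 d :=
  (M.measurable_lik.comp measurable_swap).inv.mul (measurable_fwd hM d)

lemma measurable_score_marginal (hM : M.Regular) (d : Fin D) :
    Measurable fun x : S.Point => S.score M.marginal x d := by
  refine M.measurable_marginal.inv.mul ?_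
  cases S with
  | euclidean X =>
    have h1 := measurable_partialDeriv (X := X) (Z := Unit) (f := fun _ => M.marginal)
      (M.measurable_marginal.comp measurable_snd) (d := d)
      fun _ x => hM.2.1.hasPartialDeriv d x
    exact h1.comp (measurable_id.prodMk (measurable_const (a := ())))
  | lattice L hL => exact measurable_of_countable (α := Fin D → Fin L) _

lemma integrable_fwd (hM : M.Regular) (d : Fin D) (x : S.Point) :
    Integrable (fun z => S.fwd d (M.lik z) x) M.prior ∧
      S.fwd d M.marginal x = ∫ z, S.fwd d (M.lik z) x ∂M.prior := by
  cases S with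
  | euclidean X => exact hM.2.2 x d
  | lattice L hL =>
    have h1 := M.integrable_lik (cyclicShift hL 1 d x)
    have h2 := M.integrable_lik x
    exact ⟨h1.sub h2, (integral_sub h1 h2).symm⟩

/-- The score of the marginal density is the posterior mean of the conditional scores. -/
lemma integral_score_posterior (hM : M.Regular) (x : S.Point) (d : Fin D) :
    Integrable (fun z => S.score (M.lik z) x d) (M.posterior x) ∧
      ∫ z, S.score (M.lik z) x d ∂(M.posterior x) = S.score M.marginal x d := by
  -- The posterior weight cancels the denominator of the conditional score, leaving an integral of
  -- the differentiated likelihood.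
  have h1 : ∀ z, M.lik z x * S.score (M.lik z) x d = S.fwd d (M.lik z) x := fun z => by
    rw [DataSpace.score, mul_inv_cancel_left₀ (M.lik_pos z x).ne']
  constructor
  · refine M.integrable_posterior ?_
    simpa only [h1] using (integrable_fwd hM d x).1
  · rw [integral_posterior]
    simp_rw [h1]
    rw [← (integrable_fwd hM d x).2]
    rfl

end LatentModel

/-! ### Representing vectors for ∇* and the Stein identity -/

namespace DataSpace

variable {D : ℕ} (S : DataSpace D) (H : Type*) [NormedAddCommGroup H] [InnerProductSpace ℝ H]
  [CompleteSpace H] [RKHS ℝ H S.Point ℝ]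

lemma inner_kerFun_one_left {X H : Type*} [NormedAddCommGroup H] [InnerProductSpace ℝ H]
    [CompleteSpace H] [RKHS ℝ H X ℝ] (x : X) (f : H) :
    ⟪RKHS.kerFun H x (1 : ℝ), f⟫ = f x := by
  rw [RKHS.kerFun_inner]; simp

/-- On a lattice ∇* is a difference of two evaluations; on an open set it is represented by the
derivative of the feature map. Apart from the Stein identity, what follows treats both cases at
once. -/
lemma exists_feature (hk : S.RegularKernel (S.ker H)) :
    StronglyMeasurable (fun x : S.Point => RKHS.kerFun H x (1 : ℝ)) ∧
    ∃ Ψ : Fin D → S.Point → H, (∀ d, StronglyMeasurable (Ψ d)) ∧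
      ∀ (d : Fin D) (f : H) (x : S.Point), S.bwd d f x = ⟪Ψ d x, f⟫ := by
  cases S with
  | euclidean X =>
    obtain ⟨h1, Ψ, h2, h3⟩ := exists_continuous_partialDeriv_feature (X := X) H hk
    exact ⟨h1.stronglyMeasurable, Ψ, fun d => (h2 d).stronglyMeasurable, fun d f x => (h3 d f x).2⟩
  | lattice L hL =>
    refine ⟨StronglyMeasurable.of_discrete (α := Fin D → Fin L), fun d x =>
      RKHS.kerFun H x (1 : ℝ)
        - RKHS.kerFun H (show (lattice L hL).Point from cyclicShift hL (L - 1) d x) (1 : ℝ),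
      fun d => StronglyMeasurable.of_discrete (α := Fin D → Fin L), fun d f x => ?_⟩
    rw [inner_sub_left, inner_kerFun_one_left, inner_kerFun_one_left]
    rfl

variable {S H}

/-- The Stein identity. -/
lemma steinMean_ofDensity_eq_zero {Z : Type*} [MeasurableSpace Z] {M : LatentModel S Z}
    (hM : M.Regular) (hk : S.RegularKernel (S.ker H)) (hS : S.SteinClass H M.marginal)
    (f : PiLp 2 (fun _ : Fin D => H)) :
    S.steinMean M.marginal f (S.ofDensity M.marginal) = 0 := by
  unfold steinMean ofDensity
  rw [integral_withDensity_eq_integral_toReal_smul M.measurable_marginal.ennreal_ofReal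
    (ae_of_all _ fun _ => ENNReal.ofReal_lt_top)]
  have h0 : ∀ x, (ENNReal.ofReal (M.marginal x)).toReal • S.steinOp M.marginal
      (fun d y => f d y) x
      = ∑ d, (S.fwd d M.marginal x * f d x + M.marginal x * S.bwd d (f d) x) := by
    intro x
    rw [ENNReal.toReal_ofReal (M.marginal_pos x).le, smul_eq_mul, steinOp, Finset.mul_sum]
    refine Finset.sum_congr rfl fun d _ => ?_
    rw [mul_add, score, ← mul_assoc, mul_inv_cancel_left₀ (M.marginal_pos x).ne']
  simp_rw [h0]
  cases S with
  | euclidean X =>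
    obtain ⟨-, Ψ, -, h3⟩ := exists_continuous_partialDeriv_feature (X := X) H hk
    -- By the product rule the weighted Stein operator is the divergence of p·f.
    have h1 : ∀ (x : X) (d : Fin D), (euclidean X).fwd d M.marginal x * f d x
        + M.marginal x * (euclidean X).bwd d (f d) x
        = partialDeriv d (fun x : X => M.marginal x * f d x) x := fun x d =>
      (partialDeriv_mul (hM.2.1.hasPartialDeriv d x) (h3 d (f d) x).1).symm
    have h2 : ∫ x : X, ∑ d, partialDeriv d (fun x : X => M.marginal x * f d x) x ∂(lebesgueOn X)
        = 0 := by
      rw [integral_finsetSum _ fun d _ => (hS (f d) d).1]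
      exact Finset.sum_eq_zero fun d _ => (hS (f d) d).2
    rw [← h2]
    exact integral_congr_ae (ae_of_all _ fun x => Finset.sum_congr rfl fun d _ => h1 x d)
  | lattice L hL =>
    have h1 : ∀ F : (Fin D → Fin L) → ℝ, ∫ x, F x ∂(Measure.count : Measure (Fin D → Fin L))
        = ∑ x, F x := fun F => by
      rw [integral_fintype (Integrable.of_finite)]
      simp
    refine (h1 _).trans ?_
    rw [Finset.sum_comm]
    refine Finset.sum_eq_zero fun d _ => ?_
    -- The forward difference on p and the backward one on f leave p(x+1)f(x) - p(x)f(x-1), whose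
    -- two sums agree after a shift.
    have h2 := sum_cyclicShift hL d fun x : Fin D → Fin L =>
      M.marginal (cyclicShift hL 1 d x) * f d x
    simp only [cyclicShift_cyclicShift hL (show L - 1 + 1 = L by omega)] at h2
    have h3 : ∀ x : Fin D → Fin L, (lattice L hL).fwd d M.marginal x * f d x
        + M.marginal x * (lattice L hL).bwd d (f d) x
        = M.marginal (cyclicShift hL 1 d x) * f d x
          - M.marginal x * f d (cyclicShift hL (L - 1) d x) := fun x => by
      simp only [fwd, bwd]; ring
    rw [Finset.sum_congr rfl fun x _ => h3 x, Finset.sum_sub_distrib, ← h2, sub_self]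

end DataSpace

/-! ### The Stein kernel as a Gram kernel -/

/-- As `H` need not be separable, strong measurability is built from a finite sum of coordinate
embeddings. -/
lemma stronglyMeasurable_toLp {α : Type*} [MeasurableSpace α] {D : ℕ} {H : Type*}
    [NormedAddCommGroup H] [InnerProductSpace ℝ H] {F : Fin D → α → H}
    (hF : ∀ d, StronglyMeasurable (F d)) :
    StronglyMeasurable fun a => (WithLp.toLp 2 fun d => F d a : PiLp 2 fun _ : Fin D => H) := by
  refine (PiLp.continuous_toLp 2 (fun _ : Fin D => H)).comp_stronglyMeasurable
    (f := fun a d => F d a) ?_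
  have h : (fun a d => F d a) = fun a => ∑ d, Pi.single (M := fun _ : Fin D => H) d (F d a) := by
    ext1 a; exact (Finset.univ_sum_single fun d => F d a).symm
  rw [h]
  refine Finset.stronglyMeasurable_fun_sum _ fun d _ => ?_
  exact (continuous_single d).comp_stronglyMeasurable (hF d)

section CompProd

variable {X Z V : Type*} [MeasurableSpace X] [MeasurableSpace Z] [NormedAddCommGroup V]
  [InnerProductSpace ℝ V] [CompleteSpace V] {R : Measure X} [IsProbabilityMeasure R]
  {κ : Kernel X Z} [IsMarkovKernel κ]

/-- The mean of a Gram kernel under a product of composition-products is the squared norm of the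
mean feature, also when the features themselves are only weakly integrable. -/
lemma integral_inner_compProd {η : X × Z → V} {ξ : X → V} (hξ : Integrable ξ R)
    (hη : ∀ x w, ∫ z, ⟪w, η (x, z)⟫ ∂(κ x) = ⟪w, ξ x⟫)
    (hint : Integrable (fun a : (X × Z) × (X × Z) => ⟪η a.1, η a.2⟫)
      ((R ⊗ₘ κ).prod (R ⊗ₘ κ))) :
    ∫ a : (X × Z) × (X × Z), ⟪η a.1, η a.2⟫ ∂((R ⊗ₘ κ).prod (R ⊗ₘ κ)) = ‖∫ x, ξ x ∂(R)‖ ^ 2 := by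
  set v := ∫ x, ξ x ∂(R) with hv
  -- Freezing one point turns the latent integral into a scalar one that `hη` evaluates, so `η`
  -- itself is never integrated.
  have h1 : ∀ᵐ a ∂(R ⊗ₘ κ), ∫ b, ⟪η a, η b⟫ ∂(R ⊗ₘ κ) = ⟪v, η a⟫ := by
    filter_upwards [hint.prod_right_ae] with a ha
    rw [Measure.integral_compProd ha]
    simp_rw [hη]
    rw [integral_inner hξ, real_inner_comm]
  have h2 : Integrable (fun a => ⟪v, η a⟫) (R ⊗ₘ κ) := hint.integral_prod_left.congr h1
  rw [integral_prod _ hint, integral_congr_ae h1, Measure.integral_compProd h2]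
  simp_rw [hη]
  rw [integral_inner hξ, real_inner_self_eq_norm_sq]

end CompProd

/-- Cauchy–Schwarz, attained at the normalised vector. -/
lemma sSup_abs_inner {V : Type*} [NormedAddCommGroup V] [InnerProductSpace ℝ V] (v : V) :
    sSup {r : ℝ | ∃ f : V, ‖f‖ ≤ 1 ∧ r = |⟪v, f⟫|} = ‖v‖ := by
  refine IsGreatest.csSup_eq ⟨?_, ?_⟩
  · by_cases h : v = 0
    · exact ⟨0, by simp, by simp [h]⟩
    · have h0 : ‖v‖ ≠ 0 := norm_ne_zero_iff.2 h
      refine ⟨‖v‖⁻¹ • v, by rw [norm_smul, norm_inv, norm_norm, inv_mul_cancel₀ h0], ?_⟩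
      rw [inner_smul_right, real_inner_self_eq_norm_sq, sq, inv_mul_cancel_left₀ h0, abs_norm]
  · rintro _ ⟨f, hf, rfl⟩
    exact (abs_real_inner_le_norm v f).trans (mul_le_of_le_one_right (norm_nonneg v) hf)

namespace DataSpace

variable {D : ℕ} {S : DataSpace D} {H : Type*} [NormedAddCommGroup H] [InnerProductSpace ℝ H]
  [CompleteSpace H] [RKHS ℝ H S.Point ℝ]

/-- The element of `Hᴰ` that represents the Stein operator with score vector `u` at `x`, where
`Ψ` represents the difference operators. -/
noncomputable def steinFeature (Ψ : Fin D → S.Point → H) (x : S.Point) (u : Fin D → ℝ) :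
    PiLp 2 (fun _ : Fin D => H) :=
  WithLp.toLp 2 fun d => u d • RKHS.kerFun H x (1 : ℝ) + Ψ d x

lemma ker_left_eq (y : S.Point) : (fun x => S.ker H x y) = (RKHS.kerFun H y (1 : ℝ) : H) := by
  ext x; rw [RKHS.kerFun_apply]; rfl

variable {Ψ : Fin D → S.Point → H} (hΨ : ∀ (d : Fin D) (f : H) x, S.bwd d f x = ⟪Ψ d x, f⟫)

include hΨ in
-- Expanding the product of two sums u·Φ + Ψ in each coordinate produces the four terms of the Stein
-- form.
lemma steinForm_eq_inner (x : S.Point) (u : Fin D → ℝ) (x' : S.Point) (v : Fin D → ℝ) :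
    S.steinForm (S.ker H) x u x' v = ⟪steinFeature Ψ x u, steinFeature Ψ x' v⟫ := by
  have h1 : ∀ a b d, S.kerGrad (S.ker H) a b d = ⟪Ψ d a, RKHS.kerFun H b (1 : ℝ)⟫ := by
    intro a b d
    rw [kerGrad, ker_left_eq, hΨ]
  have h2 : S.kerGradTrace (S.ker H) x x' = ∑ d, ⟪Ψ d x, Ψ d x'⟫ := by
    refine Finset.sum_congr rfl fun d _ => ?_
    have h3 : (fun y => S.bwd d (fun z => S.ker H z y) x) = (Ψ d x : H) := by
      ext y
      rw [ker_left_eq, hΨ, ← inner_kerFun_one_left y, real_inner_comm]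
    rw [h3, hΨ, real_inner_comm]
  have h4 : S.ker H x x' = ⟪RKHS.kerFun H x (1 : ℝ), RKHS.kerFun H x' (1 : ℝ)⟫ := by
    rw [inner_kerFun_one_left, ← ker_left_eq]
  rw [steinForm, h2, h4, PiLp.inner_apply, Finset.sum_mul, ← Finset.sum_add_distrib,
    ← Finset.sum_add_distrib, ← Finset.sum_add_distrib]
  refine Finset.sum_congr rfl fun d _ => ?_
  simp only [steinFeature, h1, inner_add_left, inner_add_right, real_inner_smul_left,
    real_inner_smul_right]
  rw [real_inner_comm (RKHS.kerFun H x (1 : ℝ)) (Ψ d x')]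
  ring

include hΨ in
lemma steinOp_eq_inner (p : S.Point → ℝ) (f : PiLp 2 (fun _ : Fin D => H)) (x : S.Point) :
    S.steinOp p (fun d y => f d y) x = ⟪steinFeature Ψ x (S.score p x), f⟫ := by
  rw [steinOp, PiLp.inner_apply]
  refine Finset.sum_congr rfl fun d _ => ?_
  rw [show (fun y => f d y) = (f d : S.Point → ℝ) from rfl, hΨ]
  simp only [steinFeature, inner_add_left, real_inner_smul_left, inner_kerFun_one_left]

lemma stronglyMeasurable_steinFeature (hΦ : StronglyMeasurable fun x => RKHS.kerFun H x (1 : ℝ))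
    (hΨm : ∀ d, StronglyMeasurable (Ψ d)) {α : Type*} [MeasurableSpace α] {x : α → S.Point}
    (hx : Measurable x) {u : α → Fin D → ℝ} (hu : ∀ d, Measurable fun a => u a d) :
    StronglyMeasurable fun a => steinFeature Ψ (x a) (u a) :=
  stronglyMeasurable_toLp fun d =>
    ((hu d).stronglyMeasurable.smul (hΦ.comp_measurable hx)).add ((hΨm d).comp_measurable hx)

lemma inner_steinFeature (w : PiLp 2 (fun _ : Fin D => H)) (x : S.Point) (u : Fin D → ℝ) :
    ⟪w, steinFeature Ψ x u⟫ = ∑ d, (u d * w d x + ⟪w d, Ψ d x⟫) := by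
  rw [PiLp.inner_apply]
  refine Finset.sum_congr rfl fun d _ => ?_
  simp only [steinFeature, inner_add_right, real_inner_smul_right]
  rw [real_inner_comm, inner_kerFun_one_left]

/-- The feature is affine in the score and the weights sum to one, so the `Ψ` part is unchanged. -/
lemma steinFeature_average {m : ℕ} (hm : 1 ≤ m) (x : S.Point) (u : Fin m → Fin D → ℝ) :
    steinFeature Ψ x (fun d => (m : ℝ)⁻¹ * ∑ j, u j d)
      = (m : ℝ)⁻¹ • ∑ j, steinFeature Ψ x (u j) := by
  have hm0 : (m : ℝ) ≠ 0 := by positivity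
  refine ext_inner_left ℝ fun w => ?_
  rw [inner_smul_right, inner_sum]
  simp only [inner_steinFeature]
  rw [Finset.sum_comm, Finset.mul_sum]
  refine Finset.sum_congr rfl fun d _ => ?_
  rw [Finset.sum_add_distrib, Finset.sum_const, Finset.card_univ, Fintype.card_fin, nsmul_eq_mul,
    mul_add, inv_mul_cancel_left₀ hm0, ← Finset.sum_mul, mul_assoc]

section Model

variable {Z : Type*} [MeasurableSpace Z] {M : LatentModel S Z}

include hΨ in
lemma latentKernel_eq_inner (a b : S.Point × Z) : M.latentKernel (S.ker H) a b
    = ⟪steinFeature Ψ a.1 (S.score (M.lik a.2) a.1), steinFeature Ψ b.1 (S.score (M.lik b.2) b.1)⟫ :=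
  steinForm_eq_inner hΨ _ _ _ _

include hΨ in
lemma avgKernel_eq_inner {m : ℕ} (a b : S.Point × (Fin m → Z)) : M.avgKernel (S.ker H) a b
    = ⟪steinFeature Ψ a.1 (M.avgScore a.1 a.2), steinFeature Ψ b.1 (M.avgScore b.1 b.2)⟫ :=
  steinForm_eq_inner hΨ _ _ _ _

include hΨ in
lemma avgKernel_eq_sum {m : ℕ} (hm : 1 ≤ m) (a b : S.Point × (Fin m → Z)) :
    M.avgKernel (S.ker H) a b
      = (m : ℝ)⁻¹ * ((m : ℝ)⁻¹ * ∑ i, ∑ j, M.latentKernel (S.ker H) (a.1, a.2 i) (b.1, b.2 j)) := by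
  simp_rw [avgKernel_eq_inner hΨ, latentKernel_eq_inner hΨ]
  have h : ∀ a : S.Point × (Fin m → Z), steinFeature Ψ a.1 (M.avgScore a.1 a.2)
      = (m : ℝ)⁻¹ • ∑ j, steinFeature Ψ a.1 (S.score (M.lik (a.2 j)) a.1) := fun a =>
    steinFeature_average hm a.1 fun j => S.score (M.lik (a.2 j)) a.1
  rw [h, h, real_inner_smul_left, real_inner_smul_right, sum_inner]
  simp_rw [inner_sum]

include hΨ in
-- The diagonal of the Stein kernel is the squared norm of the feature, so its integrability puts
-- the feature in `L²`.
lemma integrable_steinFeature (hM : M.Regular)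
    (hΦ : StronglyMeasurable fun x => RKHS.kerFun H x (1 : ℝ))
    (hΨm : ∀ d, StronglyMeasurable (Ψ d)) {R : Measure S.Point} [IsProbabilityMeasure R]
    (hdiag : Integrable (fun x => S.steinKernel (S.ker H) M.marginal x x) R) :
    Integrable (fun x => steinFeature Ψ x (S.score M.marginal x)) R := by
  have hsm := stronglyMeasurable_steinFeature hΦ hΨm measurable_id
    (fun d => LatentModel.measurable_score_marginal hM d)
  refine MemLp.integrable (q := 2) (by norm_num) ?_
  refine (memLp_two_iff_integrable_sq_norm hsm.aestronglyMeasurable).2 ?_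
  refine hdiag.congr (ae_of_all _ fun x => ?_)
  simp only [steinKernel, id]
  rw [steinForm_eq_inner hΨ, real_inner_self_eq_norm_sq]

include hΨ in
-- The Stein identity removes the model mean; the data mean is the inner product of `f` with the
-- mean feature.
lemma ksd_eq_norm (hM : M.Regular) (hk : S.RegularKernel (S.ker H))
    (hS : S.SteinClass H M.marginal) {R : Measure S.Point}
    (hint : Integrable (fun x => steinFeature Ψ x (S.score M.marginal x)) R) :
    S.ksd H M.marginal R = ‖∫ x, steinFeature Ψ x (S.score M.marginal x) ∂(R)‖ := by
  rw [← sSup_abs_inner, ksd]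
  congr! 7 with r f
  rw [steinMean_ofDensity_eq_zero hM hk hS, sub_zero, steinMean]
  simp_rw [steinOp_eq_inner hΨ, real_inner_comm f]
  rw [integral_inner hint]

lemma integral_inner_steinFeature (hM : M.Regular) (x : S.Point)
    (w : PiLp 2 (fun _ : Fin D => H)) :
    ∫ z, ⟪w, steinFeature Ψ x (S.score (M.lik z) x)⟫ ∂(M.posterior x)
      = ⟪w, steinFeature Ψ x (S.score M.marginal x)⟫ := by
  simp_rw [inner_steinFeature]
  have h1 := fun d => (LatentModel.integral_score_posterior hM x d).1.mul_const (w d x)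
  have h2 : ∀ d, Integrable (fun z => S.score (M.lik z) x d * w d x + ⟪w d, Ψ d x⟫)
      (M.posterior x) := fun d => (h1 d).add (integrable_const _)
  rw [integral_finsetSum _ fun d _ => h2 d]
  refine Finset.sum_congr rfl fun d _ => ?_
  rw [integral_add (h1 d) (integrable_const _), integral_mul_const,
    (LatentModel.integral_score_posterior hM x d).2]
  simp

/-- The closed form of the squared kernel Stein discrepancy of a latent variable model. -/
lemma integral_latentKernel (hM : M.Regular) (hk : S.RegularKernel (S.ker H))
    (hS : S.SteinClass H M.marginal) {R : Measure S.Point} [IsProbabilityMeasure R]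
    (hdiag : Integrable (fun x => S.steinKernel (S.ker H) M.marginal x x) R)
    (hint : Integrable (fun a => M.latentKernel (S.ker H) a.1 a.2)
      ((R ⊗ₘ M.posterior).prod (R ⊗ₘ M.posterior))) :
    ∫ a, M.latentKernel (S.ker H) a.1 a.2 ∂((R ⊗ₘ M.posterior).prod (R ⊗ₘ M.posterior))
      = S.ksd H M.marginal R ^ 2 := by
  obtain ⟨hΦ, Ψ, hΨm, hΨ⟩ := exists_feature S H hk
  have h1 := integrable_steinFeature hΨ hM hΦ hΨm hdiag
  rw [ksd_eq_norm hΨ hM hk hS h1]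
  simp_rw [latentKernel_eq_inner hΨ] at hint ⊢
  exact integral_inner_compProd (η := fun a => steinFeature Ψ a.1 (S.score (M.lik a.2) a.1)) h1
    (fun x w => integral_inner_steinFeature hM x w) hint

omit [CompleteSpace H] in
lemma ksd_nonneg (p : S.Point → ℝ) (R : Measure S.Point) : 0 ≤ S.ksd H p R :=
  Real.sSup_nonneg fun _ ⟨_, _, h⟩ => h ▸ abs_nonneg _

/-- The mean of the kernel built from averaged scores. -/
lemma integral_avgKernel (hM : M.Regular) (hk : S.RegularKernel (S.ker H))
    (hS : S.SteinClass H M.marginal) {R : Measure S.Point} [IsProbabilityMeasure R]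
    (hdiag : Integrable (fun x => S.steinKernel (S.ker H) M.marginal x x) R)
    (hint : Integrable (fun a => M.latentKernel (S.ker H) a.1 a.2)
      ((R ⊗ₘ M.posterior).prod (R ⊗ₘ M.posterior)))
    {m : ℕ} (hm : 1 ≤ m) {Y : Type*} [MeasurableSpace Y] {γ : Measure Y} [IsProbabilityMeasure γ]
    {x : Y → S.Point} {z : Y → Fin m → Z} (hx : Measurable x) (hz : Measurable z)
    (hγ : ∀ j, γ.map (fun y => (x y, z y j)) = R ⊗ₘ M.posterior) :
    Integrable (fun a : Y × Y => M.avgKernel (S.ker H) (x a.1, z a.1) (x a.2, z a.2)) (γ.prod γ) ∧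
    ∫ a : Y × Y, M.avgKernel (S.ker H) (x a.1, z a.1) (x a.2, z a.2) ∂(γ.prod γ)
      = S.ksd H M.marginal R ^ 2 := by
  obtain ⟨-, Ψ, -, hΨ⟩ := exists_feature S H hk
  have hm0 : (m : ℝ) ≠ 0 := by positivity
  have hmeas : ∀ j, Measurable fun y => (x y, z y j) := fun j =>
    hx.prodMk ((measurable_pi_apply j).comp hz)
  -- The two points are independent under the product law, so only the law of each pair (x, z_j)
  -- matters; dependence among the latent samples at one point is irrelevant.
  have hmap : ∀ i j, (γ.prod γ).map (Prod.map (fun y => (x y, z y i)) fun y => (x y, z y j))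
      = (R ⊗ₘ M.posterior).prod (R ⊗ₘ M.posterior) := fun i j => by
    rw [← Measure.map_prod_map _ _ (hmeas i) (hmeas j), hγ, hγ]
  have h1 : ∀ i j, Integrable (fun a : Y × Y =>
      M.latentKernel (S.ker H) (x a.1, z a.1 i) (x a.2, z a.2 j)) (γ.prod γ) := fun i j => by
    rw [← hmap i j] at hint
    exact hint.comp_measurable ((hmeas i).prodMap (hmeas j))
  have h2 : ∀ i j, ∫ a : Y × Y,
      M.latentKernel (S.ker H) (x a.1, z a.1 i) (x a.2, z a.2 j) ∂(γ.prod γ)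
      = S.ksd H M.marginal R ^ 2 := fun i j => by
    rw [← integral_latentKernel hM hk hS hdiag hint, ← hmap i j, integral_map]
    · rfl
    · exact ((hmeas i).prodMap (hmeas j)).aemeasurable
    · rw [hmap]; exact hint.1
  simp_rw [avgKernel_eq_sum hΨ hm]
  have h3 : Integrable (fun a : Y × Y => ∑ i, ∑ j,
      M.latentKernel (S.ker H) (x a.1, z a.1 i) (x a.2, z a.2 j)) (γ.prod γ) :=
    integrable_finsetSum _ fun i _ => integrable_finsetSum _ fun j _ => h1 i j
  refine ⟨(h3.const_mul _).const_mul _, ?_⟩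
  rw [integral_const_mul, integral_const_mul,
    integral_finsetSum _ fun i _ => integrable_finsetSum _ fun j _ => h1 i j]
  simp_rw [integral_finsetSum _ fun j _ => h1 _ j, h2]
  simp only [Finset.sum_const, Finset.card_univ, Fintype.card_fin, nsmul_eq_mul]
  field_simp

lemma measurable_avgKernel (hM : M.Regular) (hk : S.RegularKernel (S.ker H)) {m : ℕ} :
    Measurable fun a : (S.Point × (Fin m → Z)) × (S.Point × (Fin m → Z)) =>
      M.avgKernel (S.ker H) a.1 a.2 := by
  obtain ⟨hΦ, Ψ, hΨm, hΨ⟩ := exists_feature S H hk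
  have h : StronglyMeasurable fun a : S.Point × (Fin m → Z) =>
      steinFeature Ψ a.1 (M.avgScore a.1 a.2) := by
    refine stronglyMeasurable_steinFeature hΦ hΨm measurable_fst fun d => ?_
    refine Measurable.const_mul (Finset.measurable_fun_sum _ fun j _ => ?_) _
    exact (LatentModel.measurable_score_lik hM d).comp
      (measurable_fst.prodMk ((measurable_pi_apply j).comp measurable_snd))
  simp_rw [avgKernel_eq_inner hΨ]
  exact ((h.comp_measurable measurable_fst).inner (h.comp_measurable measurable_snd)).measurable

lemma avgKernel_comm (hk : S.RegularKernel (S.ker H)) {m : ℕ} (a b : S.Point × (Fin m → Z)) :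
    M.avgKernel (S.ker H) a b = M.avgKernel (S.ker H) b a := by
  obtain ⟨-, Ψ, -, hΨ⟩ := exists_feature S H hk
  rw [avgKernel_eq_inner hΨ, avgKernel_eq_inner hΨ, real_inner_comm]

end Model

end DataSpace

/-! ### The kernel of the relative test -/

section DiffKernel

variable {D : ℕ} {S : DataSpace D} {H : Type*} [NormedAddCommGroup H] [InnerProductSpace ℝ H]
  [CompleteSpace H] [RKHS ℝ H S.Point ℝ] {Z W : Type*} [MeasurableSpace Z] [MeasurableSpace W]
  {P : LatentModel S Z} {Q : LatentModel S W} {m : ℕ}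

lemma measurable_diffKernel (hP : P.Regular) (hQ : Q.Regular) (hk : S.RegularKernel (S.ker H)) :
    Measurable (Function.uncurry (diffKernel P Q (S.ker H) (m := m))) := by
  have h1 := (DataSpace.measurable_avgKernel hP hk (m := m)).comp
    (f := fun a : (S.Point × (Fin m → Z) × (Fin m → W)) × (S.Point × (Fin m → Z) ×
      (Fin m → W)) => ((a.1.1, a.1.2.1), (a.2.1, a.2.2.1))) (by fun_prop)
  have h2 := (DataSpace.measurable_avgKernel hQ hk (m := m)).comp
    (f := fun a : (S.Point × (Fin m → Z) × (Fin m → W)) × (S.Point × (Fin m → Z) ×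
      (Fin m → W)) => ((a.1.1, a.1.2.2), (a.2.1, a.2.2.2))) (by fun_prop)
  simp only [Function.comp_def] at h1 h2
  exact h1.sub h2

lemma diffKernel_comm (hk : S.RegularKernel (S.ker H)) (a b : S.Point × (Fin m → Z) × (Fin m → W)) :
    diffKernel P Q (S.ker H) a b = diffKernel P Q (S.ker H) b a := by
  rw [diffKernel, DataSpace.avgKernel_comm hk, DataSpace.avgKernel_comm hk (M := Q), diffKernel]

end DiffKernel

/-! ### Eventual bounds from finite limits superior -/

section Moments

variable {α : Type*} [MeasurableSpace α]

lemma integrable_of_lintegral_ofReal_le {f : α → ℝ} {μ : Measure α}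
    (hf : AEStronglyMeasurable f μ) (h0 : ∀ x, 0 ≤ f x) {C : ℝ≥0∞} (hC : C ≠ ∞)
    (h : ∫⁻ x, ENNReal.ofReal (f x) ∂μ ≤ C) : Integrable f μ ∧ ∫ x, f x ∂μ ≤ C.toReal := by
  refine ⟨⟨hf, ?_⟩, ?_⟩
  · rw [hasFiniteIntegral_iff_ofReal (ae_of_all _ h0)]
    exact h.trans_lt hC.lt_top
  · rw [integral_eq_lintegral_of_nonneg_ae (ae_of_all _ h0) hf]
    exact ENNReal.toReal_mono hC h

/-- A finite limit superior of integrals of nonnegative functions bounds almost all of them. -/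
lemma exists_eventually_integral_le {ι : Type*} {l : Filter ι} {μ : ι → Measure α} {f : α → ℝ}
    (hf : Measurable f) (h0 : ∀ x, 0 ≤ f x)
    (h : limsup (fun k => ∫⁻ x, ENNReal.ofReal (f x) ∂(μ k)) l < ∞) :
    ∃ C : ℝ, ∀ᶠ k in l, Integrable f (μ k) ∧ ∫ x, f x ∂(μ k) ≤ C := by
  obtain ⟨C, h1, h2⟩ := exists_between h
  refine ⟨C.toReal, ?_⟩
  filter_upwards [eventually_lt_of_limsup_lt h1] with k hk
  exact integrable_of_lintegral_ofReal_le hf.aestronglyMeasurable h0 h2.ne hk.le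

end Moments

theorem corollary1
    -- data space, reproducing kernel Hilbert space, latent variable models
    {D : ℕ} (S : DataSpace D)
    (H : Type*) [NormedAddCommGroup H] [InnerProductSpace ℝ H] [CompleteSpace H]
    [RKHS ℝ H S.Point ℝ] (hk : S.RegularKernel (S.ker H))
    {Z W : Type*}
    [TopologicalSpace Z] [PolishSpace Z] [MeasurableSpace Z] [BorelSpace Z]
    [TopologicalSpace W] [PolishSpace W] [MeasurableSpace W] [BorelSpace W]
    (P : LatentModel S Z) (Q : LatentModel S W) (hP : P.Regular) (hQ : Q.Regular)
    (hPstein : S.SteinClass H P.marginal) (hQstein : S.SteinClass H Q.marginal)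
    -- data distribution, for which the two discrepancies have their closed forms
    (R : Measure S.Point) [IsProbabilityMeasure R]
    (hPdiag : Integrable (fun x => S.steinKernel (S.ker H) P.marginal x x) R)
    (hQdiag : Integrable (fun x => S.steinKernel (S.ker H) Q.marginal x x) R)
    (hPint : Integrable (fun a => P.latentKernel (S.ker H) a.1 a.2)
      ((R ⊗ₘ P.posterior).prod (R ⊗ₘ P.posterior)))
    (hQint : Integrable (fun a => Q.latentKernel (S.ker H) a.1 a.2)
      ((R ⊗ₘ Q.posterior).prod (R ⊗ₘ Q.posterior)))
    -- law of the latent samples given the observation, after `t` burn-in steps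
    {m : ℕ} (hm : 1 ≤ m)
    (κ : ℕ → Kernel S.Point ((Fin m → Z) × (Fin m → W))) [∀ t, IsMarkovKernel (κ t)]
    -- target law, under which the latent samples have the exact posteriors as their laws
    (γ : Measure (S.Point × (Fin m → Z) × (Fin m → W))) [IsProbabilityMeasure γ]
    (hγP : ∀ j, γ.map (fun y => (y.1, y.2.1 j)) = R ⊗ₘ P.posterior)
    (hγQ : ∀ j, γ.map (fun y => (y.1, y.2.2 j)) = R ⊗ₘ Q.posterior)
    -- the way in which `(n, t)` tends to infinity
    (l : Filter (ℕ × ℕ)) (hl : l ≤ atTop ×ˢ atTop)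
    -- moment, variance and bias conditions on the U-statistic
    (hmom3 : limsup (fun t => eLpNorm
      (fun a : (S.Point × (Fin m → Z) × (Fin m → W)) × (S.Point × (Fin m → Z) × (Fin m → W)) =>
        diffKernel P Q (S.ker H) a.1 a.2 - kerMean (diffKernel P Q (S.ker H)) (R ⊗ₘ κ t))
      3 ((R ⊗ₘ κ t).prod (R ⊗ₘ κ t))) atTop < ∞)
    (σ : ℝ) (hσ : 0 < σ)
    (hvar : Tendsto (fun t => projVar (diffKernel P Q (S.ker H)) (R ⊗ₘ κ t)) atTop (𝓝 (σ ^ 2)))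
    (hbias : Tendsto (fun nt : ℕ × ℕ => √(nt.1 : ℝ) *
        (kerMean (diffKernel P Q (S.ker H)) (R ⊗ₘ κ nt.2) - kerMean (diffKernel P Q (S.ker H)) γ))
      l (𝓝 0))
    -- moment conditions for the variance estimator
    (hPmom2 : limsup (fun t => ∫⁻ y, ENNReal.ofReal
      (P.avgKernel (S.ker H) (y.1, y.2.1) (y.1, y.2.1) ^ 2) ∂(R ⊗ₘ κ t)) atTop < ∞)
    (hQmom2 : limsup (fun t => ∫⁻ y, ENNReal.ofReal
      (Q.avgKernel (S.ker H) (y.1, y.2.2) (y.1, y.2.2) ^ 2) ∂(R ⊗ₘ κ t)) atTop < ∞)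
    (hmom4 : limsup (fun t => ∫⁻ a, ENNReal.ofReal
      (diffKernel P Q (S.ker H) a.1 a.2 ^ 4) ∂((R ⊗ₘ κ t).prod (R ⊗ₘ κ t))) atTop < ∞)
    -- the samples: for each `t` an i.i.d. sequence of copies of `(x, z^(t), w^(t))`
    {Ω : Type*} [MeasurableSpace Ω] (Pr : Measure Ω) [IsProbabilityMeasure Pr]
    (Y : ℕ → ℕ → Ω → S.Point × (Fin m → Z) × (Fin m → W))
    (hYlaw : ∀ t i, HasLaw (Y t i) (R ⊗ₘ κ t) Pr)
    (hYindep : ∀ t, iIndepFun (Y t) Pr) :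
    -- asymptotic normality of the studentized statistic
    TendstoInDistribution
      (fun (nt : ℕ × ℕ) (ω : Ω) =>
        √(nt.1 : ℝ) *
          (uStat (diffKernel P Q (S.ker H)) nt.1 (fun i => Y nt.2 i ω)
            - (S.ksd H P.marginal R ^ 2 - S.ksd H Q.marginal R ^ 2)) /
          sigmaEst (diffKernel P Q (S.ker H)) nt.1 (fun i => Y nt.2 i ω))
      l (fun x : ℝ => x) (fun _ => Pr) (gaussianReal 0 1)
    ∧
    -- asymptotic level and consistency of the test
    ∀ α ∈ Set.Ioo (0 : ℝ) 1, ∀ τ : ℝ, cdf (gaussianReal 0 1) τ = 1 - α →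
      (S.ksd H P.marginal R ≤ S.ksd H Q.marginal R →
        ∃ ℓ ≤ α, Tendsto (fun nt : ℕ × ℕ => Pr.real {ω | τ <
            √(nt.1 : ℝ) * uStat (diffKernel P Q (S.ker H)) nt.1 (fun i => Y nt.2 i ω) /
              sigmaEst (diffKernel P Q (S.ker H)) nt.1 (fun i => Y nt.2 i ω)}) l (𝓝 ℓ)) ∧
      (S.ksd H Q.marginal R < S.ksd H P.marginal R →
        Tendsto (fun nt : ℕ × ℕ => Pr.real {ω | τ <
            √(nt.1 : ℝ) * uStat (diffKernel P Q (S.ker H)) nt.1 (fun i => Y nt.2 i ω) /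
              sigmaEst (diffKernel P Q (S.ker H)) nt.1 (fun i => Y nt.2 i ω)}) l (𝓝 1)) := by
  set h : S.Point × (Fin m → Z) × (Fin m → W) → S.Point × (Fin m → Z) × (Fin m → W) → ℝ :=
    diffKernel P Q (S.ker H) with hdef
  set μ := S.ksd H P.marginal R ^ 2 - S.ksd H Q.marginal R ^ 2 with hμdef
  have hm' : Measurable (Function.uncurry h) := measurable_diffKernel hP hQ hk
  have hs : ∀ a b, h a b = h b a := diffKernel_comm hk
  -- Under the target law the kernel mean is exactly the difference of squared discrepancies, so the
  -- bias condition is about `μ`.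
  have hθ : kerMean h γ = μ := by
    obtain ⟨i1, e1⟩ := DataSpace.integral_avgKernel hP hk hPstein hPdiag hPint hm
      (x := fun y : S.Point × (Fin m → Z) × (Fin m → W) => y.1) (z := fun y => y.2.1)
      measurable_fst measurable_snd.fst hγP
    obtain ⟨i2, e2⟩ := DataSpace.integral_avgKernel hQ hk hQstein hQdiag hQint hm
      (x := fun y : S.Point × (Fin m → Z) × (Fin m → W) => y.1) (z := fun y => y.2.2)
      measurable_fst measurable_snd.snd hγQ
    rw [hμdef, ← e1, ← e2, ← integral_sub i1 i2]
    rfl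
  obtain ⟨C4, hC4⟩ := exists_eventually_integral_le (f := fun a => Function.uncurry h a ^ 4)
    (hm'.pow_const 4) (fun a => by positivity) hmom4
  have hmP : Measurable fun y : S.Point × (Fin m → Z) × (Fin m → W) =>
      P.avgKernel (S.ker H) (y.1, y.2.1) (y.1, y.2.1) :=
    (DataSpace.measurable_avgKernel hP hk).comp
      (g := fun a : (S.Point × (Fin m → Z)) × (S.Point × (Fin m → Z)) =>
        P.avgKernel (S.ker H) a.1 a.2)
      (f := fun y : S.Point × (Fin m → Z) × (Fin m → W) => ((y.1, y.2.1), (y.1, y.2.1)))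
      (by fun_prop)
  have hmQ : Measurable fun y : S.Point × (Fin m → Z) × (Fin m → W) =>
      Q.avgKernel (S.ker H) (y.1, y.2.2) (y.1, y.2.2) :=
    (DataSpace.measurable_avgKernel hQ hk).comp
      (g := fun a : (S.Point × (Fin m → W)) × (S.Point × (Fin m → W)) =>
        Q.avgKernel (S.ker H) a.1 a.2)
      (f := fun y : S.Point × (Fin m → Z) × (Fin m → W) => ((y.1, y.2.2), (y.1, y.2.2)))
      (by fun_prop)
  obtain ⟨CP, hCP⟩ := exists_eventually_integral_le (hmP.pow_const 2)
    (fun a => by positivity) hPmom2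
  obtain ⟨CQ, hCQ⟩ := exists_eventually_integral_le (hmQ.pow_const 2)
    (fun a => by positivity) hQmom2
  have hM : ∀ᶠ t in atTop, MemLp (Function.uncurry h) 4 ((R ⊗ₘ κ t).prod (R ⊗ₘ κ t)) ∧
      ∫ z, Function.uncurry h z ^ 4 ∂((R ⊗ₘ κ t).prod (R ⊗ₘ κ t)) ≤ C4 := by
    filter_upwards [hC4] with t ht
    exact ⟨memLp_four_of_integrable_pow hm'.aestronglyMeasurable ht.1, ht.2⟩
  have hN : ∀ᶠ t in atTop, MemLp (fun y => h y y) 2 (R ⊗ₘ κ t) ∧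
      ∫ y, h y y ^ 2 ∂(R ⊗ₘ κ t) ≤ 2 * CP + 2 * CQ := by
    filter_upwards [hCP, hCQ] with t hp hq
    have mp := (memLp_two_iff_integrable_sq hmP.aestronglyMeasurable).2 hp.1
    have mq := (memLp_two_iff_integrable_sq hmQ.aestronglyMeasurable).2 hq.1
    have hle := integral_sq_sub_le mp mq
    exact ⟨mp.sub mq, hle.trans (by linarith [hp.2, hq.2])⟩
  -- a countably generated filter along which the assumptions hold
  set g : ℕ × ℕ → ℝ := fun nt => √(nt.1 : ℝ) * (kerMean h (R ⊗ₘ κ nt.2) - μ) with hg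
  have hbias' : Tendsto g l (𝓝 0) := by rw [hθ] at hbias; exact hbias
  set l' : Filter (ℕ × ℕ) := (atTop ×ˢ atTop) ⊓ comap g (𝓝 0) with hl'
  -- Limits along `l'` are inherited by the finer filter `l`.
  have hle : l ≤ l' := le_inf hl hbias'.le_comap
  have hn : Tendsto (fun nt : ℕ × ℕ => nt.1) l' atTop := tendsto_fst.mono_left inf_le_left
  have ht : Tendsto (fun nt : ℕ × ℕ => nt.2) l' atTop := tendsto_snd.mono_left inf_le_left
  have hμ : Tendsto g l' (𝓝 0) := tendsto_comap.mono_left inf_le_right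
  constructor
  · have hfin := tendstoInDistribution_studentized (X := fun nt : ℕ × ℕ => Y nt.2)
      (γ := fun nt : ℕ × ℕ => R ⊗ₘ κ nt.2) hn (fun nt => hYlaw nt.2) (fun nt => hYindep nt.2) hm'
      (ht.eventually hM) hs (ht.eventually hN) hσ (hvar.comp ht) hμ
    exact ⟨hfin.forall_aemeasurable, hfin.aemeasurable_limit, hfin.tendsto.mono_left hle⟩
  · intro α hα τ hτ
    obtain ⟨h0, h1⟩ := tendsto_rejection_probability (X := fun nt : ℕ × ℕ => Y nt.2)
      (γ := fun nt : ℕ × ℕ => R ⊗ₘ κ nt.2) hn (fun nt => hYlaw nt.2) (fun nt => hYindep nt.2) hm'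
      (ht.eventually hM) hs (ht.eventually hN) hσ (hvar.comp ht) hμ hα.1 hτ
    refine ⟨fun hH => ?_, fun hH => ?_⟩
    -- Discrepancies are nonnegative, so comparing them is the same as comparing their squares.
    · obtain ⟨ℓ, hℓ, hlim⟩ := h0 (sub_nonpos.2 (pow_le_pow_left₀ (DataSpace.ksd_nonneg _ _) hH 2))
      exact ⟨ℓ, hℓ, hlim.mono_left hle⟩
    · exact (h1 (sub_pos.2 (pow_lt_pow_left₀ hH (DataSpace.ksd_nonneg _ _)
        two_ne_zero))).mono_left hle
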